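/- Let $M$ be a connected oriented smooth surface without boundary, equipped with a smooth Riemannian metric $g$. Let $SM=\{(x,v)\in TM : g(v,v)=1\}$ be its unit tangent bundle with projection $\pi: SM\to M$, let $X$ be the geodesic vector field of $g$ on $SM$, and let $V$ be the vertical vector field, i.e. the infinitesimal generator of the $\mathrm{SO}(2)$-action $(x,v)\mapsto (x,\cos t\, v+\sin t\, Jv)$, where $J$ is the rotation by $+\pi/2$. For $m\in\mathbb{Z}$ let $\mathcal{H}_m$ be the kernel of the operator $m\,\mathrm{Id}+iV$ on $C^\infty(SM,\mathbb{C})$, i.e. the space of smooth functions $u:SM\to\mathbb{C}$ with $Vu=imu$. Let $\lambda\in C^\infty(SM,\mathbb{R})$, and call the thermostat generated by the vector field $F=X+\lambda V$ on $SM$ projective if there is a smooth torsion-free connection $\nabla$ on $TM$ such that for every orbit $\gamma: I\to SM$ of $F$ ($I$ an open interval) there is a reparametrisation (a diffeomorphism of open intervals) $\varphi: I'\to I$ for which $\pi\circ\gamma\circ\varphi: I'\to M$ is a geodesic of $\nabla$. Then the thermostat $F=X+\lambda V$ is projective if and only if $$\lambda\in\mathcal{H}_{-1}\oplus\mathcal{H}_{1}\oplus\mathcal{H}_{-3}\oplus\mathcal{H}_{3}.$$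 -/

import Mathlib

set_option linter.unusedSectionVars false
open Bundle Manifold
open scoped ContDiff Topology

namespace RiemannianGeometry

section LeviCivita

variable {E : Type*} [NormedAddCommGroup E] [NormedSpace ℝ E] [FiniteDimensional ℝ E]
  {H : Type*} [TopologicalSpace H] {I : ModelWithCorners ℝ E H}
  {M : Type*} [TopologicalSpace M] [ChartedSpace H M] [IsManifold I ∞ M]
  [RiemannianBundle (fun x : M ↦ TangentSpace I x)]
  [IsContMDiffRiemannianBundle I ∞ E (fun x : M ↦ TangentSpace I x)]

variable (I) in
/-- The right-hand side of the Koszul formula for `2 ⟨∇_U Y, W⟩`, at the point `x`. -/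
noncomputable def koszul (Y U W : Π x : M, TangentSpace I x) (x : M) : ℝ :=
  d% (fun y : M ↦ inner ℝ (Y y) (W y)) x (U x)
    + d% (fun y : M ↦ inner ℝ (U y) (W y)) x (Y x)
    - d% (fun y : M ↦ inner ℝ (U y) (Y y)) x (W x)
    + inner ℝ (VectorField.mlieBracket I U Y x) (W x)
    - inner ℝ (VectorField.mlieBracket I U W x) (Y x)
    - inner ℝ (VectorField.mlieBracket I Y W x) (U x)

/-- The inner product of two differentiable vector fields is differentiable. -/
theorem mdifferentiableAt_inner {U W : Π x : M, TangentSpace I x} {x : M}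
    (hU : MDiffAt (T% U) x) (hW : MDiffAt (T% W) x) :
    MDiffAt (fun y : M ↦ (inner ℝ (U y) (W y) : ℝ)) x :=
  MDifferentiableAt.inner_bundle (IB := I) (F := E) (E := fun x : M ↦ TangentSpace I x)
    (b := fun y : M ↦ y) hU hW

/-- The Koszul expression is tensorial in `U`. -/
theorem koszul_tensorial_left {Y W : Π x : M, TangentSpace I x} {x : M}
    (hY : MDiffAt (T% Y) x) (hW : MDiffAt (T% W) x) :
    TensorialAt I E (fun U ↦ koszul I Y U W x) x where
  smul {f U} hf hU := by
    simp [koszul, inner_smul_left, mvfderiv_fun_mul hf (mdifferentiableAt_inner hU hW),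
      mvfderiv_fun_mul hf (mdifferentiableAt_inner hU hY), inner_add_left,
      VectorField.mlieBracket_smul_left hf hU, inner_smul_right]
    rw [real_inner_comm (W x) (U x), real_inner_comm (Y x) (U x)]
    ring
  add {U U'} hU hU' := by
    simp [koszul, mvfderiv_fun_add (mdifferentiableAt_inner hU hW) (mdifferentiableAt_inner hU' hW),
      mvfderiv_fun_add (mdifferentiableAt_inner hU hY) (mdifferentiableAt_inner hU' hY), inner_add_left, inner_add_right,
      VectorField.mlieBracket_add_left hU hU']
    ring

/-- The Koszul expression is tensorial in `W`. -/
theorem koszul_tensorial_right {Y U : Π x : M, TangentSpace I x} {x : M}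
    (hY : MDiffAt (T% Y) x) (hU : MDiffAt (T% U) x) :
    TensorialAt I E (fun W ↦ koszul I Y U W x) x where
  smul {f W} hf hW := by
    simp [koszul, inner_smul_right, mvfderiv_fun_mul hf (mdifferentiableAt_inner hY hW),
      mvfderiv_fun_mul hf (mdifferentiableAt_inner hU hW), inner_add_left,
      VectorField.mlieBracket_smul_right hf hW, inner_smul_left]
    rw [real_inner_comm (Y x) (W x), real_inner_comm (U x) (W x)]
    ring
  add {W W'} hW hW' := by
    simp [koszul, mvfderiv_fun_add (mdifferentiableAt_inner hY hW) (mdifferentiableAt_inner hY hW'),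
      mvfderiv_fun_add (mdifferentiableAt_inner hU hW) (mdifferentiableAt_inner hU hW'), inner_add_left, inner_add_right,
      VectorField.mlieBracket_add_right hW hW']
    ring

open scoped Classical in
variable (I) in
/-- The endomorphism `u ↦ ∇_u Y` of the tangent space at `x`, where `∇` is the Levi-Civita connection:
it is dual, with respect to the metric, to half of the Koszul expression (and zero, by convention,
where `Y` is not differentiable). -/
noncomputable def leviCivitaAux (Y : Π x : M, TangentSpace I x) (x : M) :
    TangentSpace I x →L[ℝ] TangentSpace I x :=
  if hY : MDiffAt (T% Y) x then
    haveI : FiniteDimensional ℝ (TangentSpace I x) := inferInstanceAs (FiniteDimensional ℝ E)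
    haveI : CompleteSpace (TangentSpace I x) := FiniteDimensional.complete ℝ _
    (2⁻¹ : ℝ) • InnerProductSpace.continuousLinearMapOfBilin (𝕜 := ℝ)
      (TensorialAt.mkHom₂ (fun U W ↦ koszul I Y U W x) x
        (fun _ hW ↦ koszul_tensorial_left hY hW) (fun _ hU ↦ koszul_tensorial_right hY hU))
  else 0

/-- The Koszul formula. -/
theorem inner_leviCivitaAux {Y U W : Π x : M, TangentSpace I x} {x : M}
    (hY : MDiffAt (T% Y) x) (hU : MDiffAt (T% U) x) (hW : MDiffAt (T% W) x) :
    2 * inner ℝ (leviCivitaAux I Y x (U x)) (W x) = koszul I Y U W x := by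
  simp only [leviCivitaAux, dif_pos hY, smul_apply, inner_smul_left]
  have : FiniteDimensional ℝ (TangentSpace I x) := inferInstanceAs (FiniteDimensional ℝ E)
  have : CompleteSpace (TangentSpace I x) := FiniteDimensional.complete ℝ _
  erw [InnerProductSpace.continuousLinearMapOfBilin_apply]
  rw [TensorialAt.mkHom₂_apply _ _ hU hW]
  simp


/-- Two tangent vectors with the same products against all differentiable fields agree. -/
theorem eq_of_inner_fields {x : M} {a b : TangentSpace I x}
    (h : ∀ W : Π y : M, TangentSpace I y, MDiffAt (T% W) x →
      (inner ℝ a (W x) : ℝ) = inner ℝ b (W x)) : a = b := by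
  refine ext_inner_right ℝ fun w ↦ ?_
  simpa using h (FiberBundle.extend E w) (FiberBundle.mdifferentiableAt_extend ..)

/-- Two endomorphisms of a tangent space with the same matrix entries against differentiable fields
agree. -/
theorem ext_clm_fields {x : M} {A B : TangentSpace I x →L[ℝ] TangentSpace I x}
    (h : ∀ U W : Π y : M, TangentSpace I y, MDiffAt (T% U) x → MDiffAt (T% W) x →
      (inner ℝ (A (U x)) (W x) : ℝ) = inner ℝ (B (U x)) (W x)) : A = B := by
  ext u
  have := eq_of_inner_fields (fun W hW ↦
    h (FiberBundle.extend E u) W (FiberBundle.mdifferentiableAt_extend ..) hW)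
  simpa using this

variable (I M) in
/-- The Levi-Civita connection of the Riemannian metric. -/
noncomputable def leviCivita : CovariantDerivative I E (fun x : M ↦ TangentSpace I x) where
  toFun := leviCivitaAux I
  isCovariantDerivativeOnUniv :=
    { add := fun {Y Y' x} hY hY' _ ↦ by
        refine ext_clm_fields fun U W hU hW ↦ ?_
        have h := inner_leviCivitaAux (mdifferentiableAt_add_section hY hY') hU hW
        have h1 := inner_leviCivitaAux hY hU hW
        have h2 := inner_leviCivitaAux hY' hU hW
        simp [koszul, mvfderiv_fun_add (mdifferentiableAt_inner hY hW)
          (mdifferentiableAt_inner hY' hW), mvfderiv_fun_add (mdifferentiableAt_inner hU hY)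
          (mdifferentiableAt_inner hU hY'), inner_add_left, inner_add_right,
          VectorField.mlieBracket_add_left hY hY', VectorField.mlieBracket_add_right hY hY'] at h h1 h2 ⊢
        linarith
      leibniz := fun {Y f x} hY hf _ ↦ by
        refine ext_clm_fields fun U W hU hW ↦ ?_
        have h := inner_leviCivitaAux (hf.smul_section hY) hU hW
        have h1 := inner_leviCivitaAux hY hU hW
        simp [koszul, mvfderiv_fun_mul hf (mdifferentiableAt_inner hY hW),
          mvfderiv_fun_mul hf (mdifferentiableAt_inner hU hY), inner_add_left,
          VectorField.mlieBracket_smul_left hf hY, VectorField.mlieBracket_smul_right hf hY,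
          inner_smul_left, inner_smul_right] at h h1 ⊢
        rw [real_inner_comm (Y x) (U x)] at h
        linear_combination h / 2 - f x * h1 / 2 }

/-- The Levi-Civita connection is torsion-free. -/
theorem torsion_leviCivita : (leviCivita I M).torsion = 0 := by
  rw [CovariantDerivative.torsion_eq_zero_iff]
  intro X Y x hX hY
  refine eq_of_inner_fields fun W hW ↦ ?_
  have h1 := inner_leviCivitaAux hY hX hW
  have h2 := inner_leviCivitaAux hX hY hW
  have h3 : (fun y : M ↦ (inner ℝ (Y y) (X y) : ℝ)) = fun y ↦ inner ℝ (X y) (Y y) :=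
    funext fun y ↦ real_inner_comm _ _
  change (inner ℝ (leviCivitaAux I Y x (X x) - leviCivitaAux I X x (Y x)) (W x) : ℝ) = _
  rw [inner_sub_left]
  rw [koszul, VectorField.mlieBracket_swap_apply (V := Y) (W := X), inner_neg_left, h3] at h2
  rw [koszul] at h1
  linarith

/-- The Levi-Civita connection is compatible with the metric. -/
theorem isMetric_leviCivita {Y W : Π x : M, TangentSpace I x} {x : M}
    (hY : MDiffAt (T% Y) x) (hW : MDiffAt (T% W) x) (u : TangentSpace I x) :
    d% (fun y : M ↦ (inner ℝ (Y y) (W y) : ℝ)) x u =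
      inner ℝ (leviCivita I M Y x u) (W x) + inner ℝ (Y x) (leviCivita I M W x u) := by
  have hU : MDiffAt (T% (FiberBundle.extend E u)) x := FiberBundle.mdifferentiableAt_extend ..
  have h1 := inner_leviCivitaAux hY hU hW
  have h2 := inner_leviCivitaAux hW hU hY
  have h3 : (fun y : M ↦ (inner ℝ (W y) (Y y) : ℝ)) = fun y ↦ inner ℝ (Y y) (W y) :=
    funext fun y ↦ real_inner_comm _ _
  change _ = (inner ℝ (leviCivitaAux I Y x u) (W x) + inner ℝ (Y x) (leviCivitaAux I W x u) : ℝ)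
  rw [koszul, VectorField.mlieBracket_swap_apply (V := W) (W := Y), inner_neg_left, h3] at h2
  rw [koszul] at h1
  simp only [FiberBundle.extend_apply_self] at h1 h2
  rw [real_inner_comm _ (Y x)]
  linarith

end LeviCivita

section Geodesics

variable {E : Type*} [NormedAddCommGroup E] [NormedSpace ℝ E]
  {H : Type*} [TopologicalSpace H] {I : ModelWithCorners ℝ E H}
  {M : Type*} [TopologicalSpace M] [ChartedSpace H M] [IsManifold I ∞ M]

variable (I) in
/-- The vertical lift of `u ∈ T_x M` to the point `p = (x, v)` of `TM`: the velocity at `0` of the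
curve `t ↦ (x, v + t u)` in `TM`. -/
noncomputable def verticalLift (p : TangentBundle I M) (u : TangentSpace I p.1) :
    TangentSpace I.tangent p :=
  mfderiv 𝓘(ℝ, ℝ) I.tangent (fun t : ℝ ↦ (⟨p.1, p.2 + t • u⟩ : TangentBundle I M)) 0 (1 : ℝ)

/-- The horizontal lift of `w ∈ T_x M` to the point `p = (x, v)` of `TM` with respect to a connection:
the vector `dY(w) - vl(∇_w Y)`, where `Y` is a smooth vector field near `x` with `Y(x) = v` and `vl`
is the vertical lift. It does not depend on the choice of `Y`; here `Y` is `FiberBundle.extend E v`. -/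
noncomputable def horizontalLift (cov : CovariantDerivative I E (fun x : M ↦ TangentSpace I x))
    (p : TangentBundle I M) (w : TangentSpace I p.1) : TangentSpace I.tangent p :=
  let h : TangentSpace I.tangent p :=
    mfderiv I I.tangent (fun y : M ↦ (⟨y, FiberBundle.extend E p.2 y⟩ : TangentBundle I M)) p.1 w
  h - verticalLift I p (cov (FiberBundle.extend E p.2) p.1 w)

variable (I) in
/-- The velocity curve `t ↦ (c(t), c'(t))` in `TM` of a curve `c` in `M`. -/
noncomputable def velocity (c : ℝ → M) (t : ℝ) : TangentBundle I M :=
  ⟨c t, mfderiv 𝓘(ℝ, ℝ) I c t (1 : ℝ)⟩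

/-- The covariant derivative at time `t` of the vector field `Z` along the curve `c = π ∘ Z` is `w`:
the curve `Z` in `TM` is differentiable at `t`, and its velocity is the sum of the horizontal lift
of `c'(t)` and of the vertical lift of `w`. -/
def HasCovDerivAlong (cov : CovariantDerivative I E (fun x : M ↦ TangentSpace I x))
    (Z : ℝ → TangentBundle I M) (t : ℝ) (w : TangentSpace I (Z t).1) : Prop :=
  HasMFDerivAt 𝓘(ℝ, ℝ) I.tangent Z t
    ((1 : ℝ →L[ℝ] ℝ).smulRight
      (horizontalLift cov (Z t) (velocity I (fun s ↦ (Z s).1) t).2 + verticalLift I (Z t) w))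

/-- The curve `c` is, on the set `s` of times, a smooth geodesic of the connection:
`∇_{c'} c' = 0`. -/
def IsGeodesicOn (cov : CovariantDerivative I E (fun x : M ↦ TangentSpace I x))
    (c : ℝ → M) (s : Set ℝ) : Prop :=
  ContMDiffOn 𝓘(ℝ, ℝ) I ∞ c s ∧ ∀ t ∈ s, HasCovDerivAlong cov (velocity I c) t 0

end Geodesics

/-- `φ` restricts to a diffeomorphism from `s'` onto `s` (used for open intervals `s'` and `s`). -/
structure IsReparametrization (φ : ℝ → ℝ) (s' s : Set ℝ) : Prop where
  contDiffOn : ContDiffOn ℝ ∞ φ s'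
  deriv_ne_zero : ∀ t ∈ s', deriv φ t ≠ 0
  bijOn : Set.BijOn φ s' s

section Surface

/-- The model space of surfaces. -/
abbrev Plane := EuclideanSpace ℝ (Fin 2)

variable {M : Type*} [TopologicalSpace M] [ChartedSpace Plane M] [IsManifold (𝓡 2) ∞ M]

instance (x : M) : Fact (Module.finrank ℝ (TangentSpace (𝓡 2) x) = 2) :=
  ⟨finrank_euclideanSpace_fin (𝕜 := ℝ) (n := 2)⟩

variable (M) in
/-- An orientation of a surface: an orientation of every tangent space which is locally constant in
local trivialisations of the tangent bundle. -/
structure SurfaceOrientation where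
  orient : ∀ x : M, Orientation ℝ (TangentSpace (𝓡 2) x) (Fin 2)
  locally_constant : ∀ x₀ : M, ∃ o₀ : Orientation ℝ Plane (Fin 2), ∀ᶠ x in 𝓝 x₀,
    ∃ hx : x ∈ (trivializationAt Plane (fun y : M ↦ TangentSpace (𝓡 2) y) x₀).baseSet,
      Orientation.map (Fin 2) ((trivializationAt Plane (fun y : M ↦ TangentSpace (𝓡 2) y)
        x₀).continuousLinearEquivAt ℝ x hx).toLinearEquiv (orient x) = o₀

variable [RiemannianBundle (fun x : M ↦ TangentSpace (𝓡 2) x)]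

variable (M) in
/-- The unit tangent bundle `SM` of a Riemannian surface, as a subspace of `TM`. -/
abbrev UnitTangentBundle : Type _ := {p : TangentBundle (𝓡 2) M // (inner ℝ p.2 p.2 : ℝ) = 1}

/-- Smoothness of a function on the embedded submanifold `SM` of `TM`: locally, it extends to a smooth
function on `TM`. -/
def IsSmoothOnUnitTangentBundle {F : Type*} [NormedAddCommGroup F] [NormedSpace ℝ F]
    (u : UnitTangentBundle M → F) : Prop :=
  ∀ p : UnitTangentBundle M, ∃ f : TangentBundle (𝓡 2) M → F,
    ContMDiffAt (𝓡 2).tangent 𝓘(ℝ, F) ∞ f p ∧ ∀ᶠ q : UnitTangentBundle M in 𝓝 p, f q = u q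

/-- The action of `SO(2)` on `SM`: `rotate o t (x, v) = (x, cos t • v + sin t • J v)`. -/
noncomputable def rotate (o : SurfaceOrientation M) (t : ℝ) (p : UnitTangentBundle M) :
    UnitTangentBundle M :=
  ⟨⟨p.1.1, (o.orient p.1.1).rotation (t : Real.Angle) p.1.2⟩, by
    simpa only [LinearIsometryEquiv.inner_map_map] using p.2⟩

/-- The vertical vector field `V` on `SM`, the infinitesimal generator of the `SO(2)`-action. A vector
tangent to `SM` is viewed as a vector tangent to `TM`. -/
noncomputable def verticalField (o : SurfaceOrientation M) (p : UnitTangentBundle M) :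
    TangentSpace (𝓡 2).tangent p.1 :=
  mfderiv 𝓘(ℝ, ℝ) (𝓡 2).tangent (fun t : ℝ ↦ (rotate o t p).1) 0 (1 : ℝ)

/-- The smooth functions in `H_m`, the kernel of `m Id + i V`, where `V u` is the derivative of `u`
along the `SO(2)`-action. -/
def fourierMode (o : SurfaceOrientation M) (m : ℤ) : Submodule ℂ (UnitTangentBundle M → ℂ) where
  carrier := {u | IsSmoothOnUnitTangentBundle u ∧ ∀ p, ∃ d : ℂ,
    HasDerivAt (fun t : ℝ ↦ u (rotate o t p)) d 0 ∧ m * u p + Complex.I * d = 0}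
  add_mem' := by
    rintro u v ⟨hu, hu'⟩ ⟨hv, hv'⟩
    refine ⟨fun p ↦ ?_, fun p ↦ ?_⟩
    · obtain ⟨f, hf, hf'⟩ := hu p
      obtain ⟨g, hg, hg'⟩ := hv p
      exact ⟨f + g, hf.add hg, by filter_upwards [hf', hg'] with q h1 h2; simp [h1, h2]⟩
    · obtain ⟨d, hd, hd'⟩ := hu' p
      obtain ⟨e, he, he'⟩ := hv' p
      exact ⟨d + e, hd.add he, by simp only [Pi.add_apply]; linear_combination hd' + he'⟩
  zero_mem' := ⟨fun p ↦ ⟨fun _ ↦ 0, contMDiffAt_const, by simp⟩, fun p ↦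
    ⟨0, by simpa using hasDerivAt_const (0 : ℝ) (0 : ℂ), by simp⟩⟩
  smul_mem' := by
    rintro a u ⟨hu, hu'⟩
    refine ⟨fun p ↦ ?_, fun p ↦ ?_⟩
    · obtain ⟨f, hf, hf'⟩ := hu p
      exact ⟨a • f, (contDiff_const_smul (𝕜 := ℝ) a).contMDiff.contMDiffAt.comp _ hf,
        by filter_upwards [hf'] with q h1; simp [h1]⟩
    · obtain ⟨d, hd, hd'⟩ := hu' p
      exact ⟨a * d, hd.const_mul a, by
        simp only [Pi.smul_apply, smul_eq_mul]; linear_combination a * hd'⟩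

variable [IsContMDiffRiemannianBundle (𝓡 2) ∞ Plane (fun x : M ↦ TangentSpace (𝓡 2) x)]

/-- The geodesic vector field `X` of the metric: at `(x, v)`, the horizontal lift of `v` with respect
to the Levi-Civita connection. -/
noncomputable def geodesicField (p : UnitTangentBundle M) : TangentSpace (𝓡 2).tangent p.1 :=
  horizontalLift (leviCivita (𝓡 2) M) p.1 p.1.2

/-- The vector field `F = X + λ V` on `SM`. -/
noncomputable def thermostatField (o : SurfaceOrientation M) (lam : UnitTangentBundle M → ℝ)
    (p : UnitTangentBundle M) : TangentSpace (𝓡 2).tangent p.1 :=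
  geodesicField p + lam p • verticalField o p

/-- `γ` is an integral curve on `s` of the vector field `F` on `SM`. -/
def IsOrbitOn (F : ∀ p : UnitTangentBundle M, TangentSpace (𝓡 2).tangent p.1)
    (γ : ℝ → UnitTangentBundle M) (s : Set ℝ) : Prop :=
  ∀ t ∈ s, HasMFDerivAt 𝓘(ℝ, ℝ) (𝓡 2).tangent (fun r ↦ (γ r).1) t
    ((1 : ℝ →L[ℝ] ℝ).smulRight (F (γ t)))

/-- The thermostat `F = X + λ V` is projective: there is a smooth torsion-free connection on `TM` such
that the projection to `M` of every orbit `γ : s → SM`, `s` an open interval, becomes a geodesic of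
the connection after precomposition with a diffeomorphism from an open interval onto `s`. -/
def IsProjectiveThermostat (o : SurfaceOrientation M) (lam : UnitTangentBundle M → ℝ) : Prop :=
  ∃ cov : CovariantDerivative (𝓡 2) Plane (fun x : M ↦ TangentSpace (𝓡 2) x),
    cov.ContMDiffCovariantDerivative ∞ ∧ cov.torsion = 0 ∧
    ∀ (γ : ℝ → UnitTangentBundle M) (s : Set ℝ), IsOpen s → IsPreconnected s →
      IsOrbitOn (thermostatField o lam) γ s →
      ∃ (φ : ℝ → ℝ) (s' : Set ℝ), IsOpen s' ∧ IsPreconnected s' ∧ IsReparametrization φ s' s ∧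
        IsGeodesicOn cov (fun t ↦ (γ (φ t)).1.1) s'

end Surface

end RiemannianGeometry

/-! Write `D` for the difference between a connection and the Levi-Civita connection `∇`; it is a
bilinear form on each tangent plane with values in that plane. The orbits of `X + λV` project to the
unit speed curves `c` with `∇_{c'} c' = λ J c'` (`isOrbitOn_iff`). If `c ∘ φ` is a geodesic of `∇ +
D`, then at each time, with `v = c'`, `a = φ'` and `b = φ''`, one has `b v + a² (λ J v + D(v, v)) =
0`. Pairing with `J v` removes the unknown `b` and leaves `λ(v) = -⟨D(v, v), J v⟩`. Since an orbit
passes through every point of `SM` (`exists_isOrbitOn`), `λ` is on every fibre the restriction to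
the unit circle of a homogeneous cubic polynomial.

On the circle `cos² + sin² = 1`, so the homogeneous cubics in `cos t`, `sin t` are exactly the
combinations of `exp(±it)` and `exp(±3it)`. This is the Fourier condition, fibre by fibre. That the
individual components are smooth on `SM` follows from a discrete Fourier inversion, which writes
each of them as a combination of four rotates of `λ` (`IsFiberwiseCubic.mem`).

Conversely, polarization of the cubic gives on each tangent plane a symmetric `B` with `λ(v) =
-⟨B(v, v), J v⟩` and `⟨B(u, v), J w⟩` totally symmetric (`exists_bilinear_of_cubic`). Total symmetry
lets the coefficients of `B` be read off from finitely many values of `λ`, so `B` is smooth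
(`Represents.smoothFieldAt`). The connection `∇ + B` is torsion-free, and `B(v, v) = f v - λ J v`
with `f = ⟨B(v, v), v⟩`, so along an orbit its acceleration is the tangential vector `f c'`. The
reparametrisation that solves `φ'' = -f(φ) φ'²` makes it zero (`exists_isReparametrization`). -/

namespace RiemannianGeometry

/-! ### Derivatives of maps into a vector bundle. -/

section TotalSpace

open Set Filter FiberBundle

variable {𝕜 B F M : Type*} {E : B → Type*} [NontriviallyNormedField 𝕜] [NormedAddCommGroup F]
  [NormedSpace 𝕜 F] [TopologicalSpace (TotalSpace F E)] [∀ x, TopologicalSpace (E x)]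
  {EB : Type*} [NormedAddCommGroup EB] [NormedSpace 𝕜 EB] {HB : Type*} [TopologicalSpace HB]
  {IB : ModelWithCorners 𝕜 EB HB} [∀ x, Zero (E x)] {EM : Type*}
  [NormedAddCommGroup EM] [NormedSpace 𝕜 EM] {HM : Type*} [TopologicalSpace HM]
  {IM : ModelWithCorners 𝕜 EM HM} [TopologicalSpace M] [ChartedSpace HM M]
  [TopologicalSpace B] [ChartedSpace HB B] [FiberBundle F E]

/-- The derivative of a map into a vector bundle, in terms of the base point and of the fibre
coordinate in the preferred trivialization. -/
theorem hasMFDerivAt_totalSpace {f : M → TotalSpace F E} {x₀ : M}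
    {L : TangentSpace IM x₀ →L[𝕜] EB} {L' : TangentSpace IM x₀ →L[𝕜] F} :
    HasMFDerivAt IM (IB.prod 𝓘(𝕜, F)) f x₀ (L.prod L') ↔
      HasMFDerivAt IM IB (fun x ↦ (f x).proj) x₀ L ∧
      HasMFDerivAt IM 𝓘(𝕜, F) (fun x ↦ (trivializationAt F E (f x₀).proj (f x)).2) x₀ L' := by
  have hc : ContinuousAt f x₀ ↔ ContinuousAt (fun x ↦ (f x).proj) x₀ ∧
      ContinuousAt (fun x ↦ (trivializationAt F E (f x₀).proj (f x)).2) x₀ := by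
    simpa [← continuousWithinAt_univ] using
      FiberBundle.continuousWithinAt_totalSpace F (E := E) (f := f) (s := univ) (x₀ := x₀)
  have key (h : ContinuousAt f x₀) :
      writtenInExtChartAt IM (IB.prod 𝓘(𝕜, F)) x₀ f =ᶠ[𝓝[range IM] (extChartAt IM x₀ x₀)]
        fun y ↦ (writtenInExtChartAt IM IB x₀ (fun x ↦ (f x).proj) y,
          writtenInExtChartAt IM 𝓘(𝕜, F) x₀
            (fun x ↦ (trivializationAt F E (f x₀).proj (f x)).2) y) := by
    -- The chart expression of `f` splits into a pair only where the trivialization preserves base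
    -- points, that is, while the base point stays in the base set.
    have h1 : (fun x => (f x).proj) ⁻¹' (trivializationAt F E (f x₀).proj).baseSet ∈ 𝓝 x₀ :=
      (hc.1 h).1.preimage_mem_nhds
        ((Trivialization.open_baseSet _).mem_nhds (mem_baseSet_trivializationAt F E _))
    have h2 := extChartAt_preimage_mem_nhdsWithin (I := IM) (s := univ)
      (mem_nhdsWithin_of_mem_nhds h1)
    rw [preimage_univ, univ_inter] at h2
    filter_upwards [h2] with y hy
    simp only [writtenInExtChartAt, FiberBundle.extChartAt, Function.comp_def,
      PartialEquiv.trans_apply, PartialEquiv.prod_coe, PartialEquiv.refl_coe, extChartAt_self_apply,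
      modelWithCornersSelf_coe, Function.id_def, OpenPartialHomeomorph.coe_toPartialEquiv,
      Trivialization.coe_coe]
    rw [Trivialization.coe_fst']
    exact hy
  have key0 (h : ContinuousAt f x₀) := (key h).self_of_nhdsWithin
    (by simp only [mfld_simps])
  constructor
  · rintro ⟨h, h'⟩
    have h2 := h'.congr_of_eventuallyEq (key h).symm (key0 h).symm
    exact ⟨⟨(hc.1 h).1, h2.fst⟩, ⟨(hc.1 h).2, h2.snd⟩⟩
  · rintro ⟨⟨h1, h1'⟩, ⟨h2, h2'⟩⟩
    have h := hc.2 ⟨h1, h2⟩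
    exact ⟨h, (h1'.prodMk h2').congr_of_eventuallyEq (key h) (key0 h)⟩

end TotalSpace

/-! ### Covariant derivatives along curves, computed in the fibre coordinate of a trivialization. -/

section Geodesics

variable {E : Type*} [NormedAddCommGroup E] [NormedSpace ℝ E]
  {H : Type*} [TopologicalSpace H] {I : ModelWithCorners ℝ E H}
  {M : Type*} [TopologicalSpace M] [ChartedSpace H M] [IsManifold I ∞ M]

/-- The identification of a tangent space with the model space. -/
def toModel (x : M) : TangentSpace I x ≃L[ℝ] E := ContinuousLinearEquiv.refl ℝ E

variable (I) in
/-- The fibre coordinate of a tangent vector in the preferred trivialization at `x`. -/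
noncomputable def fiberCoord (x : M) (q : TangentBundle I M) : E :=
  (trivializationAt E (fun x : M ↦ TangentSpace I x) x q).2

/-- The coordinate change from a chart to itself is the identity, so at the centre of the
trivialization no coordinate change intervenes. This is why the trivialization used below is always
the one centred at the point in question. -/
theorem fiberCoord_self (x : M) (v : TangentSpace I x) : fiberCoord I x ⟨x, v⟩ = toModel x v := by
  rw [fiberCoord, TangentBundle.trivializationAt_apply]
  exact (tangentBundleCore I M).coordChange_self (achart _ x) x (mem_achart_source H x) v

theorem fiberCoord_add {x y : M} (hy : y ∈ (chartAt H x).source) (v w : TangentSpace I y) :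
    fiberCoord I x ⟨y, v + w⟩ = fiberCoord I x ⟨y, v⟩ + fiberCoord I x ⟨y, w⟩ :=
  ((trivializationAt E (fun x : M ↦ TangentSpace I x) x).linear ℝ hy).map_add v w

theorem fiberCoord_smul {x y : M} (hy : y ∈ (chartAt H x).source) (a : ℝ) (v : TangentSpace I y) :
    fiberCoord I x ⟨y, a • v⟩ = a • fiberCoord I x ⟨y, v⟩ :=
  ((trivializationAt E (fun x : M ↦ TangentSpace I x) x).linear ℝ hy).map_smul a v

/-- `FiberBundle.extend` is the section that is constant in the trivialization. All derivative terms
of extensions therefore vanish and only the connection contributes. -/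
theorem fiberCoord_extend {x y : M} (hy : y ∈ (chartAt H x).source) (v : TangentSpace I x) :
    fiberCoord I x ⟨y, FiberBundle.extend E v y⟩ = toModel x v := by
  have : y ∈ (trivializationAt E (fun x : M ↦ TangentSpace I x) x).baseSet := hy
  rw [fiberCoord, FiberBundle.extend, Trivialization.apply_mk_symm _ this]
  exact fiberCoord_self x v

/-- The component along the base of a vector tangent to the tangent bundle. -/
def baseComponent (p : TangentBundle I M) : TangentSpace I.tangent p →L[ℝ] TangentSpace I p.1 :=
  ContinuousLinearMap.fst ℝ E E

/-- The component along the fibre, in the preferred trivialization, of a vector tangent to the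
tangent bundle. -/
def fiberComponent (p : TangentBundle I M) : TangentSpace I.tangent p →L[ℝ] E :=
  ContinuousLinearMap.snd ℝ E E

variable {EN : Type*} [NormedAddCommGroup EN] [NormedSpace ℝ EN] {HN : Type*} [TopologicalSpace HN]
  {J : ModelWithCorners ℝ EN HN} {N : Type*} [TopologicalSpace N] [ChartedSpace HN N]

theorem hasMFDerivAt_tangentBundle {f : N → TangentBundle I M} {n : N}
    {L : TangentSpace J n →L[ℝ] TangentSpace I.tangent (f n)} :
    HasMFDerivAt J I.tangent f n L ↔
      HasMFDerivAt J I (fun m ↦ (f m).1) n ((baseComponent (f n)).comp L) ∧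
      HasMFDerivAt J 𝓘(ℝ, E) (fun m ↦ fiberCoord I (f n).1 (f m)) n
        ((fiberComponent (f n)).comp L) :=
  hasMFDerivAt_totalSpace (F := E) (EB := E) (IB := I) (E := fun x : M ↦ TangentSpace I x)
    (L := (ContinuousLinearMap.fst ℝ E E).comp (show TangentSpace J n →L[ℝ] E × E from L))
    (L' := (ContinuousLinearMap.snd ℝ E E).comp (show TangentSpace J n →L[ℝ] E × E from L))

theorem tangent_ext {p : TangentBundle I M} {ξ η : TangentSpace I.tangent p}
    (h : baseComponent p ξ = baseComponent p η) (h' : fiberComponent p ξ = fiberComponent p η) :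
    ξ = η :=
  Prod.ext h h'

theorem mfderiv_components {f : N → TangentBundle I M} {n : N}
    {L : TangentSpace J n →L[ℝ] TangentSpace I (f n).1} {L' : TangentSpace J n →L[ℝ] E}
    (h : HasMFDerivAt J I (fun m ↦ (f m).1) n L)
    (h' : HasMFDerivAt J 𝓘(ℝ, E) (fun m ↦ fiberCoord I (f n).1 (f m)) n L')
    (u : TangentSpace J n) :
    baseComponent (f n) (mfderiv J I.tangent f n u) = L u ∧
      fiberComponent (f n) (mfderiv J I.tangent f n u) = L' u := by
  have h0 : MDifferentiableAt J I.tangent f n :=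
    (mdifferentiableAt_totalSpace I f).2 ⟨h.mdifferentiableAt, h'.mdifferentiableAt⟩
  obtain ⟨h1, h2⟩ := hasMFDerivAt_tangentBundle.1 h0.hasMFDerivAt
  rw [← hasMFDerivAt_unique h1 h, ← hasMFDerivAt_unique h2 h']
  exact ⟨rfl, rfl⟩

theorem verticalLift_components (p : TangentBundle I M) (u : TangentSpace I p.1) :
    baseComponent p (verticalLift I p u) = 0 ∧ fiberComponent p (verticalLift I p u) =
      toModel p.1 u := by
  have h1 : HasFDerivAt (𝕜 := ℝ) (F := E)
      (fun t : ℝ ↦ fiberCoord I p.1 (⟨p.1, p.2 + t • u⟩ : TangentBundle I M))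
      ((1 : ℝ →L[ℝ] ℝ).smulRight (toModel p.1 u)) 0 := by
    have : (fun t : ℝ ↦ fiberCoord I p.1 (⟨p.1, p.2 + t • u⟩ : TangentBundle I M)) =
        fun t : ℝ ↦ toModel p.1 p.2 + t • toModel p.1 u :=
      funext fun t ↦ by rw [fiberCoord_self, map_add, map_smul]
    rw [this]
    have h := ((hasDerivAt_id (0 : ℝ)).smul_const (toModel p.1 u)).const_add (toModel p.1 p.2)
    rw [one_smul] at h
    exact h.hasFDerivAt
  have h2 := mfderiv_components (f := fun t : ℝ ↦ (⟨p.1, p.2 + t • u⟩ : TangentBundle I M))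
    (hasMFDerivAt_const (p.1 : M) (0 : ℝ)) h1.hasMFDerivAt (1 : ℝ)
  refine ⟨h2.1, h2.2.trans ?_⟩
  exact one_smul ℝ (toModel p.1 u)

/-- The extension has constant fibre coordinate, so its differential has no fibre component; what
remains along the fibre is the connection term, with a minus sign. -/
theorem horizontalLift_components (cov : CovariantDerivative I E (fun x : M ↦ TangentSpace I x))
    (p : TangentBundle I M) (w : TangentSpace I p.1) :
    baseComponent p (horizontalLift cov p w) = w ∧ fiberComponent p (horizontalLift cov p w) =
      -toModel p.1 (cov (FiberBundle.extend E p.2) p.1 w) := by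
  have h1 : HasMFDerivAt I 𝓘(ℝ, E)
      (fun y : M ↦ fiberCoord I p.1 (⟨y, FiberBundle.extend E p.2 y⟩ : TangentBundle I M)) p.1
      (0 : E →L[ℝ] E) := by
    refine (hasMFDerivAt_const (toModel p.1 p.2) p.1).congr_of_eventuallyEq ?_
    filter_upwards [(chartAt H p.1).open_source.mem_nhds (mem_chart_source H p.1)] with y hy
    exact fiberCoord_extend hy p.2
  have h2 := mfderiv_components
    (f := fun y : M ↦ (⟨y, FiberBundle.extend E p.2 y⟩ : TangentBundle I M))
    (hasMFDerivAt_id p.1) h1 w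
  have h3 := verticalLift_components p (cov (FiberBundle.extend E p.2) p.1 w)
  constructor
  · refine (map_sub (baseComponent p) _ _).trans ?_
    rw [h3.1, sub_zero]
    exact h2.1
  · refine (map_sub (fiberComponent p) _ _).trans ?_
    rw [h3.2, sub_eq_neg_self]
    exact h2.2

/-- The curve `c` is differentiable at `t`, with velocity `w`. -/
def HasVelocityAt (c : ℝ → N) (t : ℝ) (w : TangentSpace J (c t)) : Prop :=
  HasMFDerivAt 𝓘(ℝ, ℝ) J c t ((1 : ℝ →L[ℝ] ℝ).smulRight w)

theorem HasVelocityAt.mfderiv_one {c : ℝ → N} {t : ℝ} {w : TangentSpace J (c t)}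
    (h : HasVelocityAt c t w) : mfderiv 𝓘(ℝ, ℝ) J c t (1 : ℝ) = w := by
  rw [HasMFDerivAt.mfderiv h]
  exact one_smul ℝ w

theorem HasVelocityAt.unique {c : ℝ → N} {t : ℝ} {w w' : TangentSpace J (c t)}
    (h : HasVelocityAt c t w) (h' : HasVelocityAt c t w') : w = w' := by
  rw [← h.mfderiv_one, h'.mfderiv_one]

theorem HasVelocityAt.velocity_snd {c : ℝ → M} {t : ℝ} {w : TangentSpace I (c t)}
    (h : HasVelocityAt c t w) : (velocity I c t).2 = w :=
  h.mfderiv_one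

theorem HasVelocityAt.velocity_eq {c : ℝ → M} {t : ℝ} {w : TangentSpace I (c t)}
    (h : HasVelocityAt c t w) : velocity I c t = ⟨c t, w⟩ := by
  rw [velocity, h.mfderiv_one]

theorem hasVelocityAt_mfderiv {c : ℝ → N} {t : ℝ} (h : MDifferentiableAt 𝓘(ℝ, ℝ) J c t) :
    HasVelocityAt c t (mfderiv 𝓘(ℝ, ℝ) J c t (1 : ℝ)) := by
  have h1 : (1 : ℝ →L[ℝ] ℝ).smulRight (mfderiv 𝓘(ℝ, ℝ) J c t (1 : ℝ)) = mfderiv 𝓘(ℝ, ℝ) J c t :=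
    ContinuousLinearMap.ext_ring (one_smul ℝ _)
  have h2 := h.hasMFDerivAt
  exact (congrArg (HasMFDerivAt 𝓘(ℝ, ℝ) J c t) h1).mpr h2

theorem HasVelocityAt.mdifferentiableAt {c : ℝ → N} {t : ℝ} {w : TangentSpace J (c t)}
    (h : HasVelocityAt c t w) : MDifferentiableAt 𝓘(ℝ, ℝ) J c t :=
  HasMFDerivAt.mdifferentiableAt h

/-- The vectors `w` and `w'` live in tangent spaces at points that are equal only propositionally;
their equality is therefore expressed in the total space. -/
theorem HasVelocityAt.congr {c c' : ℝ → N} {t : ℝ} {w : TangentSpace J (c t)}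
    (h : HasVelocityAt c t w) (hc : c' =ᶠ[𝓝 t] c) {w' : TangentSpace J (c' t)}
    (hw : (⟨c' t, w'⟩ : TangentBundle J N) = ⟨c t, w⟩) : HasVelocityAt c' t w' := by
  have h1 := (hasVelocityAt_mfderiv (h.mdifferentiableAt.congr_of_eventuallyEq hc))
  have h2 : mfderiv 𝓘(ℝ, ℝ) J c' t (1 : ℝ) = w' := by
    have h3 : (⟨c' t, mfderiv 𝓘(ℝ, ℝ) J c' t (1 : ℝ)⟩ : TangentBundle J N) = ⟨c' t, w'⟩ := by
      rw [hw, ← h.mfderiv_one, hc.mfderiv_eq, hc.self_of_nhds]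
    exact (TotalSpace.mk_inj).1 h3
  exact h2 ▸ h1

theorem HasVelocityAt.comp {c : ℝ → N} {φ : ℝ → ℝ} {t a : ℝ} {w : TangentSpace J (c (φ t))}
    (h : HasVelocityAt c (φ t) w) (hφ : HasDerivAt φ a t) :
    HasVelocityAt (fun s ↦ c (φ s)) t (a • w) := by
  have h1 := HasMFDerivAt.comp t h hφ.hasFDerivAt.hasMFDerivAt
  refine (congrArg (HasMFDerivAt 𝓘(ℝ, ℝ) J (fun s ↦ c (φ s)) t) ?_).mp h1
  refine ContinuousLinearMap.ext_ring ?_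
  change ((1 : ℝ) • a) • w = (1 : ℝ) • a • w
  simp

theorem hasVelocityAt_tangentBundle {Z : ℝ → TangentBundle I M} {t : ℝ}
    {ξ : TangentSpace I.tangent (Z t)} :
    HasVelocityAt Z t ξ ↔ HasVelocityAt (J := I) (fun s ↦ (Z s).1) t (baseComponent (Z t) ξ) ∧
      HasDerivAt (fun s ↦ fiberCoord I (Z t).1 (Z s)) (fiberComponent (Z t) ξ) t :=
  hasMFDerivAt_tangentBundle.trans (and_congr Iff.rfl hasMFDerivAt_iff_hasFDerivAt)

variable (cov : CovariantDerivative I E (fun x : M ↦ TangentSpace I x))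

/-- The derivative of a curve in the tangent bundle, in terms of horizontal and vertical lifts. -/
theorem hasVelocityAt_horizontalLift_add {Z : ℝ → TangentBundle I M} {t : ℝ}
    {w u : TangentSpace I (Z t).1} :
    HasVelocityAt Z t (horizontalLift cov (Z t) w + verticalLift I (Z t) u) ↔
      HasVelocityAt (J := I) (fun s ↦ (Z s).1) t w ∧
      HasDerivAt (fun s ↦ fiberCoord I (Z t).1 (Z s))
        (toModel (Z t).1 (u - cov (FiberBundle.extend E (Z t).2) (Z t).1 w)) t := by
  rw [hasVelocityAt_tangentBundle, map_add, map_add, (horizontalLift_components cov (Z t) w).1,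
    (horizontalLift_components cov (Z t) w).2, (verticalLift_components (Z t) u).1,
    (verticalLift_components (Z t) u).2, add_zero, map_sub, neg_add_eq_sub]

/-- The covariant derivative along a curve, in the fibre coordinate of the preferred
trivialization. -/
theorem hasCovDerivAlong_iff {Z : ℝ → TangentBundle I M} {t : ℝ} {w u : TangentSpace I (Z t).1}
    (hw : HasVelocityAt (J := I) (fun s ↦ (Z s).1) t w) :
    HasCovDerivAlong cov Z t u ↔
      HasDerivAt (fun s ↦ fiberCoord I (Z t).1 (Z s))
        (toModel (Z t).1 (u - cov (FiberBundle.extend E (Z t).2) (Z t).1 w)) t := by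
  obtain rfl := hw.velocity_snd
  exact (hasVelocityAt_horizontalLift_add cov).trans (and_iff_right hw)

variable {cov}

theorem HasCovDerivAlong.exists_hasVelocityAt {Z : ℝ → TangentBundle I M} {t : ℝ}
    {u : TangentSpace I (Z t).1} (h : HasCovDerivAlong cov Z t u) :
    ∃ w : TangentSpace I (Z t).1, HasVelocityAt (J := I) (fun s ↦ (Z s).1) t w :=
  ⟨_, ((hasVelocityAt_horizontalLift_add cov).1 h).1⟩

theorem HasCovDerivAlong.unique {Z : ℝ → TangentBundle I M} {t : ℝ}
    {u u' : TangentSpace I (Z t).1} (h : HasCovDerivAlong cov Z t u)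
    (h' : HasCovDerivAlong cov Z t u') : u = u' := by
  obtain ⟨w, hw⟩ := h.exists_hasVelocityAt
  have h1 := (hasCovDerivAlong_iff cov hw).1 h
  have h2 := (hasCovDerivAlong_iff cov hw).1 h'
  exact sub_left_injective ((toModel (Z t).1).injective (h1.unique h2))

theorem HasCovDerivAlong.congr {Z Z' : ℝ → TangentBundle I M} {t : ℝ} (hZ : Z' =ᶠ[𝓝 t] Z)
    {u : TangentSpace I (Z t).1} (h : HasCovDerivAlong cov Z t u)
    {u' : TangentSpace I (Z' t).1} (hu : (⟨(Z' t).1, u'⟩ : TangentBundle I M) = ⟨(Z t).1, u⟩) :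
    HasCovDerivAlong cov Z' t u' := by
  obtain ⟨w, hw⟩ := h.exists_hasVelocityAt
  have e := hZ.self_of_nhds
  obtain ⟨w', hw'⟩ : ∃ w' : TangentSpace I (Z' t).1,
      (⟨(Z' t).1, w'⟩ : TangentBundle I M) = ⟨(Z t).1, w⟩ := by
    rw [e]
    exact ⟨w, rfl⟩
  have h3 : HasVelocityAt (J := I) (fun s ↦ (Z' s).1) t w' :=
    hw.congr (hZ.fun_comp (fun q ↦ q.1)) hw'
  refine (hasCovDerivAlong_iff cov h3).2 ?_
  refine HasDerivAt.congr_of_eventuallyEq (f := fun s ↦ fiberCoord I (Z' t).1 (Z s)) ?_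
    (hZ.fun_comp (fun q ↦ fiberCoord I (Z' t).1 q))
  -- The points are generalised so that their equality can be substituted in the dependent types.
  have key : ∀ (p p' : TangentBundle I M) (u w : TangentSpace I p.1) (u' w' : TangentSpace I p'.1),
      p' = p → (⟨p'.1, u'⟩ : TangentBundle I M) = ⟨p.1, u⟩ →
      (⟨p'.1, w'⟩ : TangentBundle I M) = ⟨p.1, w⟩ →
      HasDerivAt (fun s ↦ fiberCoord I p.1 (Z s))
        (toModel p.1 (u - cov (FiberBundle.extend E p.2) p.1 w)) t →
      HasDerivAt (fun s ↦ fiberCoord I p'.1 (Z s))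
        (toModel p'.1 (u' - cov (FiberBundle.extend E p'.2) p'.1 w')) t := by
    rintro p p' u w u' w' rfl hu hw h
    rwa [TotalSpace.mk_inj.1 hu, TotalSpace.mk_inj.1 hw]
  exact key _ _ _ _ _ _ e hu hw' ((hasCovDerivAlong_iff cov hw).1 h)

variable [FiniteDimensional ℝ E]

theorem mdifferentiableAt_fiberCoord {σ : Π y : M, TangentSpace I y} {x : M}
    (hσ : MDiffAt (T% σ) x) : MDiffAt (fun y ↦ fiberCoord I x ⟨y, σ y⟩) x :=
  (mdifferentiableAt_section I σ).1 hσ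

/-- The difference between a connection and the trivial connection of the preferred trivialization
is tensorial. -/
theorem cov_sub_tensorial (cov : CovariantDerivative I E (fun x : M ↦ TangentSpace I x)) (x : M) :
    TensorialAt I E (fun σ : Π y : M, TangentSpace I y ↦
      (toModel x).toContinuousLinearMap.comp (cov σ x) -
      d% (fun y ↦ fiberCoord I x ⟨y, σ y⟩) x) x where
  smul {f σ} hf hσ := by
    have h2 : (fun y ↦ fiberCoord I x ⟨y, (f • σ) y⟩) =ᶠ[𝓝 x]
        f • fun y ↦ fiberCoord I x ⟨y, σ y⟩ := by
      filter_upwards [(chartAt H x).open_source.mem_nhds (mem_chart_source H x)] with y hy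
      exact fiberCoord_smul hy _ _
    have h3 : d% (fun y ↦ fiberCoord I x ⟨y, (f • σ) y⟩) x =
        d% (f • fun y ↦ fiberCoord I x ⟨y, σ y⟩) x := by
      simp only [mvfderiv, h2.mfderiv_eq]
      rfl
    rw [h3, mvfderiv_smul hf (mdifferentiableAt_fiberCoord hσ),
      cov.isCovariantDerivativeOnUniv.leibniz hσ hf]
    ext w
    simp [fiberCoord_self]
    module
  add {σ τ} hσ hτ := by
    have h2 : (fun y ↦ fiberCoord I x ⟨y, (σ + τ) y⟩) =ᶠ[𝓝 x]
        (fun y ↦ fiberCoord I x ⟨y, σ y⟩) + fun y ↦ fiberCoord I x ⟨y, τ y⟩ := by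
      filter_upwards [(chartAt H x).open_source.mem_nhds (mem_chart_source H x)] with y hy
      exact fiberCoord_add hy _ _
    have h3 : d% (fun y ↦ fiberCoord I x ⟨y, (σ + τ) y⟩) x =
        d% ((fun y ↦ fiberCoord I x ⟨y, σ y⟩) + fun y ↦ fiberCoord I x ⟨y, τ y⟩) x := by
      simp only [mvfderiv, h2.mfderiv_eq]
      rfl
    rw [h3, mvfderiv_add (mdifferentiableAt_fiberCoord hσ) (mdifferentiableAt_fiberCoord hτ),
      cov.isCovariantDerivativeOnUniv.add hσ hτ]
    ext w
    simp
    module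

theorem mdifferentiableAt_extend' {x : M} (v : TangentSpace I x) :
    MDiffAt (T% (FiberBundle.extend E v)) x := FiberBundle.mdifferentiableAt_extend ..

theorem mvfderiv_fiberCoord_extend {x : M} (v : TangentSpace I x) :
    d% (fun y ↦ fiberCoord I x ⟨y, FiberBundle.extend E v y⟩) x = 0 := by
  have h : (fun y ↦ fiberCoord I x ⟨y, FiberBundle.extend E v y⟩) =ᶠ[𝓝 x]
      fun _ ↦ toModel x v := by
    filter_upwards [(chartAt H x).open_source.mem_nhds (mem_chart_source H x)] with y hy
    exact fiberCoord_extend hy v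
  rw [← mvfderiv_const (I := I) (toModel x v) (x := x)]
  simp only [mvfderiv, h.mfderiv_eq]
  rfl

variable (cov)

/-- The covariant derivative of a vector field, in the preferred trivialization. -/
theorem cov_apply_eq {σ : Π y : M, TangentSpace I y} {x : M} (hσ : MDiffAt (T% σ) x)
    (w : TangentSpace I x) :
    toModel x (cov σ x w) = d% (fun y ↦ fiberCoord I x ⟨y, σ y⟩) x w +
      toModel x (cov (FiberBundle.extend E (σ x)) x w) := by
  have h := (cov_sub_tensorial cov x).pointwise hσ (mdifferentiableAt_extend' (σ x)) (by simp)
  have h2 := congr($h w)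
  rw [mvfderiv_fiberCoord_extend] at h2
  simp at h2
  rw [← h2]
  abel

/-- On extensions the derivative in the trivialization vanishes at `x`, so the tensorial difference
of `cov_sub_tensorial` is the connection itself, and its tensoriality becomes linearity in `v`. The
same argument gives additivity. -/
theorem cov_extend_smul {x : M} (a : ℝ) (v w : TangentSpace I x) :
    cov (FiberBundle.extend E (a • v)) x w = a • cov (FiberBundle.extend E v) x w := by
  have h := (cov_sub_tensorial cov x).pointwise (mdifferentiableAt_extend' (a • v))
    (mdifferentiableAt_const.smul_section (mdifferentiableAt_extend' v) (f := fun _ ↦ a))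
    (by simp)
  have h0 := (cov_sub_tensorial cov x).smul (mdifferentiableAt_const (c := a))
    (mdifferentiableAt_extend' v)
  have h2 := congr($(h.trans h0) w)
  rw [mvfderiv_fiberCoord_extend, mvfderiv_fiberCoord_extend] at h2
  refine (toModel x).injective ?_
  simpa using h2

theorem cov_extend_add {x : M} (v v' w : TangentSpace I x) :
    cov (FiberBundle.extend E (v + v')) x w =
      cov (FiberBundle.extend E v) x w + cov (FiberBundle.extend E v') x w := by
  have h := (cov_sub_tensorial cov x).pointwise (mdifferentiableAt_extend' (v + v'))
    (mdifferentiableAt_add_section (mdifferentiableAt_extend' v) (mdifferentiableAt_extend' v'))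
    (by simp)
  have h0 := (cov_sub_tensorial cov x).add (mdifferentiableAt_extend' v)
    (mdifferentiableAt_extend' v')
  have h2 := congr($(h.trans h0) w)
  rw [mvfderiv_fiberCoord_extend, mvfderiv_fiberCoord_extend, mvfderiv_fiberCoord_extend] at h2
  refine (toModel x).injective ?_
  simpa using h2

variable {cov}

/-- The Leibniz rule for the covariant derivative along a curve. -/
theorem HasCovDerivAlong.smul {Z : ℝ → TangentBundle I M} {t : ℝ}
    {u : TangentSpace I (Z t).1} (h : HasCovDerivAlong cov Z t u) {f : ℝ → ℝ} {f' : ℝ}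
    (hf : HasDerivAt f f' t) :
    HasCovDerivAlong cov (fun s ↦ ⟨(Z s).1, f s • (Z s).2⟩) t (f' • (Z t).2 + f t • u) := by
  obtain ⟨w, hw⟩ := h.exists_hasVelocityAt
  refine (hasCovDerivAlong_iff (Z := fun s ↦ ⟨(Z s).1, f s • (Z s).2⟩) cov hw).2 ?_
  have h2 := (hasCovDerivAlong_iff cov hw).1 h
  have h3 := hf.smul h2
  have h4 : (fun s ↦ fiberCoord I (Z t).1 ⟨(Z s).1, f s • (Z s).2⟩) =ᶠ[𝓝 t]
      f • fun s ↦ fiberCoord I (Z t).1 (Z s) := by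
    filter_upwards [hw.mdifferentiableAt.continuousAt.preimage_mem_nhds
      ((chartAt H (Z t).1).open_source.mem_nhds (mem_chart_source H (Z t).1))] with s hs
    exact fiberCoord_smul hs _ _
  refine (h3.congr_of_eventuallyEq h4).congr_deriv ?_
  have h5 := cov_extend_smul cov (f t) (Z t).2 w
  rw [fiberCoord_self]
  dsimp only
  rw [h5]
  simp only [map_sub, map_add, map_smul]
  module

theorem HasCovDerivAlong.comp {Z : ℝ → TangentBundle I M} {φ : ℝ → ℝ} {t a : ℝ}
    {u : TangentSpace I (Z (φ t)).1} (h : HasCovDerivAlong cov Z (φ t) u)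
    (hφ : HasDerivAt φ a t) :
    HasCovDerivAlong cov (fun s ↦ Z (φ s)) t (a • u) := by
  obtain ⟨w, hw⟩ := h.exists_hasVelocityAt
  refine (hasCovDerivAlong_iff (Z := fun s ↦ Z (φ s)) cov (hw.comp hφ)).2 ?_
  have h2 := (hasCovDerivAlong_iff cov hw).1 h
  refine (h2.scomp t hφ).congr_deriv ?_
  rw [map_smul, ← smul_sub, map_smul]

/-- The chain rule, with the derivative in the trivialization rewritten by `cov_apply_eq` as a
difference of two covariant derivatives. The second one cancels against the connection term of
`hasCovDerivAlong_iff`. -/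
theorem hasDerivAt_fiberCoord_comp {c : ℝ → M} {t : ℝ} {w : TangentSpace I (c t)}
    (hc : HasVelocityAt c t w) {ρ : Π y : M, TangentSpace I y} (hρ : MDiffAt (T% ρ) (c t)) :
    HasDerivAt (fun s ↦ fiberCoord I (c t) ⟨c s, ρ (c s)⟩)
      (toModel (c t) (cov ρ (c t) w) -
        toModel (c t) (cov (FiberBundle.extend E (ρ (c t))) (c t) w)) t := by
  rw [cov_apply_eq cov hρ, add_sub_cancel_right]
  have h1 := HasMFDerivAt.comp t (mdifferentiableAt_fiberCoord hρ).hasMFDerivAt hc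
  have h2 : (mfderiv I 𝓘(ℝ, E) (fun y ↦ fiberCoord I (c t) ⟨y, ρ y⟩) (c t)).comp
      ((1 : ℝ →L[ℝ] ℝ).smulRight w) =
      ((1 : ℝ →L[ℝ] ℝ).smulRight (d% (fun y ↦ fiberCoord I (c t) ⟨y, ρ y⟩) (c t) w)) := by
    refine ContinuousLinearMap.ext_ring ?_
    change d% (fun y ↦ fiberCoord I (c t) ⟨y, ρ y⟩) (c t) ((1 : ℝ) • w) = (1 : ℝ) • _
    rw [one_smul, one_smul]
  exact hasMFDerivAt_iff_hasFDerivAt.1 ((congrArg (HasMFDerivAt 𝓘(ℝ, ℝ) 𝓘(ℝ, E) _ t) h2).mp h1)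

/-- The covariant derivative along a curve of a linear combination of two vector fields. -/
theorem hasCovDerivAlong_frame {c : ℝ → M} {t : ℝ} {w : TangentSpace I (c t)}
    (hc : HasVelocityAt c t w) {σ τ : Π y : M, TangentSpace I y} (hσ : MDiffAt (T% σ) (c t))
    (hτ : MDiffAt (T% τ) (c t)) {a b : ℝ → ℝ} {a' b' : ℝ} (ha : HasDerivAt a a' t)
    (hb : HasDerivAt b b' t) :
    HasCovDerivAlong cov (fun s ↦ ⟨c s, a s • σ (c s) + b s • τ (c s)⟩) t
      (a' • σ (c t) + b' • τ (c t) + a t • cov σ (c t) w + b t • cov τ (c t) w) := by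
  refine (hasCovDerivAlong_iff (Z := fun s ↦ ⟨c s, a s • σ (c s) + b s • τ (c s)⟩) cov hc).2 ?_
  have h3 := (ha.smul (hasDerivAt_fiberCoord_comp (cov := cov) hc hσ)).add
    (hb.smul (hasDerivAt_fiberCoord_comp (cov := cov) hc hτ))
  have h4 : (fun s ↦ fiberCoord I (c t) ⟨c s, a s • σ (c s) + b s • τ (c s)⟩) =ᶠ[𝓝 t]
      (a • fun s ↦ fiberCoord I (c t) ⟨c s, σ (c s)⟩) +
      (b • fun s ↦ fiberCoord I (c t) ⟨c s, τ (c s)⟩) := by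
    filter_upwards [hc.mdifferentiableAt.continuousAt.preimage_mem_nhds
      ((chartAt H (c t)).open_source.mem_nhds (mem_chart_source H (c t)))] with s hs
    rw [fiberCoord_add hs, fiberCoord_smul hs, fiberCoord_smul hs]
    rfl
  refine (h3.congr_of_eventuallyEq h4).congr_deriv ?_
  have h5 := cov_extend_add cov (a t • σ (c t)) (b t • τ (c t)) w
  rw [cov_extend_smul, cov_extend_smul] at h5
  dsimp only
  rw [h5, fiberCoord_self, fiberCoord_self]
  simp only [map_sub, map_add, map_smul]
  module

/-- The effect of a change of connection on the covariant derivative along a curve. -/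
theorem HasCovDerivAlong.change {Z : ℝ → TangentBundle I M} {t : ℝ} {u w : TangentSpace I (Z t).1}
    (h : HasCovDerivAlong cov Z t u)
    (cov' : CovariantDerivative I E (fun x : M ↦ TangentSpace I x))
    (hw : HasVelocityAt (J := I) (fun s ↦ (Z s).1) t w) :
    HasCovDerivAlong cov' Z t (u + (cov' (FiberBundle.extend E (Z t).2) (Z t).1 w -
      cov (FiberBundle.extend E (Z t).2) (Z t).1 w)) := by
  refine (hasCovDerivAlong_iff cov' hw).2 (((hasCovDerivAlong_iff cov hw).1 h).congr_deriv ?_)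
  congr 1
  abel

/-- The covariant derivative of the velocity of a reparametrised curve. -/
theorem hasCovDerivAlong_velocity_comp {Z : ℝ → TangentBundle I M} {φ : ℝ → ℝ} {t b : ℝ}
    {u : TangentSpace I (Z (φ t)).1} (h : HasCovDerivAlong cov Z (φ t) u)
    (hZ : ∀ᶠ s in 𝓝 (φ t), HasVelocityAt (J := I) (fun r ↦ (Z r).1) s (Z s).2)
    (hφ : ∀ᶠ s in 𝓝 t, DifferentiableAt ℝ φ s) (hφ' : HasDerivAt (deriv φ) b t) :
    HasCovDerivAlong cov (velocity I (fun s ↦ (Z (φ s)).1)) t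
      (b • (Z (φ t)).2 + deriv φ t • deriv φ t • u) := by
  have h0 := hφ.self_of_nhds
  have h1 := (h.comp h0.hasDerivAt).smul hφ'
  have h2 : velocity I (fun s ↦ (Z (φ s)).1) =ᶠ[𝓝 t]
      fun s ↦ ⟨(Z (φ s)).1, deriv φ s • (Z (φ s)).2⟩ := by
    filter_upwards [hφ, h0.continuousAt.eventually hZ] with s hs hs'
    exact (HasVelocityAt.comp hs' hs.hasDerivAt).velocity_eq
  exact h1.congr h2 rfl

end Geodesics

/-! ### Smoothness criteria and the smoothness of the Levi-Civita connection. -/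

section Smoothness

variable {E : Type*} [NormedAddCommGroup E] [NormedSpace ℝ E] [FiniteDimensional ℝ E]
  {H : Type*} [TopologicalSpace H] {I : ModelWithCorners ℝ E H}
  {M : Type*} [TopologicalSpace M] [ChartedSpace H M] [IsManifold I ∞ M]
  {EN : Type*} [NormedAddCommGroup EN] [NormedSpace ℝ EN] {HN : Type*} [TopologicalSpace HN]
  {J : ModelWithCorners ℝ EN HN} {N : Type*} [TopologicalSpace N] [ChartedSpace HN N]

/-- As `E` is finite-dimensional, a basis identifies the maps `E →L[ℝ] G` with finite families in
`G`. -/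
theorem contMDiffAt_clm_of_apply {G : Type*} [NormedAddCommGroup G] [NormedSpace ℝ G]
    {f : N → E →L[ℝ] G} {n : N} {k : ℕ∞ω} (h : ∀ v, CMDiffAt k (fun m ↦ f m v) n) :
    CMDiffAt k f n := by
  let d := Module.finrank ℝ E
  have hd : d = Module.finrank ℝ (Fin d → ℝ) := (Module.finrank_fin_fun ℝ).symm
  let e₁ := ContinuousLinearEquiv.ofFinrankEq hd
  let e₂ := (e₁.arrowCongr (1 : G ≃L[ℝ] G)).trans (ContinuousLinearEquiv.piRing (Fin d))
  rw [← Function.id_comp f, ← e₂.symm_comp_self]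
  refine (e₂.symm.contDiff.contMDiff.contMDiffAt).comp n ?_
  exact contMDiffAt_pi_space.mpr fun i ↦ h (e₁.symm (Pi.single i 1))

/-- A section of the endomorphism bundle is smooth if its values on smooth vector fields are. -/
theorem contMDiffAt_hom_of_apply {A : Π x : M, TangentSpace I x →L[ℝ] TangentSpace I x} {x₀ : M}
    {k : ℕ∞ω}
    (h : ∀ v : TangentSpace I x₀, ContMDiffAt I I.tangent k
      (fun x ↦ (⟨x, A x (FiberBundle.extend E v x)⟩ : TangentBundle I M)) x₀) :
    ContMDiffAt I (I.prod 𝓘(ℝ, E →L[ℝ] E)) k (fun x ↦ TotalSpace.mk' (E →L[ℝ] E)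
      (E := fun x : M ↦ TangentSpace I x →L[ℝ] TangentSpace I x) x (A x)) x₀ := by
  rw [contMDiffAt_hom_bundle]
  refine ⟨contMDiffAt_id, contMDiffAt_clm_of_apply fun v ↦ ?_⟩
  have h1 := (contMDiffAt_totalSpace.1 (h ((toModel x₀).symm v))).2
  refine h1.congr_of_eventuallyEq ?_
  filter_upwards [(chartAt H x₀).open_source.mem_nhds (mem_chart_source H x₀)] with y hy
  have hy' : y ∈ (trivializationAt E (fun x : M ↦ TangentSpace I x) x₀).baseSet := hy
  have h2 : (trivializationAt E (fun x : M ↦ TangentSpace I x) x₀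
      ⟨x₀, (toModel x₀).symm v⟩).2 = v := fiberCoord_self x₀ ((toModel x₀).symm v)
  rw [ContinuousLinearMap.inCoordinates_eq hy' hy', FiberBundle.extend, h2]
  simp

theorem contMDiffAt_mvfderiv_apply {f : M → ℝ} {U : Π x : M, TangentSpace I x} {x₀ : M}
    (hf : CMDiffAt ∞ f x₀) (hU : CMDiffAt ∞ (T% U) x₀) : CMDiffAt ∞ (fun x ↦ d% f x (U x)) x₀ := by
  have h1 := hf.mfderiv_const (m := ∞) (by simp)
  have h2 := ContMDiffAt.clm_apply_of_inCoordinates (b₁ := id) (b₂ := f)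
    (E₁ := fun x : M ↦ TangentSpace I x) (E₂ := fun x : ℝ ↦ TangentSpace 𝓘(ℝ, ℝ) x) h1 hU hf
  have h3 := (contMDiffAt_totalSpace.1 h2).2
  refine h3.congr_of_eventuallyEq (Filter.Eventually.of_forall fun y ↦ ?_)
  simp
  rfl

end Smoothness

section LeviCivita
variable {E : Type*} [NormedAddCommGroup E] [NormedSpace ℝ E] [FiniteDimensional ℝ E]
  {H : Type*} [TopologicalSpace H] {I : ModelWithCorners ℝ E H}
  {M : Type*} [TopologicalSpace M] [ChartedSpace H M] [IsManifold I ∞ M]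
  [RiemannianBundle (fun x : M ↦ TangentSpace I x)]
  [IsContMDiffRiemannianBundle I ∞ E (fun x : M ↦ TangentSpace I x)]

theorem contMDiffAt_inner {U W : Π x : M, TangentSpace I x} {x : M}
    (hU : CMDiffAt ∞ (T% U) x) (hW : CMDiffAt ∞ (T% W) x) :
    CMDiffAt ∞ (fun y : M ↦ (inner ℝ (U y) (W y) : ℝ)) x :=
  ContMDiffAt.inner_bundle (IB := I) (F := E) (E := fun x : M ↦ TangentSpace I x)
    (b := fun y : M ↦ y) hU hW

theorem contMDiffAt_mlieBracket [CompleteSpace E] {U W : Π x : M, TangentSpace I x} {x : M}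
    (hU : CMDiffAt ∞ (T% U) x) (hW : CMDiffAt ∞ (T% W) x) :
    CMDiffAt ∞ (T% (VectorField.mlieBracket I U W)) x := by
  have : IsManifold I (minSmoothness ℝ 2) M := by
    rw [minSmoothness_of_isRCLikeNormedField]
    infer_instance
  have : IsManifold I ((⊤ : ℕ∞) + 1) M := by
    change IsManifold I ∞ M
    infer_instance
  exact ContMDiffAt.mlieBracket_vectorField (m := ⊤) (n := ⊤) hU hW (by
    rw [minSmoothness_of_isRCLikeNormedField]; simp)

theorem contMDiffAt_koszul {Y U W : Π x : M, TangentSpace I x} {x : M}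
    (hY : CMDiffAt ∞ (T% Y) x) (hU : CMDiffAt ∞ (T% U) x) (hW : CMDiffAt ∞ (T% W) x) :
    CMDiffAt ∞ (koszul I Y U W) x := by
  have : CompleteSpace E := FiniteDimensional.complete ℝ E
  unfold koszul
  exact (((((contMDiffAt_mvfderiv_apply (contMDiffAt_inner hY hW) hU).add
    (contMDiffAt_mvfderiv_apply (contMDiffAt_inner hU hW) hY)).sub
    (contMDiffAt_mvfderiv_apply (contMDiffAt_inner hU hY) hW)).add
    (contMDiffAt_inner (contMDiffAt_mlieBracket hU hY) hW)).sub
    (contMDiffAt_inner (contMDiffAt_mlieBracket hU hW) hY)).sub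
    (contMDiffAt_inner (contMDiffAt_mlieBracket hY hW) hU)

theorem eventually_mdifferentiableAt {σ : Π x : M, TangentSpace I x} {x : M}
    (h : CMDiffAt ∞ (T% σ) x) : ∀ᶠ y in 𝓝 x, MDiffAt (T% σ) y := by
  have h1 : CMDiffAt 1 (T% σ) x := h.of_le (by simp)
  filter_upwards [(contMDiffAt_iff_contMDiffAt_nhds (by simp)).1 h1] with y hy
  exact ContMDiffAt.mdifferentiableAt hy (by simp)

/-- The Koszul formula holds at all nearby points, since smooth fields are differentiable near `x`;
so the product agrees there with half of a smooth function. -/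
theorem contMDiffAt_inner_leviCivita {Y U W : Π x : M, TangentSpace I x} {x : M}
    (hY : CMDiffAt ∞ (T% Y) x) (hU : CMDiffAt ∞ (T% U) x) (hW : CMDiffAt ∞ (T% W) x) :
    CMDiffAt ∞ (fun y ↦ (inner ℝ (leviCivita I M Y y (U y)) (W y) : ℝ)) x := by
  refine (contMDiffAt_const (c := (2⁻¹ : ℝ)).mul (contMDiffAt_koszul hY hU hW)).congr_of_eventuallyEq ?_
  filter_upwards [eventually_mdifferentiableAt hY, eventually_mdifferentiableAt hU,
    eventually_mdifferentiableAt hW] with y h1 h2 h3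
  have := inner_leviCivitaAux h1 h2 h3
  change inner ℝ (leviCivitaAux I Y y (U y)) (W y) = (2⁻¹ : ℝ) * koszul I Y U W y
  linarith

end LeviCivita


section FiberCoord

variable {E : Type*} [NormedAddCommGroup E] [NormedSpace ℝ E]
  {H : Type*} [TopologicalSpace H] {I : ModelWithCorners ℝ E H}
  {M : Type*} [TopologicalSpace M] [ChartedSpace H M] [IsManifold I ∞ M]

theorem contMDiffAt_fiberCoord {σ : Π y : M, TangentSpace I y} {x : M} {n : ℕ∞ω}
    (hσ : CMDiffAt n (T% σ) x) :
    ContMDiffAt I 𝓘(ℝ, E) n (fun y ↦ fiberCoord I x ⟨y, σ y⟩) x :=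
  (contMDiffAt_totalSpace.1 hσ).2

end FiberCoord

/-! ### Oriented Euclidean planes. -/

section Plane

variable {V : Type*} [NormedAddCommGroup V] [InnerProductSpace ℝ V]
  [Fact (Module.finrank ℝ V = 2)] (o : Orientation ℝ V (Fin 2))

/-- Both sides are computed in a positive orthonormal basis, whose determinant is the volume form.
It turns equality of orientations into proportionality of volume forms. -/
theorem rayOfNeZero_volumeForm (h : o.volumeForm ≠ 0) : rayOfNeZero ℝ o.volumeForm h = o := by
  have h0 := o.finOrthonormalBasis_orientation two_pos (Fact.out : Module.finrank ℝ V = 2)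
  have h1 := o.volumeForm_robust _ h0
  conv_rhs => rw [← h0]
  rw [Module.Basis.orientation]
  congr 1

theorem volumeForm_ne_zero : o.volumeForm ≠ 0 := by
  have h0 := o.finOrthonormalBasis_orientation two_pos (Fact.out : Module.finrank ℝ V = 2)
  rw [o.volumeForm_robust _ h0]
  exact Module.Basis.det_ne_zero _

/-- Equal orientations of `W` mean that the two transported volume forms lie on the same ray, hence
differ by a positive factor. -/
theorem exists_areaForm_eq {V' W : Type*} [NormedAddCommGroup V'] [InnerProductSpace ℝ V']
    [Fact (Module.finrank ℝ V' = 2)] [AddCommGroup W] [Module ℝ W] (o' : Orientation ℝ V' (Fin 2))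
    (e : V ≃ₗ[ℝ] W) (e' : V' ≃ₗ[ℝ] W)
    (h : Orientation.map (Fin 2) e o = Orientation.map (Fin 2) e' o') :
    ∃ r : ℝ, 0 < r ∧ ∀ u v, o.areaForm u v = r * o'.areaForm (e'.symm (e u)) (e'.symm (e v)) := by
  rw [← rayOfNeZero_volumeForm o (volumeForm_ne_zero o),
    ← rayOfNeZero_volumeForm o' (volumeForm_ne_zero o'), Orientation.map_apply,
    Orientation.map_apply, ray_eq_iff] at h
  obtain ⟨r, hr, hr'⟩ := h.symm.exists_pos_left
    (mt (AlternatingMap.compLinearEquiv_eq_zero_iff _ _).1 (volumeForm_ne_zero _))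
    (mt (AlternatingMap.compLinearEquiv_eq_zero_iff _ _).1 (volumeForm_ne_zero _))
  refine ⟨r, hr, fun u v ↦ ?_⟩
  have h3 := congr($hr' ![e u, e v])
  rw [Orientation.areaForm_to_volumeForm, Orientation.areaForm_to_volumeForm]
  have h4 : (fun i ↦ e.symm (![e u, e v] i)) = ![u, v] := by
    ext i; fin_cases i <;> simp
  have h5 : (fun i ↦ e'.symm (![e u, e v] i)) = ![e'.symm (e u), e'.symm (e v)] := by
    ext i; fin_cases i <;> simp
  rw [← h4, ← h5]
  exact h3.symm

/-- From `⟨u, v⟩² + ω(u, v)² = 1` and positivity, `ω(u, v) = 1`; then `|Ju - v|² = 2 - 2 ω(u, v) =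
0`. -/
theorem eq_rightAngleRotation {u v : V} (hu : inner ℝ u u = (1 : ℝ)) (hv : inner ℝ v v = (1 : ℝ))
    (huv : inner ℝ u v = (0 : ℝ)) (h : 0 < o.areaForm u v) : o.rightAngleRotation u = v := by
  have h1 : o.areaForm u v = 1 := by
    have := o.inner_sq_add_areaForm_sq u v
    rw [huv, ← real_inner_self_eq_norm_sq, ← real_inner_self_eq_norm_sq, hu, hv] at this
    nlinarith
  have h2 : inner ℝ (o.rightAngleRotation u - v) (o.rightAngleRotation u - v) = (0 : ℝ) := by
    rw [inner_sub_left, inner_sub_right, inner_sub_right, o.inner_comp_rightAngleRotation, hu, hv,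
      real_inner_comm (o.rightAngleRotation u) v, o.inner_rightAngleRotation_left, h1]
    norm_num
  exact sub_eq_zero.1 (inner_self_eq_zero.1 h2)

theorem eq_frame {e : V} (he : inner ℝ e e = (1 : ℝ)) (v : V) :
    v = (inner ℝ e v : ℝ) • e + (inner ℝ (o.rightAngleRotation e) v : ℝ) • o.rightAngleRotation e := by
  refine ext_inner_right ℝ fun w ↦ ?_
  rw [inner_add_left, inner_smul_left, inner_smul_left, o.inner_rightAngleRotation_left,
    o.inner_rightAngleRotation_left]
  have := o.inner_mul_inner_add_areaForm_mul_areaForm e v w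
  rw [← real_inner_self_eq_norm_sq, he, one_mul] at this
  rw [← this]
  rfl

end Plane

/-! ### Smooth positively oriented orthonormal frames. -/

variable {M : Type*} [TopologicalSpace M] [ChartedSpace Plane M] [IsManifold (𝓡 2) ∞ M]
  [RiemannianBundle (fun x : M ↦ TangentSpace (𝓡 2) x)]

theorem exists_inner_self_eq_one (x : M) : ∃ v : TangentSpace (𝓡 2) x, (inner ℝ v v : ℝ) = 1 := by
  have : Nontrivial (TangentSpace (𝓡 2) x) := Module.nontrivial_of_finrank_pos (R := ℝ) (by
    rw [(Fact.out : Module.finrank ℝ (TangentSpace (𝓡 2) x) = 2)]; norm_num)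
  obtain ⟨v, hv⟩ := exists_ne (0 : TangentSpace (𝓡 2) x)
  exact ⟨‖v‖⁻¹ • v, by rw [real_inner_self_eq_norm_sq, norm_smul, norm_inv, norm_norm,
    inv_mul_cancel₀ (norm_ne_zero_iff.2 hv), one_pow]⟩

/-- The rotation by a right angle. -/
noncomputable def rot (o : SurfaceOrientation M) (x : M) :
    TangentSpace (𝓡 2) x ≃ₗᵢ[ℝ] TangentSpace (𝓡 2) x := (o.orient x).rightAngleRotation

/-- The vector field `σ` is smooth at `x`. -/
abbrev SmoothFieldAt (σ : Π y : M, TangentSpace (𝓡 2) y) (x : M) : Prop :=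
  ContMDiffAt (𝓡 2) (𝓡 2).tangent ∞ (fun y ↦ (⟨y, σ y⟩ : TangentBundle (𝓡 2) M)) x

theorem continuous_areaForm {V : Type*} [NormedAddCommGroup V] [InnerProductSpace ℝ V]
    [Fact (Module.finrank ℝ V = 2)] (o : Orientation ℝ V (Fin 2)) (e : V ≃L[ℝ] Plane) :
    Continuous fun p : Plane × Plane ↦ o.areaForm (e.symm p.1) (e.symm p.2) := by
  change Continuous fun p : Plane × Plane ↦ o.areaForm' (e.symm p.1) (e.symm p.2)
  fun_prop

/-- The area form is not known to vary continuously; only the orientation is locally constant in a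
trivialization. So the fixed area form at `x₀` is transported to nearby fibres: it is continuous in
the fibre coordinates and differs from the area form at `x` by a positive factor. -/
theorem eventually_areaForm_pos (o : SurfaceOrientation M) {x₀ : M}
    {σ τ : Π y : M, TangentSpace (𝓡 2) y} (hσ : SmoothFieldAt σ x₀) (hτ : SmoothFieldAt τ x₀)
    (h : 0 < (o.orient x₀).areaForm (σ x₀) (τ x₀)) :
    ∀ᶠ x in 𝓝 x₀, 0 < (o.orient x).areaForm (σ x) (τ x) := by
  obtain ⟨o₀, ho₀⟩ := o.locally_constant x₀
  obtain ⟨hx₀, h₀⟩ := ho₀.self_of_nhds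
  let e₀ := (trivializationAt Plane (fun y : M ↦ TangentSpace (𝓡 2) y) x₀).continuousLinearEquivAt
    ℝ x₀ hx₀
  let af : Plane × Plane → ℝ := fun p ↦ (o.orient x₀).areaForm (e₀.symm p.1) (e₀.symm p.2)
  have h1 : ContinuousAt (fun y ↦ af (fiberCoord (𝓡 2) x₀ ⟨y, σ y⟩,
      fiberCoord (𝓡 2) x₀ ⟨y, τ y⟩)) x₀ :=
    (continuous_areaForm (o.orient x₀) e₀).continuousAt.comp
      ((contMDiffAt_fiberCoord hσ).continuousAt.prodMk (contMDiffAt_fiberCoord hτ).continuousAt)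
  have h2 : 0 < af (fiberCoord (𝓡 2) x₀ ⟨x₀, σ x₀⟩, fiberCoord (𝓡 2) x₀ ⟨x₀, τ x₀⟩) := by
    change 0 < (o.orient x₀).areaForm (e₀.symm (e₀ (σ x₀))) (e₀.symm (e₀ (τ x₀)))
    rwa [e₀.symm_apply_apply, e₀.symm_apply_apply]
  filter_upwards [ho₀, h1.eventually (lt_mem_nhds h2)] with x ⟨hx, ho⟩ hpos
  obtain ⟨r, hr, h3⟩ := exists_areaForm_eq _ _ _ _ (ho.trans h₀.symm)
  rw [h3]
  exact mul_pos hr hpos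

variable [IsContMDiffRiemannianBundle (𝓡 2) ∞ Plane (fun x : M ↦ TangentSpace (𝓡 2) x)]

/-- A smooth positively oriented orthonormal frame near a point. -/
structure IsOrthonormalFrameAt (o : SurfaceOrientation M)
    (e₁ e₂ : Π x : M, TangentSpace (𝓡 2) x) (x₀ : M) : Prop where
  smooth₁ : SmoothFieldAt e₁ x₀
  smooth₂ : SmoothFieldAt e₂ x₀
  unit : ∀ᶠ x in 𝓝 x₀, (inner ℝ (e₁ x) (e₁ x) : ℝ) = 1
  rot_eq : ∀ᶠ x in 𝓝 x₀, rot o x (e₁ x) = e₂ x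

/-- The factor `r` is part of the conclusion because the caller needs that orthogonality relations
of `σ` pass to `τ`. -/
theorem contMDiffAt_normalize {σ : Π y : M, TangentSpace (𝓡 2) y} {x₀ : M}
    (hσ : SmoothFieldAt σ x₀) (h : (inner ℝ (σ x₀) (σ x₀) : ℝ) = 1) :
    ∃ τ : Π y : M, TangentSpace (𝓡 2) y, SmoothFieldAt τ x₀ ∧ τ x₀ = σ x₀ ∧
      (∀ᶠ x in 𝓝 x₀, (inner ℝ (τ x) (τ x) : ℝ) = 1) ∧ ∃ r : M → ℝ, ∀ x, τ x = r x • σ x := by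
  have h1 := contMDiffAt_inner hσ hσ
  let r : M → ℝ := fun x ↦ (√(inner ℝ (σ x) (σ x)))⁻¹
  have hr : ContMDiffAt (𝓡 2) 𝓘(ℝ, ℝ) ∞ r x₀ := by
    have h2 : ContDiffAt ℝ ∞ (fun y : ℝ ↦ (√y)⁻¹) (inner ℝ (σ x₀) (σ x₀)) := by
      rw [h]
      exact (Real.contDiffAt_sqrt one_ne_zero).inv (by simp)
    exact ContMDiffAt.comp x₀ (g := fun y : ℝ ↦ (√y)⁻¹) h2.contMDiffAt h1
  refine ⟨fun x ↦ r x • σ x, ContMDiffAt.smul_section hr hσ, ?_, ?_, r, fun x ↦ rfl⟩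
  · change (√(inner ℝ (σ x₀) (σ x₀)))⁻¹ • σ x₀ = σ x₀
    rw [h, Real.sqrt_one, inv_one, one_smul]
  have h3 : ∀ᶠ x in 𝓝 x₀, (0 : ℝ) < inner ℝ (σ x) (σ x) :=
    h1.continuousAt.eventually (lt_mem_nhds (by
      change (0 : ℝ) < inner ℝ (σ x₀) (σ x₀); rw [h]; exact one_pos))
  filter_upwards [h3] with x hx
  rw [inner_smul_left, inner_smul_right]
  have := Real.mul_self_sqrt hx.le
  have h4 := (Real.sqrt_pos.2 hx).ne'
  simp only [r, conj_trivial]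
  field_simp
  rw [sq, this]

/-- Gram–Schmidt applied to extensions of `v` and `Jv`. The positive area at `x₀` persists nearby
and forces the second vector to be `J` of the first. The smoothness of `J` thereby becomes a
consequence of the local constancy of the orientation. -/
theorem exists_orthonormalFrame (o : SurfaceOrientation M) (x₀ : M) (v : TangentSpace (𝓡 2) x₀)
    (hv : (inner ℝ v v : ℝ) = 1) :
    ∃ e₁ e₂ : Π x : M, TangentSpace (𝓡 2) x, e₁ x₀ = v ∧ IsOrthonormalFrameAt o e₁ e₂ x₀ := by
  have hw (v : TangentSpace (𝓡 2) x₀) : SmoothFieldAt (FiberBundle.extend Plane v) x₀ :=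
    FiberBundle.contMDiffAt_extend ..
  obtain ⟨e₁, h₁, h₁', hu, -⟩ := contMDiffAt_normalize (hw v) (by rwa [FiberBundle.extend_apply_self])
  rw [FiberBundle.extend_apply_self] at h₁'
  let w := FiberBundle.extend Plane (rot o x₀ v)
  have hwx : w x₀ = rot o x₀ v := by simp [w]
  let σ : Π x : M, TangentSpace (𝓡 2) x := fun x ↦ w x - (inner ℝ (e₁ x) (w x) : ℝ) • e₁ x
  have hσ : SmoothFieldAt σ x₀ :=
    ContMDiffAt.sub_section (hw _) (ContMDiffAt.smul_section (contMDiffAt_inner h₁ (hw _)) h₁)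
  have hσ₀ : σ x₀ = rot o x₀ v := by
    simp only [σ, hwx, h₁']
    have : (inner ℝ v (rot o x₀ v) : ℝ) = 0 := by simp [rot]
    rw [this, zero_smul, sub_zero]
  obtain ⟨e₂, h₂, h₂', hu₂, r, hr⟩ := contMDiffAt_normalize hσ (by
    rw [hσ₀, LinearIsometryEquiv.inner_map_map, hv])
  refine ⟨e₁, e₂, h₁', h₁, h₂, hu, ?_⟩
  have hpos := eventually_areaForm_pos o h₁ h₂ (by
    rw [h₂', hσ₀, h₁', rot, Orientation.areaForm_rightAngleRotation_right, hv]
    exact one_pos)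
  filter_upwards [hu, hu₂, hpos] with x h1 h2 h3
  refine eq_rightAngleRotation _ h1 h2 ?_ h3
  rw [hr, inner_smul_right, inner_sub_right, inner_smul_right, h1]
  ring


section Combination

variable {E : Type*} [NormedAddCommGroup E] [NormedSpace ℝ E]
  {H : Type*} [TopologicalSpace H] {I : ModelWithCorners ℝ E H}
  {M : Type*} [TopologicalSpace M] [ChartedSpace H M] [IsManifold I ∞ M]
  {EN : Type*} [NormedAddCommGroup EN] [NormedSpace ℝ EN] {HN : Type*} [TopologicalSpace HN]
  {J : ModelWithCorners ℝ EN HN} {N : Type*} [TopologicalSpace N] [ChartedSpace HN N]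

/-- A combination of smooth vector fields along a smooth map, with smooth coefficients, is smooth. -/
theorem contMDiffAt_smul_add_smul {b : N → M} {a₁ a₂ : N → ℝ} {n : N} {k : ℕ∞ω}
    {σ τ : Π y : M, TangentSpace I y} (hb : CMDiffAt k b n) (h₁ : CMDiffAt k a₁ n)
    (h₂ : CMDiffAt k a₂ n) (hσ : CMDiffAt k (T% σ) (b n)) (hτ : CMDiffAt k (T% τ) (b n)) :
    ContMDiffAt J I.tangent k
      (fun m ↦ (⟨b m, a₁ m • σ (b m) + a₂ m • τ (b m)⟩ : TangentBundle I M)) n := by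
  refine contMDiffAt_totalSpace.2 ⟨hb, ?_⟩
  have h3 : CMDiffAt k (fun m ↦ fiberCoord I (b n) ⟨b m, σ (b m)⟩) n :=
    ContMDiffAt.comp n (g := fun y ↦ fiberCoord I (b n) ⟨y, σ y⟩) (f := b)
      (contMDiffAt_fiberCoord hσ) hb
  have h4 : CMDiffAt k (fun m ↦ fiberCoord I (b n) ⟨b m, τ (b m)⟩) n :=
    ContMDiffAt.comp n (g := fun y ↦ fiberCoord I (b n) ⟨y, τ y⟩) (f := b)
      (contMDiffAt_fiberCoord hτ) hb
  refine ((h₁.smul h3).add (h₂.smul h4)).congr_of_eventuallyEq ?_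
  filter_upwards [hb.continuousAt.preimage_mem_nhds
    ((chartAt H (b n)).open_source.mem_nhds (mem_chart_source H (b n)))] with m hm
  change fiberCoord I (b n) ⟨b m, a₁ m • σ (b m) + a₂ m • τ (b m)⟩ = _
  rw [fiberCoord_add hm, fiberCoord_smul hm, fiberCoord_smul hm]
  rfl

end Combination

/-! ### Torsion-free smooth connections of the form Levi-Civita plus a symmetric tensor. -/

variable {M : Type*} [TopologicalSpace M] [ChartedSpace Plane M] [IsManifold (𝓡 2) ∞ M]
  [RiemannianBundle (fun x : M ↦ TangentSpace (𝓡 2) x)]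
  [IsContMDiffRiemannianBundle (𝓡 2) ∞ Plane (fun x : M ↦ TangentSpace (𝓡 2) x)]
  {o : SurfaceOrientation M} {e₁ e₂ : Π x : M, TangentSpace (𝓡 2) x} {x₀ : M}

theorem IsOrthonormalFrameAt.eventually_eq (h : IsOrthonormalFrameAt o e₁ e₂ x₀) :
    ∀ᶠ x in 𝓝 x₀, ∀ v : TangentSpace (𝓡 2) x,
      v = (inner ℝ (e₁ x) v : ℝ) • e₁ x + (inner ℝ (e₂ x) v : ℝ) • e₂ x := by
  filter_upwards [h.unit, h.rot_eq] with x h1 h2 v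
  rw [← h2]
  exact eq_frame (o.orient x) h1 v

theorem IsOrthonormalFrameAt.smoothFieldAt (h : IsOrthonormalFrameAt o e₁ e₂ x₀)
    {σ : Π x : M, TangentSpace (𝓡 2) x}
    (h₁ : ContMDiffAt (𝓡 2) 𝓘(ℝ, ℝ) ∞ (fun x ↦ (inner ℝ (e₁ x) (σ x) : ℝ)) x₀)
    (h₂ : ContMDiffAt (𝓡 2) 𝓘(ℝ, ℝ) ∞ (fun x ↦ (inner ℝ (e₂ x) (σ x) : ℝ)) x₀) :
    SmoothFieldAt σ x₀ := by
  refine (contMDiffAt_smul_add_smul contMDiffAt_id h₁ h₂ h.smooth₁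
    h.smooth₂).congr_of_eventuallyEq ?_
  filter_upwards [h.eventually_eq] with x hx
  exact congrArg (TotalSpace.mk x) (hx (σ x))

theorem exists_isOrthonormalFrameAt (o : SurfaceOrientation M) (x₀ : M) :
    ∃ e₁ e₂ : Π x : M, TangentSpace (𝓡 2) x, IsOrthonormalFrameAt o e₁ e₂ x₀ := by
  obtain ⟨v, hv⟩ := exists_inner_self_eq_one x₀
  obtain ⟨e₁, e₂, -, h⟩ := exists_orthonormalFrame o x₀ v hv
  exact ⟨e₁, e₂, h⟩

theorem smoothFieldAt_leviCivita (o : SurfaceOrientation M) {Y U : Π x : M, TangentSpace (𝓡 2) x}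
    (hY : SmoothFieldAt Y x₀) (hU : SmoothFieldAt U x₀) :
    SmoothFieldAt (fun x ↦ leviCivita (𝓡 2) M Y x (U x)) x₀ := by
  obtain ⟨e₁, e₂, h⟩ := exists_isOrthonormalFrameAt o x₀
  refine h.smoothFieldAt ?_ ?_
  · refine (contMDiffAt_inner_leviCivita hY hU h.smooth₁).congr_of_eventuallyEq
      (Filter.Eventually.of_forall fun x ↦ real_inner_comm _ _)
  · refine (contMDiffAt_inner_leviCivita hY hU h.smooth₂).congr_of_eventuallyEq
      (Filter.Eventually.of_forall fun x ↦ real_inner_comm _ _)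

theorem contMDiffCovariantDerivative_leviCivita_addOneForm (o : SurfaceOrientation M)
    {B : Π x : M, TangentSpace (𝓡 2) x →L[ℝ] TangentSpace (𝓡 2) x →L[ℝ] TangentSpace (𝓡 2) x}
    (hB : ∀ {x₀ : M} {Y U : Π x : M, TangentSpace (𝓡 2) x}, SmoothFieldAt Y x₀ →
      SmoothFieldAt U x₀ → SmoothFieldAt (fun x ↦ B x (Y x) (U x)) x₀) :
    ((leviCivita (𝓡 2) M).addOneForm B).ContMDiffCovariantDerivative ∞ := by
  refine ⟨⟨fun {σ} hσ x₀ _ ↦ ContMDiffAt.contMDiffWithinAt (contMDiffAt_hom_of_apply fun v ↦ ?_)⟩⟩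
  have h1 : SmoothFieldAt σ x₀ :=
    ((hσ x₀ (Set.mem_univ _)).contMDiffAt Filter.univ_mem).of_le (by simp)
  have h2 : SmoothFieldAt (FiberBundle.extend Plane v) x₀ := FiberBundle.contMDiffAt_extend ..
  exact ContMDiffAt.add_section (smoothFieldAt_leviCivita o h1 h2) (hB h1 h2)

theorem torsion_addOneForm_eq_zero {cov : CovariantDerivative (𝓡 2) Plane
      (fun x : M ↦ TangentSpace (𝓡 2) x)} (hcov : cov.torsion = 0)
    {B : Π x : M, TangentSpace (𝓡 2) x →L[ℝ] TangentSpace (𝓡 2) x →L[ℝ] TangentSpace (𝓡 2) x}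
    (hB : ∀ x u v, B x u v = B x v u) : (cov.addOneForm B).torsion = 0 := by
  rw [CovariantDerivative.torsion_eq_zero_iff] at hcov ⊢
  intro X Y x hX hY
  rw [← hcov hX hY]
  change (cov Y x (X x) + B x (Y x) (X x)) - (cov X x (Y x) + B x (X x) (Y x)) = _
  rw [hB x (Y x)]
  abel


/-! ### The vertical field, and the orbits as curves of prescribed geodesic curvature. -/

variable {M : Type*} [TopologicalSpace M] [ChartedSpace Plane M] [IsManifold (𝓡 2) ∞ M]
  [RiemannianBundle (fun x : M ↦ TangentSpace (𝓡 2) x)]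

theorem rotate_snd (o : SurfaceOrientation M) (t : ℝ) (p : UnitTangentBundle M) :
    (rotate o t p).1.2 = Real.cos t • p.1.2 + Real.sin t • rot o p.1.1 p.1.2 := by
  simp [rotate, rot, Orientation.rotation_apply]

/-- The curve `t ↦ cos t v + sin t Jv` stays in one fibre and has derivative `Jv` at `0`. -/
theorem verticalField_eq (o : SurfaceOrientation M) (p : UnitTangentBundle M) :
    verticalField o p = verticalLift (𝓡 2) p.1 (rot o p.1.1 p.1.2) := by
  have h1 : HasFDerivAt (𝕜 := ℝ) (F := Plane)
      (fun t : ℝ ↦ fiberCoord (𝓡 2) p.1.1 (rotate o t p).1)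
      ((1 : ℝ →L[ℝ] ℝ).smulRight (toModel p.1.1 (rot o p.1.1 p.1.2))) 0 := by
    have h2 : (fun t : ℝ ↦ fiberCoord (𝓡 2) p.1.1 (rotate o t p).1) =
        fun t : ℝ ↦ Real.cos t • toModel p.1.1 p.1.2 +
          Real.sin t • toModel p.1.1 (rot o p.1.1 p.1.2) := by
      funext t
      have h3 : (rotate o t p).1 = ⟨p.1.1, Real.cos t • p.1.2 + Real.sin t • rot o p.1.1 p.1.2⟩ :=
        congrArg (TotalSpace.mk p.1.1) (rotate_snd o t p)
      rw [h3, fiberCoord_self, map_add, map_smul, map_smul]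
    rw [h2]
    have h := ((Real.hasDerivAt_cos 0).smul_const (toModel p.1.1 p.1.2)).add
      ((Real.hasDerivAt_sin 0).smul_const (toModel p.1.1 (rot o p.1.1 p.1.2)))
    rw [Real.sin_zero, Real.cos_zero, neg_zero, zero_smul, zero_add, one_smul] at h
    exact h.hasFDerivAt
  have h2 := mfderiv_components (I := 𝓡 2) (f := fun t : ℝ ↦ (rotate o t p).1)
    (hasMFDerivAt_const (p.1.1 : M) (0 : ℝ)) h1.hasMFDerivAt (1 : ℝ)
  have h3 := verticalLift_components p.1 (rot o p.1.1 p.1.2)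
  refine tangent_ext ?_ ?_
  · rw [h3.1]
    exact h2.1
  · rw [h3.2]
    exact h2.2.trans (one_smul ℝ (toModel p.1.1 (rot o p.1.1 p.1.2)))

variable [IsContMDiffRiemannianBundle (𝓡 2) ∞ Plane (fun x : M ↦ TangentSpace (𝓡 2) x)]

theorem thermostatField_eq (o : SurfaceOrientation M) (lam : UnitTangentBundle M → ℝ)
    (p : UnitTangentBundle M) :
    thermostatField o lam p = horizontalLift (leviCivita (𝓡 2) M) p.1 p.1.2 +
      verticalLift (𝓡 2) p.1 (lam p • rot o p.1.1 p.1.2) := by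
  rw [thermostatField, geodesicField, verticalField_eq]
  congr 1
  refine tangent_ext ?_ ?_
  · rw [map_smul, (verticalLift_components p.1 _).1, (verticalLift_components p.1 _).1, smul_zero]
  · rw [map_smul, (verticalLift_components p.1 _).2, (verticalLift_components p.1 _).2, map_smul]

/-- The orbits of the thermostat are the unit speed curves with `∇_{c'} c' = λ J c'`. -/
theorem isOrbitOn_iff {o : SurfaceOrientation M} {lam : UnitTangentBundle M → ℝ}
    {γ : ℝ → UnitTangentBundle M} {s : Set ℝ} :
    IsOrbitOn (thermostatField o lam) γ s ↔ ∀ t ∈ s,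
      HasVelocityAt (J := 𝓡 2) (fun r ↦ (γ r).1.1) t (γ t).1.2 ∧
      HasCovDerivAlong (leviCivita (𝓡 2) M) (fun r ↦ (γ r).1) t
        (lam (γ t) • rot o (γ t).1.1 (γ t).1.2) := by
  refine forall₂_congr fun t _ ↦ ?_
  rw [thermostatField_eq]
  have h := hasVelocityAt_horizontalLift_add (leviCivita (𝓡 2) M) (Z := fun r ↦ (γ r).1) (t := t)
    (w := (γ t).1.2) (u := lam (γ t) • rot o (γ t).1.1 (γ t).1.2)
  refine Iff.trans h (and_congr_right fun h1 ↦ ?_)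
  exact (hasCovDerivAlong_iff (Z := fun r ↦ (γ r).1) _ h1).symm


/-! ### Fourier analysis on the fibres of the unit tangent bundle. -/

variable {M : Type*} [TopologicalSpace M] [ChartedSpace Plane M] [IsManifold (𝓡 2) ∞ M]
  [RiemannianBundle (fun x : M ↦ TangentSpace (𝓡 2) x)]

theorem rotate_zero (o : SurfaceOrientation M) (p : UnitTangentBundle M) : rotate o 0 p = p := by
  refine Subtype.ext ?_
  have h : (rotate o 0 p).1 = ⟨p.1.1, p.1.2⟩ :=
    congrArg (TotalSpace.mk p.1.1) ((rotate_snd o 0 p).trans (by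
      rw [Real.cos_zero, Real.sin_zero, one_smul, zero_smul, add_zero]))
  exact h

theorem rotate_rotate (o : SurfaceOrientation M) (s t : ℝ) (p : UnitTangentBundle M) :
    rotate o s (rotate o t p) = rotate o (s + t) p := by
  refine Subtype.ext ?_
  have h : (o.orient p.1.1).rotation (s : Real.Angle) ((o.orient p.1.1).rotation (t : Real.Angle)
      p.1.2) = (o.orient p.1.1).rotation ((s + t : ℝ) : Real.Angle) p.1.2 := by
    rw [Orientation.rotation_rotation, Real.Angle.coe_add]
  exact congrArg (TotalSpace.mk p.1.1) h

section Smooth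

variable {F G : Type*} [NormedAddCommGroup F] [NormedSpace ℝ F] [NormedAddCommGroup G]
  [NormedSpace ℝ G]

theorem IsSmoothOnUnitTangentBundle.add {u v : UnitTangentBundle M → F}
    (hu : IsSmoothOnUnitTangentBundle u) (hv : IsSmoothOnUnitTangentBundle v) :
    IsSmoothOnUnitTangentBundle (u + v) := fun p ↦ by
  obtain ⟨f, hf, hf'⟩ := hu p
  obtain ⟨g, hg, hg'⟩ := hv p
  exact ⟨f + g, hf.add hg, by filter_upwards [hf', hg'] with q h1 h2; simp [h1, h2]⟩

theorem IsSmoothOnUnitTangentBundle.clm_comp (L : F →L[ℝ] G) {u : UnitTangentBundle M → F}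
    (hu : IsSmoothOnUnitTangentBundle u) : IsSmoothOnUnitTangentBundle fun p ↦ L (u p) := fun p ↦ by
  obtain ⟨f, hf, hf'⟩ := hu p
  exact ⟨fun q ↦ L (f q), L.contDiff.contMDiff.contMDiffAt.comp _ hf, by
    filter_upwards [hf'] with q h1; simp [h1]⟩

end Smooth

/-- The defining equation concerns `t = 0` at every point; moving the point along its fibre turns it
into the differential equation `u' = i m u`, so `exp(-imt) u` is constant. -/
theorem fourierMode_rotate {o : SurfaceOrientation M} {m : ℤ} {u : UnitTangentBundle M → ℂ}
    (hu : u ∈ fourierMode o m) (p : UnitTangentBundle M) (t : ℝ) :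
    u (rotate o t p) = Complex.exp (Complex.I * m * t) * u p := by
  have h1 (t : ℝ) : HasDerivAt (fun s : ℝ ↦ u (rotate o s p))
      (Complex.I * m * u (rotate o t p)) t := by
    obtain ⟨d, hd, hd'⟩ := hu.2 (rotate o t p)
    have h2 : d = Complex.I * m * u (rotate o t p) := by
      linear_combination -Complex.I * hd' + d * Complex.I_sq
    rw [← h2]
    have h3 : HasDerivAt (fun s : ℝ ↦ s - t) 1 t := (hasDerivAt_id t).sub_const t
    have h4 := HasDerivAt.scomp t (g₁ := fun s ↦ u (rotate o s (rotate o t p))) (h := fun s ↦ s - t)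
      (by rw [sub_self]; exact hd) h3
    rw [one_smul] at h4
    refine h4.congr_of_eventuallyEq (Filter.Eventually.of_forall fun s ↦ ?_)
    simp [rotate_rotate]
  have h2 (t : ℝ) : HasDerivAt (fun s : ℝ ↦ Complex.exp (-(Complex.I * m * s)) * u (rotate o s p))
      0 t := by
    have h3 : HasDerivAt (fun s : ℝ ↦ Complex.exp (-(Complex.I * m * s)))
        (Complex.exp (-(Complex.I * m * t)) * -(Complex.I * m)) t := by
      have h5 := ((Complex.ofRealCLM.hasDerivAt (x := t)).const_mul (Complex.I * m)).fun_neg.cexp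
      simpa using h5
    refine (h3.mul (h1 t)).congr_deriv ?_
    ring
  have h3 := is_const_of_deriv_eq_zero (fun t ↦ (h2 t).differentiableAt) (fun t ↦ (h2 t).deriv) t 0
  simp only [Complex.ofReal_zero, mul_zero, neg_zero, Complex.exp_zero, one_mul, rotate_zero] at h3
  rw [← h3, ← mul_assoc, ← Complex.exp_add, add_neg_cancel, Complex.exp_zero, one_mul]

/-- On every fibre, the function `lam` is a homogeneous cubic polynomial. -/
def IsFiberwiseCubic (o : SurfaceOrientation M) (lam : UnitTangentBundle M → ℝ) : Prop :=
  ∀ p, ∃ a b c d : ℝ, ∀ t, lam (rotate o t p) = a * Real.cos t ^ 3 +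
    b * (Real.cos t ^ 2 * Real.sin t) + c * (Real.cos t * Real.sin t ^ 2) + d * Real.sin t ^ 3

theorem isFiberwiseCubic_of_mem {o : SurfaceOrientation M} {lam : UnitTangentBundle M → ℝ}
    (h : (fun p ↦ (lam p : ℂ)) ∈ fourierMode o (-1) ⊔ fourierMode o 1 ⊔ fourierMode o (-3) ⊔
      fourierMode o 3) : IsFiberwiseCubic o lam := by
  intro p
  obtain ⟨v, hv, u₄, h₄, hlam⟩ := Submodule.mem_sup.1 h
  obtain ⟨w, hw, u₃, h₃, rfl⟩ := Submodule.mem_sup.1 hv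
  obtain ⟨u₁, h₁, u₂, h₂, rfl⟩ := Submodule.mem_sup.1 hw
  -- With `x = cos t`, `y = sin t` the exponentials are `x ± iy` and `(x ± iy)³`. The linear ones
  -- are made cubic by the factor `x² + y² = 1`, and the coefficients are read off after taking real
  -- parts.
  refine ⟨(u₁ p + u₂ p + u₃ p + u₄ p).re, (Complex.I * (-u₁ p + u₂ p - 3 * u₃ p + 3 * u₄ p)).re,
    (u₁ p + u₂ p - 3 * u₃ p - 3 * u₄ p).re, (Complex.I * (-u₁ p + u₂ p + u₃ p - u₄ p)).re,
    fun t ↦ ?_⟩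
  have h5 := congrFun hlam (rotate o t p)
  simp only [Pi.add_apply] at h5
  rw [fourierMode_rotate h₁, fourierMode_rotate h₂, fourierMode_rotate h₃,
    fourierMode_rotate h₄] at h5
  have e1 : Complex.exp (Complex.I * (-1 : ℤ) * t) = Real.cos t - Complex.I * Real.sin t := by
    rw [show Complex.I * (-1 : ℤ) * t = (-t : ℂ) * Complex.I by push_cast; ring,
      Complex.exp_mul_I, Complex.cos_neg, Complex.sin_neg]
    push_cast; ring
  have e2 : Complex.exp (Complex.I * (1 : ℤ) * t) = Real.cos t + Complex.I * Real.sin t := by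
    rw [show Complex.I * (1 : ℤ) * t = (t : ℂ) * Complex.I by push_cast; ring, Complex.exp_mul_I]
    push_cast; ring
  have e3 : Complex.exp (Complex.I * (-3 : ℤ) * t) = (Real.cos t - Complex.I * Real.sin t) ^ 3 := by
    rw [← e1, ← Complex.exp_nat_mul]
    congr 1; push_cast; ring
  have e4 : Complex.exp (Complex.I * (3 : ℤ) * t) = (Real.cos t + Complex.I * Real.sin t) ^ 3 := by
    rw [← e2, ← Complex.exp_nat_mul]
    congr 1; push_cast; ring
  have h6 := congrArg Complex.re h5
  rw [Complex.ofReal_re, e1, e2, e3, e4] at h6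
  rw [← h6]
  have hcs := Real.sin_sq_add_cos_sq t
  generalize Real.cos t = x at *
  generalize Real.sin t = y at *
  simp [pow_succ]
  linear_combination ((-x) * (u₁ p).re - x * (u₂ p).re - y * (u₁ p).im + y * (u₂ p).im) * hcs

section Rotation

variable [IsContMDiffRiemannianBundle (𝓡 2) ∞ Plane (fun x : M ↦ TangentSpace (𝓡 2) x)]

theorem contMDiffAt_inner_frame {q : TangentBundle (𝓡 2) M} {e : Π x : M, TangentSpace (𝓡 2) x}
    (he : SmoothFieldAt e q.1) : ContMDiffAt (𝓡 2).tangent 𝓘(ℝ, ℝ) ∞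
      (fun r : TangentBundle (𝓡 2) M ↦ (inner ℝ (e r.1) r.2 : ℝ)) q := by
  have h1 : ContMDiffAt (𝓡 2).tangent (𝓡 2).tangent ∞
      (fun r : TangentBundle (𝓡 2) M ↦ (⟨r.1, e r.1⟩ : TangentBundle (𝓡 2) M)) q :=
    ContMDiffAt.comp q (g := fun x ↦ (⟨x, e x⟩ : TangentBundle (𝓡 2) M)) he
      (Bundle.contMDiffAt_proj (fun x : M ↦ TangentSpace (𝓡 2) x))
  exact ContMDiffAt.inner_bundle (IB := 𝓡 2) (F := Plane) (E := fun x : M ↦ TangentSpace (𝓡 2) x)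
    (b := fun r : TangentBundle (𝓡 2) M ↦ r.1) (v := fun r ↦ e r.1) (w := fun r ↦ r.2)
    h1 contMDiffAt_id

theorem IsOrthonormalFrameAt.rot_apply {o : SurfaceOrientation M}
    {e₁ e₂ : Π x : M, TangentSpace (𝓡 2) x} {x₀ : M} (h : IsOrthonormalFrameAt o e₁ e₂ x₀) :
    ∀ᶠ x in 𝓝 x₀, ∀ a b : ℝ, rot o x (a • e₁ x + b • e₂ x) = (-b) • e₁ x + a • e₂ x := by
  filter_upwards [h.rot_eq] with x h2 a b
  have h3 : rot o x (e₂ x) = - e₁ x := by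
    rw [← h2]
    exact Orientation.rightAngleRotation_rightAngleRotation _ _
  rw [map_add, map_smul, map_smul, h2, h3]
  module

/-- Smoothness on `SM` is defined by extension to `TM`, so the rotation must be extended too. In an
orthonormal frame it acts on the coordinates by a constant matrix, which makes sense for vectors of
any length. -/
theorem exists_rotate_extension (o : SurfaceOrientation M) (t : ℝ) (p : UnitTangentBundle M) :
    ∃ R : TangentBundle (𝓡 2) M → TangentBundle (𝓡 2) M,
      ContMDiffAt (𝓡 2).tangent (𝓡 2).tangent ∞ R p.1 ∧
      ∀ᶠ q : UnitTangentBundle M in 𝓝 p, R q.1 = (rotate o t q).1 := by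
  obtain ⟨e₁, e₂, h⟩ := exists_isOrthonormalFrameAt o p.1.1
  have h1 := contMDiffAt_inner_frame h.smooth₁
  have h2 := contMDiffAt_inner_frame h.smooth₂
  refine ⟨_, contMDiffAt_smul_add_smul (b := fun r : TangentBundle (𝓡 2) M ↦ r.1)
    (Bundle.contMDiffAt_proj (fun x : M ↦ TangentSpace (𝓡 2) x))
    ((contMDiffAt_const (c := Real.cos t).mul h1).sub (contMDiffAt_const (c := Real.sin t).mul h2))
    ((contMDiffAt_const (c := Real.cos t).mul h2).add (contMDiffAt_const (c := Real.sin t).mul h1))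
    h.smooth₁ h.smooth₂, ?_⟩
  have hc : Continuous fun q : UnitTangentBundle M ↦ q.1.1 :=
    (FiberBundle.continuous_proj Plane (fun x : M ↦ TangentSpace (𝓡 2) x)).comp
      continuous_subtype_val
  filter_upwards [hc.continuousAt.eventually h.eventually_eq,
    hc.continuousAt.eventually h.rot_apply] with q h3 h4
  refine congrArg (TotalSpace.mk q.1.1) ?_
  refine Eq.trans ?_ (rotate_snd o t q).symm
  have h5 := h4 (inner ℝ (e₁ q.1.1) q.1.2) (inner ℝ (e₂ q.1.1) q.1.2)
  rw [← h3] at h5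
  rw [h5]
  conv_rhs => arg 1; rw [h3 q.1.2]
  simp only [Pi.mul_apply, Pi.add_apply]
  module

theorem IsSmoothOnUnitTangentBundle.comp_rotate {F : Type*} [NormedAddCommGroup F]
    [NormedSpace ℝ F] {u : UnitTangentBundle M → F} (hu : IsSmoothOnUnitTangentBundle u)
    (o : SurfaceOrientation M) (t : ℝ) :
    IsSmoothOnUnitTangentBundle fun p ↦ u (rotate o t p) := fun p ↦ by
  obtain ⟨R, hR, hR'⟩ := exists_rotate_extension o t p
  obtain ⟨f, hf, hf'⟩ := hu (rotate o t p)
  have h0 := hR'.self_of_nhds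
  refine ⟨fun q ↦ f (R q), ContMDiffAt.comp p.1 (g := f) (h0 ▸ hf) hR, ?_⟩
  have h1 : ContinuousAt (rotate o t) p := by
    refine Topology.IsInducing.subtypeVal.continuousAt_iff.2 ?_
    have h2 : ContinuousAt (fun q : UnitTangentBundle M ↦ R q.1) p :=
      ContinuousAt.comp (g := R) hR.continuousAt continuous_subtype_val.continuousAt
    exact h2.congr hR'
  filter_upwards [hR', h1.eventually hf'] with q h2 h3
  rw [h2, h3]

/-- For `ξ = exp (-iπm/4)`, the component of frequency `m` of a function on `SM` which is a
trigonometric polynomial with frequencies `-3, -1, 1, 3` on every fibre. -/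
noncomputable def fourierComponent (o : SurfaceOrientation M) (lam : UnitTangentBundle M → ℝ)
    (ξ : ℂ) (p : UnitTangentBundle M) : ℂ :=
  4⁻¹ * (lam p + lam (rotate o (Real.pi / 4) p) * ξ + lam (rotate o (2 * (Real.pi / 4)) p) * ξ ^ 2 +
    lam (rotate o (3 * (Real.pi / 4)) p) * ξ ^ 3)

theorem isSmooth_fourierComponent (o : SurfaceOrientation M) {lam : UnitTangentBundle M → ℝ}
    (hlam : IsSmoothOnUnitTangentBundle lam) (ξ : ℂ) :
    IsSmoothOnUnitTangentBundle (fourierComponent o lam ξ) := by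
  have key (t : ℝ) (z : ℂ) :
      IsSmoothOnUnitTangentBundle fun p ↦ (lam (rotate o t p) : ℂ) * z :=
    (hlam.comp_rotate o t).clm_comp (Complex.ofRealCLM.smulRight z)
  have h := ((((key 0 1).add (key (Real.pi / 4) ξ)).add (key (2 * (Real.pi / 4)) (ξ ^ 2))).add
    (key (3 * (Real.pi / 4)) (ξ ^ 3))).clm_comp (ContinuousLinearMap.mul ℝ ℂ 4⁻¹)
  simp only [rotate_zero, mul_one] at h
  exact h

theorem fourierComponent_mem {o : SurfaceOrientation M} {lam : UnitTangentBundle M → ℝ}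
    (hlam : IsSmoothOnUnitTangentBundle lam) (ξ : ℂ) (m : ℤ)
    (h : ∀ p, ∃ a : ℂ, ∀ t : ℝ, fourierComponent o lam ξ (rotate o t p) =
      a * Complex.exp (t * Complex.I) ^ m) : fourierComponent o lam ξ ∈ fourierMode o m := by
  refine ⟨isSmooth_fourierComponent o hlam ξ, fun p ↦ ?_⟩
  obtain ⟨a, ha⟩ := h p
  have h0 := ha 0
  rw [rotate_zero, Complex.ofReal_zero, zero_mul, Complex.exp_zero, one_zpow, mul_one] at h0
  refine ⟨a * (m * Complex.I), ?_, ?_⟩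
  · simp only [ha, ← Complex.exp_int_mul]
    have h5 := ((((Complex.ofRealCLM.hasDerivAt (x := 0)).mul_const Complex.I).const_mul
      (m : ℂ)).cexp).const_mul a
    simpa using h5
  · rw [h0]
    linear_combination (a * m) * Complex.I_sq

theorem exp_pi_div_four_pow : Complex.exp (Real.pi / 4 * Complex.I) ^ 4 = -1 := by
  rw [← Complex.exp_nat_mul, ← Complex.exp_pi_mul_I]
  congr 1
  push_cast
  ring

/-- Euler's formulas with `z = exp(it)` and `w = z⁻¹`. The inverse is kept as a separate variable so
that later identities are polynomial modulo `z w = 1`. -/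
theorem IsFiberwiseCubic.exists_exp {o : SurfaceOrientation M} {lam : UnitTangentBundle M → ℝ}
    (h : IsFiberwiseCubic o lam) (p : UnitTangentBundle M) : ∃ a b c d : ℂ, ∀ (t : ℝ) (z w : ℂ),
      Complex.exp (t * Complex.I) = z → z * w = 1 →
      (lam (rotate o t p) : ℂ) = a * z + b * w + c * z ^ 3 + d * w ^ 3 := by
  obtain ⟨A, B, C, D, hp⟩ := h p
  refine ⟨(3 * A - Complex.I * B + C - 3 * Complex.I * D) / 8,
    (3 * A + Complex.I * B + C + 3 * Complex.I * D) / 8,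
    (A - Complex.I * B - C + Complex.I * D) / 8,
    (A + Complex.I * B - C - Complex.I * D) / 8, fun t z w hz hzw ↦ ?_⟩
  rw [hp]
  have hw : Complex.exp (-(t * Complex.I)) = w := by
    rw [Complex.exp_neg, hz]
    exact (eq_inv_of_mul_eq_one_right hzw).symm
  have hc : Complex.cos t = (z + w) / 2 := by
    rw [Complex.cos, hz, neg_mul, hw]
  have hs : Complex.sin t = (w - z) * Complex.I / 2 := by
    rw [Complex.sin, hz, neg_mul, hw]
  push_cast
  rw [hc, hs]
  have hI := Complex.I_sq
  generalize Complex.I = i at *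
  grind

/-- Sampling at the angles `kπ/4`, `k = 0, 1, 2, 3`, separates the four frequencies: two distinct
ones differ by `2`, `4` or `6` in absolute value, so the average over `k` of `exp(ik(m' - m)π/4)` is
a sum over powers of a nontrivial fourth root of unity and vanishes. -/
theorem IsFiberwiseCubic.mem {o : SurfaceOrientation M} {lam : UnitTangentBundle M → ℝ}
    (h : IsFiberwiseCubic o lam) (hlam : IsSmoothOnUnitTangentBundle lam) :
    (fun p ↦ (lam p : ℂ)) ∈ fourierMode o (-1) ⊔ fourierMode o 1 ⊔ fourierMode o (-3) ⊔
      fourierMode o 3 := by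
  obtain ⟨ζ, hζ, hζ4⟩ : ∃ ζ : ℂ, Complex.exp (Real.pi / 4 * Complex.I) = ζ ∧ ζ ^ 4 = -1 :=
    ⟨_, rfl, exp_pi_div_four_pow⟩
  -- For `ζ = exp(iπ/4)` the values `exp(-iπm/4)` with `m = -1, 1, -3, 3` are `ζ`, `-ζ³`, `ζ³`,
  -- `-ζ`, because `ζ⁴ = -1`. Their first, second and third powers sum to zero, so only the
  -- unrotated term survives.
  have hsum : (fun p ↦ (lam p : ℂ)) = fourierComponent o lam ζ + fourierComponent o lam (-ζ ^ 3) +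
      fourierComponent o lam (ζ ^ 3) + fourierComponent o lam (-ζ) := by
    funext p
    simp only [fourierComponent, Pi.add_apply]
    ring_nf
    grind
  -- Rotation by `kπ/4` replaces `z` by `ζ^k z` and its inverse `w` by `(-ζ³)^k w`, as `ζ · (-ζ³) =
  -- 1`.
  have key : ∀ p, ∃ a b c d : ℂ, ∀ (t : ℝ) (z w : ℂ), Complex.exp (t * Complex.I) = z → z * w = 1 →
      ∀ ξ, fourierComponent o lam ξ (rotate o t p) = 4⁻¹ * (a * z + b * w + c * z ^ 3 + d * w ^ 3 +
        (a * (ζ * z) + b * (-ζ ^ 3 * w) + c * (ζ * z) ^ 3 + d * (-ζ ^ 3 * w) ^ 3) * ξ +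
        (a * (ζ ^ 2 * z) + b * ((-ζ ^ 3) ^ 2 * w) + c * (ζ ^ 2 * z) ^ 3 +
          d * ((-ζ ^ 3) ^ 2 * w) ^ 3) * ξ ^ 2 +
        (a * (ζ ^ 3 * z) + b * ((-ζ ^ 3) ^ 3 * w) + c * (ζ ^ 3 * z) ^ 3 +
          d * ((-ζ ^ 3) ^ 3 * w) ^ 3) * ξ ^ 3) := by
    intro p
    obtain ⟨a, b, c, d, hp⟩ := h.exists_exp p
    refine ⟨a, b, c, d, fun t z w hz hzw ξ ↦ ?_⟩
    simp only [fourierComponent, rotate_rotate]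
    have hadd (k : ℕ) : Complex.exp ((k * (Real.pi / 4) + t : ℝ) * Complex.I) = ζ ^ k * z := by
      rw [← hζ, ← hz, ← Complex.exp_nat_mul, ← Complex.exp_add]
      congr 1
      push_cast
      ring
    have h1 := hadd 1
    have h2 := hadd 2
    have h3 := hadd 3
    norm_num only [Nat.cast_one, one_mul, Nat.cast_ofNat, pow_one] at h1 h2 h3
    rw [hp t z w hz hzw, hp _ _ (-ζ ^ 3 * w) h1 (by grind), hp _ _ ((-ζ ^ 3) ^ 2 * w) h2 (by grind),
      hp _ _ ((-ζ ^ 3) ^ 3 * w) h3 (by grind)]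
  have hexp (t : ℝ) : Complex.exp (t * Complex.I) * (Complex.exp (t * Complex.I))⁻¹ = 1 :=
    mul_inv_cancel₀ (Complex.exp_ne_zero _)
  rw [hsum]
  refine Submodule.add_mem_sup (Submodule.add_mem_sup (Submodule.add_mem_sup ?_ ?_) ?_) ?_
  all_goals
    refine fourierComponent_mem hlam _ _ fun p ↦ ?_
    obtain ⟨a, b, c, d, hp⟩ := key p
  · refine ⟨b, fun t ↦ ?_⟩
    rw [hp t _ _ rfl (hexp t), zpow_neg_one]
    generalize (Complex.exp (t * Complex.I))⁻¹ = w
    generalize Complex.exp (t * Complex.I) = z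
    clear * - hζ4
    grind
  · refine ⟨a, fun t ↦ ?_⟩
    rw [hp t _ _ rfl (hexp t), zpow_one]
    generalize (Complex.exp (t * Complex.I))⁻¹ = w
    generalize Complex.exp (t * Complex.I) = z
    clear * - hζ4
    grind
  · refine ⟨d, fun t ↦ ?_⟩
    rw [hp t _ _ rfl (hexp t), zpow_neg, ← inv_zpow]
    generalize (Complex.exp (t * Complex.I))⁻¹ = w
    generalize Complex.exp (t * Complex.I) = z
    rw [zpow_ofNat w 3]
    clear * - hζ4
    grind
  · refine ⟨c, fun t ↦ ?_⟩
    rw [hp t _ _ rfl (hexp t)]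
    generalize (Complex.exp (t * Complex.I))⁻¹ = w
    generalize Complex.exp (t * Complex.I) = z
    rw [zpow_ofNat z 3]
    clear * - hζ4
    grind

end Rotation


/-! ### Regularity of integral curves, and velocities in charts. -/

section ODE

variable {F : Type*} [NormedAddCommGroup F] [NormedSpace ℝ F]

/-- Integral curves of smooth vector fields are smooth. -/
theorem contDiffAt_of_hasDerivAt {G : F → F} {X : ℝ → F} {t₀ : ℝ} (hG : ContDiffAt ℝ ∞ G (X t₀))
    (hX : ∀ᶠ t in 𝓝 t₀, HasDerivAt X (G (X t)) t) : ContDiffAt ℝ ∞ X t₀ := by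
  refine contDiffAt_infty.2 fun n ↦ ?_
  induction n with
  | zero =>
    exact contDiffAt_zero.2 ⟨_, hX, fun t ht ↦
      (HasDerivAt.continuousAt ht).continuousWithinAt⟩
  | succ n ih =>
    -- Bootstrap: if `X` is `C^n`, so is `X' = G ∘ X`, hence `X` is `C^(n+1)`.
    rw [Nat.cast_succ, contDiffAt_succ_iff_hasFDerivAt]
    exact ⟨fun t ↦ (1 : ℝ →L[ℝ] ℝ).smulRight (G (X t)), ⟨_, hX, fun t ht ↦ ht.hasFDerivAt⟩,
      contDiffAt_const.smulRight ((hG.of_le (by exact_mod_cast le_top)).comp t₀ ih)⟩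

end ODE

section Chart

variable {E : Type*} [NormedAddCommGroup E] [NormedSpace ℝ E]
  {H : Type*} [TopologicalSpace H] {I : ModelWithCorners ℝ E H}
  {M : Type*} [TopologicalSpace M] [ChartedSpace H M] [IsManifold I ∞ M]

theorem fiberCoord_injective {x y : M} (hy : y ∈ (chartAt H x).source) {v w : TangentSpace I y}
    (h : fiberCoord I x ⟨y, v⟩ = fiberCoord I x ⟨y, w⟩) : v = w := by
  have hy' : y ∈ (trivializationAt E (fun x : M ↦ TangentSpace I x) x).baseSet := hy
  exact ((trivializationAt E (fun x : M ↦ TangentSpace I x) x).continuousLinearEquivAt ℝ y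
    hy').injective h

/-- The preferred trivialization of the tangent bundle is the derivative of the chart, so the fibre
coordinate of the velocity is the derivative of the chart expression. -/
theorem HasVelocityAt.hasDerivAt_extChartAt {c : ℝ → M} {t : ℝ} {x₀ : M} {w : TangentSpace I (c t)}
    (h : HasVelocityAt c t w) (hx : c t ∈ (chartAt H x₀).source) :
    HasDerivAt (fun s ↦ extChartAt I x₀ (c s)) (fiberCoord I x₀ ⟨c t, w⟩) t := by
  have h1 := HasMFDerivAt.comp t (mdifferentiableAt_extChartAt (I := I) hx).hasMFDerivAt h
  have h3 := TangentBundle.continuousLinearMapAt_trivializationAt (I := I) (𝕜 := ℝ) hx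
  have h4 : mfderiv I 𝓘(ℝ, E) (extChartAt I x₀) (c t) w = fiberCoord I x₀ ⟨c t, w⟩ := by
    rw [← h3]
    have hx' : c t ∈ (trivializationAt E (fun x : M ↦ TangentSpace I x) x₀).baseSet := hx
    exact Trivialization.continuousLinearMapAt_apply_of_mem ℝ _ hx' w
  have h2 : (mfderiv I 𝓘(ℝ, E) (extChartAt I x₀) (c t)).comp
      ((1 : ℝ →L[ℝ] ℝ).smulRight w) =
      ((1 : ℝ →L[ℝ] ℝ).smulRight (fiberCoord I x₀ ⟨c t, w⟩)) := by
    refine ContinuousLinearMap.ext_ring ?_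
    change mfderiv I 𝓘(ℝ, E) (extChartAt I x₀) (c t) ((1 : ℝ) • w) = (1 : ℝ) • _
    rw [one_smul]
    exact h4.trans (one_smul ℝ (fiberCoord I x₀ ⟨c t, w⟩)).symm
  exact hasMFDerivAt_iff_hasFDerivAt.1 ((congrArg (HasMFDerivAt 𝓘(ℝ, ℝ) 𝓘(ℝ, E) _ t) h2).mp h1)

variable [I.Boundaryless]

theorem contMDiffAt_extChartAt_symm {x₀ : M} {y : E} (hy : y ∈ (extChartAt I x₀).target) :
    ContMDiffAt 𝓘(ℝ, E) I ∞ (extChartAt I x₀).symm y :=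
  (contMDiffWithinAt_extChartAt_symm_target x₀ hy).contMDiffAt (extChartAt_target_mem_nhds' hy)

theorem hasVelocityAt_extChartAt_symm {y : ℝ → E} {t : ℝ} {x₀ : M}
    (hy : y t ∈ (extChartAt I x₀).target) {w : TangentSpace I ((extChartAt I x₀).symm (y t))}
    (h : HasDerivAt y (fiberCoord I x₀ ⟨(extChartAt I x₀).symm (y t), w⟩) t) :
    HasVelocityAt (J := I) (fun s ↦ (extChartAt I x₀).symm (y s)) t w := by
  have h1 : MDifferentiableAt 𝓘(ℝ, ℝ) I (fun s ↦ (extChartAt I x₀).symm (y s)) t :=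
    MDifferentiableAt.comp t (g := (extChartAt I x₀).symm)
      ((contMDiffAt_extChartAt_symm hy).mdifferentiableAt (by simp))
      h.differentiableAt.mdifferentiableAt
  have h2 := hasVelocityAt_mfderiv h1
  have hx : (extChartAt I x₀).symm (y t) ∈ (chartAt H x₀).source := by
    rw [← extChartAt_source I]
    exact (extChartAt I x₀).map_target hy
  have h3 : (fun s ↦ extChartAt I x₀ ((extChartAt I x₀).symm (y s))) =ᶠ[𝓝 t] y := by
    filter_upwards [h.continuousAt.preimage_mem_nhds (extChartAt_target_mem_nhds' hy)] with s hs
    exact (extChartAt I x₀).right_inv hs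
  have h4 := (h2.hasDerivAt_extChartAt hx).congr_of_eventuallyEq h3.symm
  rw [fiberCoord_injective hx (h.unique h4)]
  exact h2

end Chart

/-! ### The thermostat equation in the coordinates of an orthonormal frame. -/

variable {M : Type*} [TopologicalSpace M] [ChartedSpace Plane M] [IsManifold (𝓡 2) ∞ M]
  [RiemannianBundle (fun x : M ↦ TangentSpace (𝓡 2) x)]

/-- The tangent vector with given base point, in the chart at `x₀`, and with given coordinates
in a frame. -/
noncomputable def fromFrame (e₁ e₂ : Π x : M, TangentSpace (𝓡 2) x) (x₀ : M)
    (X : Plane × ℝ × ℝ) : TangentBundle (𝓡 2) M :=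
  ⟨(extChartAt (𝓡 2) x₀).symm X.1, X.2.1 • e₁ _ + X.2.2 • e₂ _⟩

/-- The base point of a tangent vector, in the chart at `x₀`, and its products with two vector
fields. -/
noncomputable def toFrame (e₁ e₂ : Π x : M, TangentSpace (𝓡 2) x) (x₀ : M)
    (q : TangentBundle (𝓡 2) M) : Plane × ℝ × ℝ :=
  (extChartAt (𝓡 2) x₀ q.1, (inner ℝ (e₁ q.1) q.2 : ℝ), (inner ℝ (e₂ q.1) q.2 : ℝ))

variable [IsContMDiffRiemannianBundle (𝓡 2) ∞ Plane (fun x : M ↦ TangentSpace (𝓡 2) x)]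

/-- The connection form of a frame `e₁, e₂`. -/
noncomputable def connectionForm (e₁ e₂ : Π x : M, TangentSpace (𝓡 2) x) (x : M)
    (w : TangentSpace (𝓡 2) x) : ℝ :=
  inner ℝ (leviCivita (𝓡 2) M e₁ x w) (e₂ x)

/-- The vector field of the thermostat with intensity `f`, in the coordinates given by a frame. -/
noncomputable def frameField (e₁ e₂ : Π x : M, TangentSpace (𝓡 2) x) (x₀ : M)
    (f : TangentBundle (𝓡 2) M → ℝ) (X : Plane × ℝ × ℝ) : Plane × ℝ × ℝ :=
  let x := (fromFrame e₁ e₂ x₀ X).1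
  -- The vector must turn at the rate `f`, while the frame itself turns at the rate given by the
  -- connection form; the coordinates turn at the difference `k`.
  let k := f (fromFrame e₁ e₂ x₀ X) - (X.2.1 * connectionForm e₁ e₂ x (e₁ x) +
    X.2.2 * connectionForm e₁ e₂ x (e₂ x))
  (X.2.1 • fiberCoord (𝓡 2) x₀ ⟨x, e₁ x⟩ + X.2.2 • fiberCoord (𝓡 2) x₀ ⟨x, e₂ x⟩,
    -k * X.2.2, k * X.2.1)

/-- The pointwise properties of an orthonormal frame that are used to compute in it. -/
structure IsAdaptedAt (o : SurfaceOrientation M) (e₁ e₂ : Π x : M, TangentSpace (𝓡 2) x)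
    (x₀ x : M) : Prop where
  mem_source : x ∈ (chartAt Plane x₀).source
  mdiff₁ : MDifferentiableAt (𝓡 2) (𝓡 2).tangent (fun y ↦ (⟨y, e₁ y⟩ : TangentBundle (𝓡 2) M)) x
  mdiff₂ : MDifferentiableAt (𝓡 2) (𝓡 2).tangent (fun y ↦ (⟨y, e₂ y⟩ : TangentBundle (𝓡 2) M)) x
  unit₁ : (inner ℝ (e₁ x) (e₁ x) : ℝ) = 1
  unit₂ : (inner ℝ (e₂ x) (e₂ x) : ℝ) = 1
  ortho : (inner ℝ (e₁ x) (e₂ x) : ℝ) = 0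
  eq : ∀ v : TangentSpace (𝓡 2) x,
    v = (inner ℝ (e₁ x) v : ℝ) • e₁ x + (inner ℝ (e₂ x) v : ℝ) • e₂ x
  rot : ∀ a b : ℝ, rot o x (a • e₁ x + b • e₂ x) = (-b) • e₁ x + a • e₂ x
  cov₁ : ∀ w, leviCivita (𝓡 2) M e₁ x w = connectionForm e₁ e₂ x w • e₂ x
  cov₂ : ∀ w, leviCivita (𝓡 2) M e₂ x w = (-connectionForm e₁ e₂ x w) • e₁ x

variable {o : SurfaceOrientation M} {e₁ e₂ : Π x : M, TangentSpace (𝓡 2) x} {x₀ : M}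

theorem mvfderiv_eq_zero_of_eventually_const {f : M → ℝ} {a : ℝ} {x : M}
    (h : ∀ᶠ y in 𝓝 x, f y = a) (w : TangentSpace (𝓡 2) x) :
    mvfderiv (𝓡 2) f x w = 0 := by
  have h1 : mfderiv (𝓡 2) 𝓘(ℝ, ℝ) f x = mfderiv (𝓡 2) 𝓘(ℝ, ℝ) (fun _ ↦ a) x :=
    Filter.EventuallyEq.mfderiv_eq h
  have h2 : mvfderiv (𝓡 2) f x = mvfderiv (𝓡 2) (fun _ : M ↦ a) x := by
    simp only [mvfderiv, h1]
    rfl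
  rw [h2, mvfderiv_const]
  rfl

/-- By metric compatibility, differentiating the constant products `⟨eᵢ, eⱼ⟩` shows that the
connection matrix is skew, so a single form describes it. -/
theorem IsOrthonormalFrameAt.eventually_adapted (h : IsOrthonormalFrameAt o e₁ e₂ x₀) :
    ∀ᶠ x in 𝓝 x₀, IsAdaptedAt o e₁ e₂ x₀ x := by
  have h1 := h.unit
  have h2 : ∀ᶠ x in 𝓝 x₀, (inner ℝ (e₂ x) (e₂ x) : ℝ) = 1 := by
    filter_upwards [h.unit, h.rot_eq] with x h1 h2
    rw [← h2, LinearIsometryEquiv.inner_map_map, h1]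
  have h3 : ∀ᶠ x in 𝓝 x₀, (inner ℝ (e₁ x) (e₂ x) : ℝ) = 0 := by
    filter_upwards [h.rot_eq] with x h2
    rw [← h2]
    exact (real_inner_comm _ _).trans ((o.orient x).inner_rightAngleRotation_self (e₁ x))
  filter_upwards [(chartAt Plane x₀).open_source.mem_nhds (mem_chart_source _ x₀),
    eventually_mdifferentiableAt h.smooth₁, eventually_mdifferentiableAt h.smooth₂,
    h1.eventually_nhds, h2.eventually_nhds, h3.eventually_nhds, h.eventually_eq, h.rot_apply]
    with x hx hd₁ hd₂ h1 h2 h3 h4 h5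
  have k1 (w : TangentSpace (𝓡 2) x) : (inner ℝ (e₁ x) (leviCivita (𝓡 2) M e₁ x w) : ℝ) = 0 := by
    have := isMetric_leviCivita hd₁ hd₁ w
    rw [mvfderiv_eq_zero_of_eventually_const h1 w,
      real_inner_comm (e₁ x) (leviCivita (𝓡 2) M e₁ x w)] at this
    linarith
  have k2 (w : TangentSpace (𝓡 2) x) : (inner ℝ (e₂ x) (leviCivita (𝓡 2) M e₂ x w) : ℝ) = 0 := by
    have := isMetric_leviCivita hd₂ hd₂ w
    rw [mvfderiv_eq_zero_of_eventually_const h2 w,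
      real_inner_comm (e₂ x) (leviCivita (𝓡 2) M e₂ x w)] at this
    linarith
  have k3 (w : TangentSpace (𝓡 2) x) : (inner ℝ (e₁ x) (leviCivita (𝓡 2) M e₂ x w) : ℝ) =
      - connectionForm e₁ e₂ x w := by
    have := isMetric_leviCivita hd₁ hd₂ w
    rw [mvfderiv_eq_zero_of_eventually_const h3 w] at this
    rw [connectionForm]
    linarith
  refine ⟨hx, hd₁, hd₂, h1.self_of_nhds, h2.self_of_nhds, h3.self_of_nhds, h4, h5, fun w ↦ ?_,
    fun w ↦ ?_⟩
  · have := h4 (leviCivita (𝓡 2) M e₁ x w)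
    rw [k1, zero_smul, zero_add, real_inner_comm] at this
    exact this
  · have := h4 (leviCivita (𝓡 2) M e₂ x w)
    rw [k2, zero_smul, add_zero, k3] at this
    exact this


variable {M : Type*} [TopologicalSpace M] [ChartedSpace Plane M] [IsManifold (𝓡 2) ∞ M]
  [RiemannianBundle (fun x : M ↦ TangentSpace (𝓡 2) x)]
  [IsContMDiffRiemannianBundle (𝓡 2) ∞ Plane (fun x : M ↦ TangentSpace (𝓡 2) x)]
  {o : SurfaceOrientation M} {e₁ e₂ : Π x : M, TangentSpace (𝓡 2) x} {x₀ : M}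

theorem fromFrame_toFrame {q : TangentBundle (𝓡 2) M} (h : IsAdaptedAt o e₁ e₂ x₀ q.1) :
    fromFrame e₁ e₂ x₀ (toFrame e₁ e₂ x₀ q) = q := by
  have h1 : (extChartAt (𝓡 2) x₀).symm (extChartAt (𝓡 2) x₀ q.1) = q.1 :=
    (extChartAt (𝓡 2) x₀).left_inv (by rw [extChartAt_source]; exact h.mem_source)
  have key (y : M) (hy : y = q.1) : (⟨y, (inner ℝ (e₁ q.1) q.2 : ℝ) • e₁ y +
      (inner ℝ (e₂ q.1) q.2 : ℝ) • e₂ y⟩ : TangentBundle (𝓡 2) M) = q := by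
    subst hy
    exact congrArg (TotalSpace.mk q.1) (h.eq q.2).symm
  exact key _ h1

theorem contMDiffAt_toFrame (h : IsOrthonormalFrameAt o e₁ e₂ x₀) {q : TangentBundle (𝓡 2) M}
    (hq : q.1 = x₀) :
    ContMDiffAt (𝓡 2).tangent 𝓘(ℝ, Plane × ℝ × ℝ) ∞ (toFrame e₁ e₂ x₀) q := by
  subst hq
  have h1 : ContMDiffAt (𝓡 2).tangent 𝓘(ℝ, Plane) ∞
      (fun r : TangentBundle (𝓡 2) M ↦ extChartAt (𝓡 2) q.1 r.1) q :=
    ContMDiffAt.comp q (g := extChartAt (𝓡 2) q.1) contMDiffAt_extChartAt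
      (Bundle.contMDiffAt_proj (fun x : M ↦ TangentSpace (𝓡 2) x))
  exact h1.prodMk_space
    ((contMDiffAt_inner_frame h.smooth₁).prodMk_space (contMDiffAt_inner_frame h.smooth₂))

theorem contMDiffAt_comp_chart {EN : Type*} [NormedAddCommGroup EN] [NormedSpace ℝ EN] {HN : Type*}
    [TopologicalSpace HN] {J : ModelWithCorners ℝ EN HN} {N : Type*} [TopologicalSpace N]
    [ChartedSpace HN N] {f : M → N} (hf : ContMDiffAt (𝓡 2) J ∞ f x₀) {X : Plane × ℝ × ℝ}
    (hX : X.1 = extChartAt (𝓡 2) x₀ x₀) :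
    ContMDiffAt 𝓘(ℝ, Plane × ℝ × ℝ) J ∞ (fun Y ↦ f ((extChartAt (𝓡 2) x₀).symm Y.1)) X := by
  have h1 : ContMDiffAt 𝓘(ℝ, Plane × ℝ × ℝ) (𝓡 2) ∞
      (fun Y ↦ (extChartAt (𝓡 2) x₀).symm Y.1) X :=
    ContMDiffAt.comp X (g := (extChartAt (𝓡 2) x₀).symm) (f := Prod.fst)
      (contMDiffAt_extChartAt_symm (hX ▸ mem_extChartAt_target x₀)) contDiffAt_fst.contMDiffAt
  exact ContMDiffAt.comp_of_eq hf h1 (by rw [hX, extChartAt_to_inv])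

theorem contMDiffAt_fromFrame (h : IsOrthonormalFrameAt o e₁ e₂ x₀) {X : Plane × ℝ × ℝ}
    (hX : X.1 = extChartAt (𝓡 2) x₀ x₀) :
    ContMDiffAt 𝓘(ℝ, Plane × ℝ × ℝ) (𝓡 2).tangent ∞ (fromFrame e₁ e₂ x₀) X := by
  have h0 : (extChartAt (𝓡 2) x₀).symm X.1 = x₀ := by rw [hX, extChartAt_to_inv]
  refine contMDiffAt_smul_add_smul (contMDiffAt_comp_chart contMDiffAt_id hX) ?_ ?_ ?_ ?_
  · exact contDiffAt_snd.fst.contMDiffAt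
  · exact contDiffAt_snd.snd.contMDiffAt
  · exact h0.symm ▸ h.smooth₁
  · exact h0.symm ▸ h.smooth₂

theorem contMDiffAt_connectionForm (h : IsOrthonormalFrameAt o e₁ e₂ x₀)
    {σ : Π x : M, TangentSpace (𝓡 2) x} (hσ : SmoothFieldAt σ x₀) :
    ContMDiffAt (𝓡 2) 𝓘(ℝ, ℝ) ∞ (fun x ↦ connectionForm e₁ e₂ x (σ x)) x₀ :=
  contMDiffAt_inner_leviCivita h.smooth₁ hσ h.smooth₂

theorem contDiffAt_frameField (h : IsOrthonormalFrameAt o e₁ e₂ x₀)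
    {f : TangentBundle (𝓡 2) M → ℝ} {X : Plane × ℝ × ℝ} (hX : X.1 = extChartAt (𝓡 2) x₀ x₀)
    (hf : ContMDiffAt (𝓡 2).tangent 𝓘(ℝ, ℝ) ∞ f (fromFrame e₁ e₂ x₀ X)) :
    ContDiffAt ℝ ∞ (frameField e₁ e₂ x₀ f) X := by
  have a₁ : ContMDiffAt 𝓘(ℝ, Plane × ℝ × ℝ) 𝓘(ℝ, ℝ) ∞ (fun Y : Plane × ℝ × ℝ ↦ Y.2.1) X :=
    contDiffAt_snd.fst.contMDiffAt
  have a₂ : ContMDiffAt 𝓘(ℝ, Plane × ℝ × ℝ) 𝓘(ℝ, ℝ) ∞ (fun Y : Plane × ℝ × ℝ ↦ Y.2.2) X :=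
    contDiffAt_snd.snd.contMDiffAt
  have d₁ := contMDiffAt_comp_chart (contMDiffAt_fiberCoord h.smooth₁) hX
  have d₂ := contMDiffAt_comp_chart (contMDiffAt_fiberCoord h.smooth₂) hX
  have c₁ := contMDiffAt_comp_chart (contMDiffAt_connectionForm h h.smooth₁) hX
  have c₂ := contMDiffAt_comp_chart (contMDiffAt_connectionForm h h.smooth₂) hX
  have hk := (hf.comp X (contMDiffAt_fromFrame h hX)).sub ((a₁.mul c₁).add (a₂.mul c₂))
  exact (((a₁.smul d₁).add (a₂.smul d₂)).prodMk_space
    ((hk.neg.mul a₂).prodMk_space (hk.mul a₁))).contDiffAt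

theorem connectionForm_add_smul {x : M} (a b : ℝ) :
    connectionForm e₁ e₂ x (a • e₁ x + b • e₂ x) =
      a * connectionForm e₁ e₂ x (e₁ x) + b * connectionForm e₁ e₂ x (e₂ x) := by
  simp only [connectionForm, map_add, map_smul, inner_add_left, inner_smul_left, conj_trivial]

/-- The covariant derivative along a curve, in an orthonormal frame. -/
theorem IsAdaptedAt.hasCovDerivAlong {c : ℝ → M} {t : ℝ} {w : TangentSpace (𝓡 2) (c t)}
    (h : IsAdaptedAt o e₁ e₂ x₀ (c t)) (hc : HasVelocityAt c t w) {a b : ℝ → ℝ} {a' b' : ℝ}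
    (ha : HasDerivAt a a' t) (hb : HasDerivAt b b' t) :
    HasCovDerivAlong (leviCivita (𝓡 2) M) (fun s ↦ ⟨c s, a s • e₁ (c s) + b s • e₂ (c s)⟩) t
      ((a' - b t * connectionForm e₁ e₂ (c t) w) • e₁ (c t) +
        (b' + a t * connectionForm e₁ e₂ (c t) w) • e₂ (c t)) := by
  have h1 := hasCovDerivAlong_frame (cov := leviCivita (𝓡 2) M) hc h.mdiff₁ h.mdiff₂ ha hb
  rw [h.cov₁, h.cov₂] at h1
  refine (congrArg (HasCovDerivAlong (leviCivita (𝓡 2) M) _ t) ?_).mp h1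
  module

theorem frameField_eq {X : Plane × ℝ × ℝ} (h : IsAdaptedAt o e₁ e₂ x₀ (fromFrame e₁ e₂ x₀ X).1)
    (f : TangentBundle (𝓡 2) M → ℝ) : frameField e₁ e₂ x₀ f X =
      (fiberCoord (𝓡 2) x₀ (fromFrame e₁ e₂ x₀ X),
        -(f (fromFrame e₁ e₂ x₀ X) - connectionForm e₁ e₂ _ (fromFrame e₁ e₂ x₀ X).2) * X.2.2,
        (f (fromFrame e₁ e₂ x₀ X) - connectionForm e₁ e₂ _ (fromFrame e₁ e₂ x₀ X).2) * X.2.1) := by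
  have hs := h.mem_source
  have h1 : fiberCoord (𝓡 2) x₀ (fromFrame e₁ e₂ x₀ X) =
      X.2.1 • fiberCoord (𝓡 2) x₀ ⟨(fromFrame e₁ e₂ x₀ X).1, e₁ _⟩ +
        X.2.2 • fiberCoord (𝓡 2) x₀ ⟨(fromFrame e₁ e₂ x₀ X).1, e₂ _⟩ := by
    rw [← fiberCoord_smul hs, ← fiberCoord_smul hs, ← fiberCoord_add hs]
    rfl
  have h3 : connectionForm e₁ e₂ (fromFrame e₁ e₂ x₀ X).1 (fromFrame e₁ e₂ x₀ X).2 =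
    _ := connectionForm_add_smul X.2.1 X.2.2
  rw [h1, h3]
  rfl

/-- Solutions of the thermostat equation in a frame give solutions on the surface. -/
theorem hasVelocityAt_and_hasCovDerivAlong_fromFrame {X : ℝ → Plane × ℝ × ℝ} {t : ℝ}
    (hX : (X t).1 ∈ (extChartAt (𝓡 2) x₀).target)
    (h : IsAdaptedAt o e₁ e₂ x₀ (fromFrame e₁ e₂ x₀ (X t)).1) {f : TangentBundle (𝓡 2) M → ℝ}
    (hd : HasDerivAt X (frameField e₁ e₂ x₀ f (X t)) t) :
    HasVelocityAt (J := 𝓡 2) (fun s ↦ (fromFrame e₁ e₂ x₀ (X s)).1) t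
        (fromFrame e₁ e₂ x₀ (X t)).2 ∧
      HasCovDerivAlong (leviCivita (𝓡 2) M) (fun s ↦ fromFrame e₁ e₂ x₀ (X s)) t
        (f (fromFrame e₁ e₂ x₀ (X t)) • rot o _ (fromFrame e₁ e₂ x₀ (X t)).2) := by
  rw [frameField_eq h] at hd
  have hv : HasVelocityAt (J := 𝓡 2) (fun s ↦ (fromFrame e₁ e₂ x₀ (X s)).1) t
      (fromFrame e₁ e₂ x₀ (X t)).2 := hasVelocityAt_extChartAt_symm hX hd.fst
  refine ⟨hv, ?_⟩
  have h1 := h.hasCovDerivAlong hv hd.snd.fst hd.snd.snd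
  refine (congrArg (HasCovDerivAlong (leviCivita (𝓡 2) M)
    (fun s ↦ fromFrame e₁ e₂ x₀ (X s)) t) ?_).mp h1
  refine Eq.trans ?_ (congrArg (f (fromFrame e₁ e₂ x₀ (X t)) • ·)
    (h.rot (X t).2.1 (X t).2.2)).symm
  module

/-- Solutions of the thermostat equation on the surface give solutions in a frame. -/
theorem hasDerivAt_toFrame {Z : ℝ → TangentBundle (𝓡 2) M} {t : ℝ}
    (h : ∀ᶠ s in 𝓝 t, IsAdaptedAt o e₁ e₂ x₀ (Z s).1) {f : TangentBundle (𝓡 2) M → ℝ}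
    (hm : MDifferentiableAt (𝓡 2).tangent 𝓘(ℝ, Plane × ℝ × ℝ) (toFrame e₁ e₂ x₀) (Z t))
    (hv : HasVelocityAt (J := 𝓡 2) (fun s ↦ (Z s).1) t (Z t).2)
    (hZ : HasCovDerivAlong (leviCivita (𝓡 2) M) Z t (f (Z t) • rot o _ (Z t).2)) :
    HasDerivAt (fun s ↦ toFrame e₁ e₂ x₀ (Z s))
      (frameField e₁ e₂ x₀ f (toFrame e₁ e₂ x₀ (Z t))) t := by
  have h0 := h.self_of_nhds
  have hZm : MDifferentiableAt 𝓘(ℝ, ℝ) (𝓡 2).tangent Z t := HasMFDerivAt.mdifferentiableAt hZ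
  have hd : DifferentiableAt ℝ (fun s ↦ toFrame e₁ e₂ x₀ (Z s)) t :=
    (MDifferentiableAt.comp t hm hZm).differentiableAt
  have h1 := h0.hasCovDerivAlong hv hd.hasDerivAt.snd.fst hd.hasDerivAt.snd.snd
  have h2 : (fun s ↦ (⟨(Z s).1, (toFrame e₁ e₂ x₀ (Z s)).2.1 • e₁ (Z s).1 +
      (toFrame e₁ e₂ x₀ (Z s)).2.2 • e₂ (Z s).1⟩ : TangentBundle (𝓡 2) M)) =ᶠ[𝓝 t] Z := by
    filter_upwards [h] with s hs
    exact congrArg (TotalSpace.mk (Z s).1) (hs.eq (Z s).2).symm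
  have h3 := (h1.congr h2.symm rfl).unique hZ
  have h4 := fromFrame_toFrame h0
  have h5 : rot o (Z t).1 (Z t).2 = (-(toFrame e₁ e₂ x₀ (Z t)).2.2) • e₁ (Z t).1 +
      (toFrame e₁ e₂ x₀ (Z t)).2.1 • e₂ (Z t).1 :=
    (congrArg (rot o (Z t).1) (h0.eq (Z t).2)).trans (h0.rot _ _)
  rw [h5] at h3
  have h6 := congrArg (inner ℝ (e₁ (Z t).1)) h3
  have h7 := congrArg (inner ℝ (e₂ (Z t).1)) h3
  simp only [inner_add_right, inner_smul_right, h0.unit₁, h0.ortho, h0.unit₂,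
    (real_inner_comm _ _).trans h0.ortho] at h6 h7
  have h8 := (hv.hasDerivAt_extChartAt h0.mem_source).unique hd.hasDerivAt.fst
  refine hd.hasDerivAt.congr_deriv ?_
  rw [frameField_eq (o := o) (by rwa [h4]), h4]
  refine Prod.ext h8.symm (Prod.ext ?_ ?_)
  · linear_combination h6
  · linear_combination h7


/-! ### Smoothness and existence of orbits. -/

variable {M : Type*} [TopologicalSpace M] [ChartedSpace Plane M] [IsManifold (𝓡 2) ∞ M]
  [RiemannianBundle (fun x : M ↦ TangentSpace (𝓡 2) x)]
  [IsContMDiffRiemannianBundle (𝓡 2) ∞ Plane (fun x : M ↦ TangentSpace (𝓡 2) x)]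
  {o : SurfaceOrientation M} {lam : UnitTangentBundle M → ℝ}

theorem continuous_proj_tangentBundle : Continuous fun q : TangentBundle (𝓡 2) M ↦ q.1 :=
  FiberBundle.continuous_proj Plane (fun x : M ↦ TangentSpace (𝓡 2) x)

theorem eventually_mdifferentiableAt_toFrame {e₁ e₂ : Π x : M, TangentSpace (𝓡 2) x}
    {q : TangentBundle (𝓡 2) M} (h : IsOrthonormalFrameAt o e₁ e₂ q.1) :
    ∀ᶠ r in 𝓝 q,
      MDifferentiableAt (𝓡 2).tangent 𝓘(ℝ, Plane × ℝ × ℝ) (toFrame e₁ e₂ q.1) r := by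
  have h1 : ContMDiffAt (𝓡 2).tangent 𝓘(ℝ, Plane × ℝ × ℝ) 1 (toFrame e₁ e₂ q.1) q :=
    (contMDiffAt_toFrame h rfl).of_le (by simp)
  filter_upwards [(contMDiffAt_iff_contMDiffAt_nhds (by simp)).1 h1] with r hr
  exact hr.mdifferentiableAt (by simp)

/-- The orbits of a thermostat are smooth. -/
theorem IsOrbitOn.contMDiffAt (hlam : IsSmoothOnUnitTangentBundle lam) {γ : ℝ → UnitTangentBundle M}
    {s : Set ℝ} (hs : IsOpen s) (hγ : IsOrbitOn (thermostatField o lam) γ s) {t₀ : ℝ}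
    (ht₀ : t₀ ∈ s) :
    ContMDiffAt 𝓘(ℝ, ℝ) (𝓡 2).tangent ∞ (fun r ↦ (γ r).1) t₀ := by
  obtain ⟨e₁, e₂, h⟩ := exists_isOrthonormalFrameAt o (γ t₀).1.1
  -- The frame equation lives on an open set of coordinates, so `lam` is replaced by a local
  -- extension to `TM`; on the orbit both agree.
  obtain ⟨f, hf, hf'⟩ := hlam (γ t₀)
  have hc : ContinuousAt (fun r ↦ (γ r).1) t₀ := (hγ t₀ ht₀).mdifferentiableAt.continuousAt
  have hc' : ContinuousAt γ t₀ := Topology.IsInducing.subtypeVal.continuousAt_iff.2 hc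
  have hπ : ContinuousAt (fun r ↦ (γ r).1.1) t₀ :=
    continuous_proj_tangentBundle.continuousAt.comp hc
  have ha : ∀ᶠ r in 𝓝 t₀, IsAdaptedAt o e₁ e₂ (γ t₀).1.1 (γ r).1.1 :=
    hπ.eventually h.eventually_adapted
  have hX : ∀ᶠ t in 𝓝 t₀, HasDerivAt (fun r ↦ toFrame e₁ e₂ (γ t₀).1.1 (γ r).1)
      (frameField e₁ e₂ (γ t₀).1.1 f (toFrame e₁ e₂ (γ t₀).1.1 (γ t).1)) t := by
    filter_upwards [hs.mem_nhds ht₀, ha.eventually_nhds,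
      hc.eventually (eventually_mdifferentiableAt_toFrame h), hc'.eventually hf']
      with t ht h1 h2 h3
    obtain ⟨h4, h5⟩ := isOrbitOn_iff.1 hγ t ht
    rw [← h3] at h5
    exact hasDerivAt_toFrame (Z := fun r ↦ (γ r).1) h1 h2 h4 h5
  have h0 := fromFrame_toFrame (q := (γ t₀).1) ha.self_of_nhds
  have hG : ContDiffAt ℝ ∞ (frameField e₁ e₂ (γ t₀).1.1 f) (toFrame e₁ e₂ (γ t₀).1.1 (γ t₀).1) :=
    contDiffAt_frameField h rfl (by rwa [h0])
  have h1 := contDiffAt_of_hasDerivAt hG hX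
  have h2 := ContMDiffAt.comp t₀ (contMDiffAt_fromFrame h
    (X := toFrame e₁ e₂ (γ t₀).1.1 (γ t₀).1) rfl) h1.contMDiffAt
  refine h2.congr_of_eventuallyEq ?_
  filter_upwards [ha] with r hr
  exact (fromFrame_toFrame hr).symm

theorem IsAdaptedAt.inner_fromFrame {e₁ e₂ : Π x : M, TangentSpace (𝓡 2) x} {x₀ : M}
    {X : Plane × ℝ × ℝ} (h : IsAdaptedAt o e₁ e₂ x₀ (fromFrame e₁ e₂ x₀ X).1) :
    (inner ℝ (fromFrame e₁ e₂ x₀ X).2 (fromFrame e₁ e₂ x₀ X).2 : ℝ) = X.2.1 ^ 2 + X.2.2 ^ 2 := by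
  have key {x : M} (h1 : (inner ℝ (e₁ x) (e₁ x) : ℝ) = 1) (h2 : (inner ℝ (e₂ x) (e₂ x) : ℝ) = 1)
      (h3 : (inner ℝ (e₁ x) (e₂ x) : ℝ) = 0) (a b : ℝ) :
      (inner ℝ (a • e₁ x + b • e₂ x) (a • e₁ x + b • e₂ x) : ℝ) = a ^ 2 + b ^ 2 := by
    simp only [inner_add_left, inner_add_right, inner_smul_left, inner_smul_right, h1, h2, h3,
      (real_inner_comm _ _).trans h3, conj_trivial]
    ring
  exact key h.unit₁ h.unit₂ h.ortho X.2.1 X.2.2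

/-- There is an orbit of a thermostat through every point. -/
theorem exists_isOrbitOn (o : SurfaceOrientation M) (hlam : IsSmoothOnUnitTangentBundle lam)
    (p : UnitTangentBundle M) : ∃ (γ : ℝ → UnitTangentBundle M) (s : Set ℝ), IsOpen s ∧
      IsPreconnected s ∧ (0 : ℝ) ∈ s ∧ γ 0 = p ∧ IsOrbitOn (thermostatField o lam) γ s := by
  classical
  obtain ⟨e₁, e₂, h⟩ := exists_isOrthonormalFrameAt o p.1.1
  obtain ⟨f, hf, hf'⟩ := hlam p
  set x₀ := p.1.1 with hx₀
  have h0 : fromFrame e₁ e₂ x₀ (toFrame e₁ e₂ x₀ p.1) = p.1 :=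
    fromFrame_toFrame h.eventually_adapted.self_of_nhds
  have hG : ContDiffAt ℝ ∞ (frameField e₁ e₂ x₀ f) (toFrame e₁ e₂ x₀ p.1) :=
    contDiffAt_frameField h rfl (by rwa [h0])
  obtain ⟨X, hX₀, ε, hε, hX⟩ := (hG.of_le (m := 1) (by simp)
    ).exists_forall_mem_closedBall_exists_eq_forall_mem_Ioo_hasDerivAt₀ 0
  have hXc : ContinuousAt X 0 := (hX 0 (by simpa using hε)).continuousAt
  have hFc : ContinuousAt (fun t ↦ fromFrame e₁ e₂ x₀ (X t)) 0 := by
    refine ContinuousAt.comp (g := fromFrame e₁ e₂ x₀) ?_ hXc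
    rw [hX₀]
    exact (contMDiffAt_fromFrame h (X := toFrame e₁ e₂ x₀ p.1) rfl).continuousAt
  have hF0 : fromFrame e₁ e₂ x₀ (X 0) = p.1 := by rw [hX₀, h0]
  have h1 : ∀ᶠ t in 𝓝 (0 : ℝ), (X t).1 ∈ (extChartAt (𝓡 2) x₀).target := by
    refine hXc.fst.preimage_mem_nhds (extChartAt_target_mem_nhds' ?_)
    rw [hX₀]
    exact mem_extChartAt_target x₀
  have h2 : ∀ᶠ t in 𝓝 (0 : ℝ), IsAdaptedAt o e₁ e₂ x₀ (fromFrame e₁ e₂ x₀ (X t)).1 := by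
    refine (continuous_proj_tangentBundle.continuousAt.comp hFc).eventually ?_
    change ∀ᶠ x in 𝓝 (fromFrame e₁ e₂ x₀ (X 0)).1, _
    rw [hF0]
    exact h.eventually_adapted
  -- The solution is not yet known to have unit length, so the agreement with `lam` is stated
  -- conditionally on it.
  have h3 : ∀ᶠ t in 𝓝 (0 : ℝ), ∀ hq, f (fromFrame e₁ e₂ x₀ (X t)) =
      lam ⟨fromFrame e₁ e₂ x₀ (X t), hq⟩ := by
    rw [nhds_subtype_eq_comap, Filter.eventually_comap] at hf'
    rw [← hF0] at hf'
    filter_upwards [hFc.eventually hf'] with t ht hq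
    exact ht ⟨_, hq⟩ rfl
  obtain ⟨δ, hδ, hall⟩ := Metric.eventually_nhds_iff_ball.1 (h1.and (h2.and h3))
  let s := Set.Ioo (0 - min ε δ) (0 + min ε δ)
  have hs0 : (0 : ℝ) ∈ s := by simp [s, hε, hδ]
  have hsX (t : ℝ) (ht : t ∈ s) : HasDerivAt X (frameField e₁ e₂ x₀ f (X t)) t :=
    hX t ⟨by linarith [ht.1, min_le_left ε δ], by linarith [ht.2, min_le_left ε δ]⟩
  have hsall (t : ℝ) (ht : t ∈ s) := hall t (by
    rw [Metric.mem_ball, Real.dist_eq, abs_lt]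
    exact ⟨by linarith [ht.1, min_le_right ε δ], by linarith [ht.2, min_le_right ε δ]⟩)
  -- The derivative of the coordinates `(a, b)` is `k(-b, a)`, orthogonal to `(a, b)`. So the length
  -- is conserved and the solution of the extended equation stays in `SM`.
  have hN (t : ℝ) (ht : t ∈ s) :
      HasDerivAt (fun r ↦ (X r).2.1 ^ 2 + (X r).2.2 ^ 2) 0 t := by
    have ha : HasDerivAt (fun r ↦ (X r).2.1) (frameField e₁ e₂ x₀ f (X t)).2.1 t :=
      (hsX t ht).snd.fst
    have hb : HasDerivAt (fun r ↦ (X r).2.2) (frameField e₁ e₂ x₀ f (X t)).2.2 t :=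
      (hsX t ht).snd.snd
    refine ((ha.fun_pow 2).fun_add (hb.fun_pow 2)).congr_deriv ?_
    simp only [frameField]
    ring
  have hunit (t : ℝ) (ht : t ∈ s) : (inner ℝ (fromFrame e₁ e₂ x₀ (X t)).2
      (fromFrame e₁ e₂ x₀ (X t)).2 : ℝ) = 1 := by
    have h4 := isOpen_Ioo.is_const_of_deriv_eq_zero isPreconnected_Ioo
      (fun t ht ↦ (hN t ht).differentiableAt.differentiableWithinAt)
      (fun t ht ↦ (hN t ht).deriv) ht hs0
    rw [(hsall t ht).2.1.inner_fromFrame]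
    refine h4.trans ?_
    rw [← (hsall 0 hs0).2.1.inner_fromFrame, hF0]
    exact p.2
  let γ : ℝ → UnitTangentBundle M := fun t ↦ if ht : t ∈ s then ⟨_, hunit t ht⟩ else p
  have hγ (t : ℝ) (ht : t ∈ s) : (γ t).1 = fromFrame e₁ e₂ x₀ (X t) := by
    simp only [γ, dif_pos ht]
  refine ⟨γ, s, isOpen_Ioo, isPreconnected_Ioo, hs0, Subtype.ext ((hγ 0 hs0).trans hF0),
    isOrbitOn_iff.2 fun t ht ↦ ?_⟩
  obtain ⟨h4, h5⟩ := hasVelocityAt_and_hasCovDerivAlong_fromFrame (hsall t ht).1 (hsall t ht).2.1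
    (hsX t ht)
  have h6 : (fun r ↦ (γ r).1) =ᶠ[𝓝 t] fun r ↦ fromFrame e₁ e₂ x₀ (X r) := by
    filter_upwards [isOpen_Ioo.mem_nhds ht] with r hr
    exact hγ r hr
  refine ⟨h4.congr (h6.fun_comp (fun q ↦ q.1)) (hγ t ht), h5.congr h6 ?_⟩
  have h7 : lam (γ t) = f (γ t).1 := by
    have h8 := (hsall t ht).2.2 (hunit t ht)
    have h9 : γ t = ⟨_, hunit t ht⟩ := Subtype.ext (hγ t ht)
    rw [h9, h8]
  rw [h7]
  exact congrArg (fun q : TangentBundle (𝓡 2) M ↦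
    (⟨q.1, f q • rot o q.1 q.2⟩ : TangentBundle (𝓡 2) M)) (hγ t ht)


/-! ### Projective thermostats have fibrewise cubic intensity. -/

section Thermostat

variable {M : Type*} [TopologicalSpace M] [ChartedSpace Plane M] [IsManifold (𝓡 2) ∞ M]
  [RiemannianBundle (fun x : M ↦ TangentSpace (𝓡 2) x)]
  [IsContMDiffRiemannianBundle (𝓡 2) ∞ Plane (fun x : M ↦ TangentSpace (𝓡 2) x)]
  {o : SurfaceOrientation M} {lam : UnitTangentBundle M → ℝ}

/-- If a reparametrisation of an orbit is a geodesic of a connection, the intensity of the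
thermostat along the orbit is determined by the connection. -/
theorem IsOrbitOn.eq_neg_inner {cov : CovariantDerivative (𝓡 2) Plane
      (fun x : M ↦ TangentSpace (𝓡 2) x)} {γ : ℝ → UnitTangentBundle M} {s s' : Set ℝ} {φ : ℝ → ℝ}
    (hγ : IsOrbitOn (thermostatField o lam) γ s) (hs : IsOpen s) (hs' : IsOpen s')
    (hφ : IsReparametrization φ s' s) (hc : IsGeodesicOn cov (fun t ↦ (γ (φ t)).1.1) s')
    {t₀ : ℝ} (ht₀ : t₀ ∈ s) :
    lam (γ t₀) = -inner ℝ (cov (FiberBundle.extend Plane (γ t₀).1.2) _ (γ t₀).1.2 -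
      leviCivita (𝓡 2) M (FiberBundle.extend Plane (γ t₀).1.2) _ (γ t₀).1.2)
      (rot o _ (γ t₀).1.2) := by
  obtain ⟨t, ht, rfl⟩ := hφ.bijOn.surjOn ht₀
  have hφt := hφ.contDiffOn.contDiffAt (hs'.mem_nhds ht)
  have hd : ∀ᶠ r in 𝓝 t, DifferentiableAt ℝ φ r := by
    filter_upwards [hs'.mem_nhds ht] with r hr
    exact (hφ.contDiffOn.contDiffAt (hs'.mem_nhds hr)).differentiableAt (by simp)
  have hφ' : HasDerivAt (deriv φ) (deriv (deriv φ) t) t :=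
    ((hφt.derivWithin (m := ∞) (by simp)).differentiableAt (by simp)).hasDerivAt
  have hv : ∀ᶠ r in 𝓝 (φ t), HasVelocityAt (J := 𝓡 2) (fun r ↦ (γ r).1.1) r (γ r).1.2 := by
    filter_upwards [hs.mem_nhds ht₀] with r hr
    exact (isOrbitOn_iff.1 hγ r hr).1
  have h1 := hasCovDerivAlong_velocity_comp (Z := fun r ↦ (γ r).1) (isOrbitOn_iff.1 hγ _ ht₀).2 hv
    hd hφ'
  have hw := hv.self_of_nhds.comp hd.self_of_nhds.hasDerivAt
  -- Two computations of the acceleration for `cov` of the reparametrised curve: from the orbit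
  -- equation by changing the connection, and as zero because the curve is a geodesic.
  have h2 := (h1.change cov hw).unique (hc.2 t ht)
  have h3 : (velocity (𝓡 2) (fun s ↦ (γ (φ s)).1.1) t).2 = deriv φ t • (γ (φ t)).1.2 :=
    hw.velocity_snd
  -- Pairing with `Jv` removes the tangential term `b v`. The remaining terms are homogeneous of
  -- degree two in `a ≠ 0`, which cancels.
  have key {x : M} (v u : TangentSpace (𝓡 2) x) (hv : (inner ℝ v v : ℝ) = 1) (a b k : ℝ)
      (ha : a ≠ 0) (hu : u = a • v) (h : b • v + a • a • k • rot o x v +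
        (cov (FiberBundle.extend Plane u) x (a • v) -
          leviCivita (𝓡 2) M (FiberBundle.extend Plane u) x (a • v)) = 0) :
      k = -inner ℝ (cov (FiberBundle.extend Plane v) x v -
        leviCivita (𝓡 2) M (FiberBundle.extend Plane v) x v) (rot o x v) := by
    subst hu
    rw [cov_extend_smul, cov_extend_smul, map_smul, map_smul, ← smul_sub, ← smul_sub] at h
    have h4 := congrArg (fun w ↦ (inner ℝ w (rot o x v) : ℝ)) h
    have h5 : (inner ℝ v (rot o x v) : ℝ) = 0 :=
      (real_inner_comm _ _).trans ((o.orient x).inner_rightAngleRotation_self v)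
    simp only [inner_add_left, inner_smul_left, h5, LinearIsometryEquiv.inner_map_map, hv,
      inner_zero_left, conj_trivial] at h4
    have h6 : a ^ 2 ≠ 0 := pow_ne_zero 2 ha
    refine mul_left_cancel₀ h6 ?_
    linear_combination h4
  exact key _ _ (γ (φ t)).2 _ _ _ (hφ.deriv_ne_zero t ht) h3 h2

/-- The intensity of a projective thermostat is a cubic polynomial on the fibres. -/
theorem IsProjectiveThermostat.isFiberwiseCubic (h : IsProjectiveThermostat o lam)
    (hlam : IsSmoothOnUnitTangentBundle lam) : IsFiberwiseCubic o lam := by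
  obtain ⟨cov, -, -, hcov⟩ := h
  let D (x : M) (u w : TangentSpace (𝓡 2) x) : TangentSpace (𝓡 2) x :=
    cov (FiberBundle.extend Plane u) x w - leviCivita (𝓡 2) M (FiberBundle.extend Plane u) x w
  have h1 (p : UnitTangentBundle M) :
      lam p = -inner ℝ (D p.1.1 p.1.2 p.1.2) (rot o p.1.1 p.1.2) := by
    obtain ⟨γ, s, hs, hs1, h0, rfl, hγ⟩ := exists_isOrbitOn o hlam p
    obtain ⟨φ, s', hs', -, hφ, hc⟩ := hcov γ s hs hs1 hγ
    exact hγ.eq_neg_inner hs hs' hφ hc h0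
  have hD (x : M) (u w : TangentSpace (𝓡 2) x) (a b : ℝ) : D x (a • u + b • w) (a • u + b • w) =
      a ^ 2 • D x u u + (a * b) • (D x u w + D x w u) + b ^ 2 • D x w w := by
    simp only [D, cov_extend_add, cov_extend_smul, map_add, map_smul]
    module
  have hJ (x : M) (u : TangentSpace (𝓡 2) x) (a b : ℝ) :
      rot o x (a • u + b • rot o x u) = a • rot o x u - b • u := by
    have : rot o x (rot o x u) = -u := (o.orient x).rightAngleRotation_rightAngleRotation u
    rw [map_add, map_smul, map_smul, this]
    module
  intro p
  set u := p.1.2 with hu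
  let w := rot o p.1.1 u
  -- The coefficients of `-⟨D(v, v), Jv⟩` for `v = cos t u + sin t w`, where `Jv = cos t w - sin t
  -- u`.
  refine ⟨-inner ℝ (D _ u u) w, inner ℝ (D _ u u) u - inner ℝ (D _ u w + D _ w u) w,
    inner ℝ (D _ u w + D _ w u) u - inner ℝ (D _ w w) w, inner ℝ (D _ w w) u, fun t ↦ ?_⟩
  refine (h1 (rotate o t p)).trans ((congrArg (fun v ↦ -inner ℝ (D p.1.1 v v) (rot o p.1.1 v))
    (rotate_snd o t p)).trans ?_)
  simp only [hD, hJ]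
  change -inner ℝ (_ • D _ u u + _ • (D _ u w + D _ w u) + _ • D _ w w) (_ • w - _ • u) = _
  simp only [inner_add_left, inner_sub_right, inner_smul_left, inner_smul_right, conj_trivial]
  ring

end Thermostat

/-! ### Reparametrisations that remove a tangential acceleration. -/

section Reparametrization

open Set

theorem exists_primitive {s : Set ℝ} (hs : IsOpen s) (hs' : IsPreconnected s) {f : ℝ → ℝ}
    (hf : ContDiffOn ℝ ∞ f s) :
    ∃ F : ℝ → ℝ, ContDiffOn ℝ ∞ F s ∧ ∀ t ∈ s, HasDerivAt F (f t) t := by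
  rcases s.eq_empty_or_nonempty with rfl | ⟨t₀, ht₀⟩
  · exact ⟨f, hf, by simp⟩
  have h1 : ∀ t ∈ s, HasDerivAt (fun t ↦ ∫ r in t₀..t, f r) (f t) t := fun t ht ↦
    intervalIntegral.integral_hasDerivAt_right
      ((hf.continuousOn.mono (hs'.ordConnected.uIcc_subset ht₀ ht)).intervalIntegrable)
      (hf.continuousOn.stronglyMeasurableAtFilter hs t ht)
      (hf.continuousOn.continuousAt (hs.mem_nhds ht))
  refine ⟨_, ?_, h1⟩
  rw [contDiffOn_infty_iff_deriv_of_isOpen hs]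
  exact ⟨fun t ht ↦ (h1 t ht).differentiableAt.differentiableWithinAt,
    hf.congr fun t ht ↦ (h1 t ht).deriv⟩

/-- A smooth bijection with nonvanishing derivative has a smooth inverse. -/
theorem isReparametrization_invFunOn {s : Set ℝ} (hs : IsOpen s) {ψ ψ' : ℝ → ℝ}
    (hψ : ContDiffOn ℝ ∞ ψ s) (hd : ∀ t ∈ s, HasDerivAt ψ (ψ' t) t) (h0 : ∀ t ∈ s, ψ' t ≠ 0)
    (hinj : InjOn ψ s) : IsOpen (ψ '' s) ∧ IsReparametrization (Function.invFunOn ψ s) (ψ '' s) s ∧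
      ∀ t ∈ ψ '' s, HasDerivAt (Function.invFunOn ψ s) (ψ' (Function.invFunOn ψ s t))⁻¹ t := by
  have hstrict (t) (ht : t ∈ s) : HasStrictDerivAt ψ (ψ' t) t := by
    have := (hψ.contDiffAt (hs.mem_nhds ht)).hasStrictDerivAt (by simp)
    rwa [(hd t ht).deriv] at this
  have hopen : IsOpen (ψ '' s) := by
    rw [isOpen_iff_mem_nhds]
    rintro _ ⟨t, ht, rfl⟩
    rw [← (hstrict t ht).map_nhds_eq (h0 t ht)]
    exact Filter.image_mem_map (hs.mem_nhds ht)
  have hleft (t) (ht : t ∈ s) : Function.invFunOn ψ s (ψ t) = t := hinj.leftInvOn_invFunOn ht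
  have hbij : BijOn (Function.invFunOn ψ s) (ψ '' s) s := by
    refine ⟨?_, ?_, fun t ht ↦ ⟨ψ t, mem_image_of_mem ψ ht, hleft t ht⟩⟩
    · rintro _ ⟨t, ht, rfl⟩
      rwa [hleft t ht]
    · rintro _ ⟨t, ht, rfl⟩ _ ⟨r, hr, rfl⟩ h
      rw [hleft t ht, hleft r hr] at h
      rw [h]
  have hsmooth (t) (ht : t ∈ ψ '' s) : ContDiffAt ℝ ∞ (Function.invFunOn ψ s) t := by
    obtain ⟨t, ht, rfl⟩ := ht
    have hc := hψ.contDiffAt (hs.mem_nhds ht)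
    have hf : HasFDerivAt ψ
        (ContinuousLinearEquiv.unitsEquivAut ℝ (Units.mk0 _ (h0 t ht)) : ℝ →L[ℝ] ℝ) t := by
      refine (hd t ht).hasFDerivAt.congr_fderiv ?_
      ext
      simp
    have hne : (∞ : ℕ∞ω) ≠ 0 := by simp
    have hs1 : HasStrictFDerivAt ψ
        (ContinuousLinearEquiv.unitsEquivAut ℝ (Units.mk0 _ (h0 t ht)) : ℝ →L[ℝ] ℝ) t :=
      hc.hasStrictFDerivAt' hf hne
    have h1 := hc.to_localInverse hf hne
    have h2 : ∀ᶠ y in 𝓝 (ψ t), ψ (hc.localInverse hf hne y) = y := hs1.eventually_right_inverse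
    have h3 : hc.localInverse hf hne (ψ t) = t := hs1.localInverse_apply_image
    have h4 : ∀ᶠ y in 𝓝 (ψ t), hc.localInverse hf hne y ∈ s :=
      h1.continuousAt.preimage_mem_nhds (by rw [h3]; exact hs.mem_nhds ht)
    -- Near `ψ t` the smooth local inverse takes values in `s`, where `ψ` is injective, so it
    -- coincides with `Function.invFunOn ψ s`.
    refine h1.congr_of_eventuallyEq ?_
    filter_upwards [h2, h4] with y hy hy'
    rw [← hleft _ hy', hy]
  have hder (t) (ht : t ∈ ψ '' s) :
      HasDerivAt (Function.invFunOn ψ s) (ψ' (Function.invFunOn ψ s t))⁻¹ t := by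
    refine (hd _ (hbij.mapsTo ht)).of_local_left_inverse (hsmooth t ht).continuousAt
      (h0 _ (hbij.mapsTo ht)) ?_
    filter_upwards [hopen.mem_nhds ht] with y hy
    exact Function.invFunOn_eq hy
  refine ⟨hopen, ⟨fun t ht ↦ (hsmooth t ht).contDiffWithinAt, fun t ht ↦ ?_, hbij⟩, hder⟩
  rw [(hder t ht).deriv]
  exact inv_ne_zero (h0 _ (hbij.mapsTo ht))

/-- The solution of `φ'' = -f(φ) φ'²`. -/
theorem exists_isReparametrization {s : Set ℝ} (hs : IsOpen s) (hs' : IsPreconnected s) {f : ℝ → ℝ}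
    (hf : ContDiffOn ℝ ∞ f s) :
    ∃ (φ : ℝ → ℝ) (s' : Set ℝ), IsOpen s' ∧ IsPreconnected s' ∧ IsReparametrization φ s' s ∧
      ∀ t ∈ s', HasDerivAt (deriv φ) (-f (φ t) * deriv φ t ^ 2) t := by
  -- With `F' = f` and `ψ' = exp F`, the inverse `φ` of `ψ` has `φ' = exp(-F(φ))`, and one more
  -- differentiation gives `φ'' = -f(φ) φ'²`.
  obtain ⟨F, hF, hF'⟩ := exists_primitive hs hs' hf
  obtain ⟨ψ, hψ, hψ'⟩ := exists_primitive hs hs' hF.exp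
  have hinj : InjOn ψ s := by
    refine (strictMonoOn_of_deriv_pos (convex_iff_ordConnected.2 hs'.ordConnected) hψ.continuousOn
      fun t ht ↦ ?_).injOn
    rw [(hψ' t (interior_subset ht)).deriv]
    exact Real.exp_pos _
  obtain ⟨h1, h2, h3⟩ := isReparametrization_invFunOn hs hψ hψ' (fun t _ ↦ (Real.exp_pos _).ne') hinj
  refine ⟨_, _, h1, hs'.image ψ hψ.continuousOn, h2, fun t ht ↦ ?_⟩
  have h4 : deriv (Function.invFunOn ψ s) =ᶠ[𝓝 t]
      fun r ↦ Real.exp (-F (Function.invFunOn ψ s r)) := by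
    filter_upwards [h1.mem_nhds ht] with r hr
    rw [(h3 r hr).deriv, Real.exp_neg]
  have h5 := ((hF' _ (h2.bijOn.mapsTo ht)).comp t (h3 t ht)).neg.exp
  refine (h5.congr_of_eventuallyEq h4).congr_deriv ?_
  rw [(h3 t ht).deriv]
  simp only [Function.comp, Pi.neg_apply, Real.exp_neg]
  ring

end Reparametrization


/-! ### From fibrewise cubic functions to symmetric tensors. -/

section Plane

variable {V : Type*} [NormedAddCommGroup V] [InnerProductSpace ℝ V]
  [Fact (Module.finrank ℝ V = 2)] (o : Orientation ℝ V (Fin 2))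

/-- Every homogeneous cubic polynomial on an oriented Euclidean plane is of the form
`v ↦ -⟨B(v, v), Jv⟩` with `B` bilinear and `⟨B(u, v), Jw⟩` totally symmetric. -/
theorem exists_bilinear_of_cubic {e : V} (he : inner ℝ e e = (1 : ℝ)) (a b c d : ℝ) :
    ∃ B : V →L[ℝ] V →L[ℝ] V, (∀ u v, B u v = B v u) ∧
      (∀ u v w, (inner ℝ (B u v) (o.rightAngleRotation w) : ℝ) =
        inner ℝ (B u w) (o.rightAngleRotation v)) ∧
      ∀ x y : ℝ, -(inner ℝ (B (x • e + y • o.rightAngleRotation e)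
        (x • e + y • o.rightAngleRotation e))
          (o.rightAngleRotation (x • e + y • o.rightAngleRotation e)) : ℝ) =
        a * x ^ 3 + b * (x ^ 2 * y) + c * (x * y ^ 2) + d * y ^ 3 := by
  set f := o.rightAngleRotation e with hf
  have hff : (inner ℝ f f : ℝ) = 1 := by rw [hf, LinearIsometryEquiv.inner_map_map, he]
  have hfe : (inner ℝ f e : ℝ) = 0 := o.inner_rightAngleRotation_self e
  have hef : (inner ℝ e f : ℝ) = 0 := (real_inner_comm _ _).trans hfe
  have hJf : o.rightAngleRotation f = -e := o.rightAngleRotation_rightAngleRotation e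
  have hJ (w : V) : o.rightAngleRotation w = (-(inner ℝ f w : ℝ)) • e + (inner ℝ e w : ℝ) • f := by
    conv_lhs => rw [eq_frame o he w]
    rw [map_add, map_smul, map_smul, ← hf, hJf]
    module
  let ℓ₁ : V →L[ℝ] ℝ := innerSL ℝ e
  let ℓ₂ : V →L[ℝ] ℝ := innerSL ℝ f
  -- These are to be `B(e, e)`, `B(e, f)` and `B(f, f)`. Since `Je = f` and `Jf = -e`, their
  -- components are fixed by requiring `-⟨B(u, v), Jw⟩` to be the polarization of the cubic; the
  -- thirds come from polarizing its mixed terms.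
  let β₁ : V := (b / 3) • e - a • f
  let β₂ : V := (c / 3) • e - (b / 3) • f
  let β₃ : V := d • e - (c / 3) • f
  let B : V →L[ℝ] V →L[ℝ] V := ℓ₁.smulRight (ℓ₁.smulRight β₁ + ℓ₂.smulRight β₂) +
    ℓ₂.smulRight (ℓ₁.smulRight β₂ + ℓ₂.smulRight β₃)
  have hB (u v : V) : B u v = (inner ℝ e u * inner ℝ e v : ℝ) • β₁ +
      (inner ℝ e u * inner ℝ f v + inner ℝ f u * inner ℝ e v : ℝ) • β₂ +
      (inner ℝ f u * inner ℝ f v : ℝ) • β₃ := by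
    simp only [B, ℓ₁, ℓ₂, add_apply, ContinuousLinearMap.smulRight_apply,
      innerSL_apply_apply, smul_apply]
    module
  have hBJ (u v w : V) : (inner ℝ (B u v) (o.rightAngleRotation w) : ℝ) =
      -(a * (inner ℝ e u * inner ℝ e v * inner ℝ e w) +
        b / 3 * (inner ℝ e u * inner ℝ e v * inner ℝ f w + inner ℝ e u * inner ℝ f v * inner ℝ e w +
          inner ℝ f u * inner ℝ e v * inner ℝ e w) +
        c / 3 * (inner ℝ e u * inner ℝ f v * inner ℝ f w + inner ℝ f u * inner ℝ e v * inner ℝ f w +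
          inner ℝ f u * inner ℝ f v * inner ℝ e w) + d * (inner ℝ f u * inner ℝ f v * inner ℝ f w)) := by
    rw [hB, hJ]
    simp only [β₁, β₂, β₃, inner_add_left, inner_sub_left, inner_add_right, inner_smul_left,
      inner_smul_right, he, hff, hef, hfe, conj_trivial]
    ring
  refine ⟨B, fun u v ↦ ?_, fun u v w ↦ ?_, fun x y ↦ ?_⟩
  · rw [hB, hB]
    module
  · rw [hBJ, hBJ]
    ring
  · rw [hBJ]
    simp only [inner_add_right, inner_smul_right, he, hff, hef, hfe]
    ring

theorem smul_add_smul_eq_zero {x v w : V} {k l : ℝ} (h : x = k • v + l • w) (a : ℝ) :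
    (-k * a ^ 2) • v + a • a • (-l • w + x) = 0 := by
  subst h
  module

end Plane

variable {M : Type*} [TopologicalSpace M] [ChartedSpace Plane M] [IsManifold (𝓡 2) ∞ M]
  [RiemannianBundle (fun x : M ↦ TangentSpace (𝓡 2) x)]
  {o : SurfaceOrientation M} {lam : UnitTangentBundle M → ℝ}

/-- The symmetric bilinear form `B` on the tangent bundle with values in the tangent bundle represents
the function `lam`, in the sense that `lam v = -⟨B(v, v), Jv⟩`, and that `⟨B(u, v), Jw⟩` is totally
symmetric. -/
structure Represents (o : SurfaceOrientation M)
    (B : Π x : M, TangentSpace (𝓡 2) x →L[ℝ] TangentSpace (𝓡 2) x →L[ℝ] TangentSpace (𝓡 2) x)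
    (lam : UnitTangentBundle M → ℝ) : Prop where
  symm : ∀ x u v, B x u v = B x v u
  symm_rot : ∀ x u v w, (inner ℝ (B x u v) (rot o x w) : ℝ) = inner ℝ (B x u w) (rot o x v)
  eq_neg_inner : ∀ p, lam p = -inner ℝ (B p.1.1 p.1.2 p.1.2) (rot o p.1.1 p.1.2)

/-- The choice is made pointwise, with no continuity in `x`. Smoothness is recovered afterwards,
because total symmetry leaves no freedom in `B`. -/
theorem IsFiberwiseCubic.exists_represents (h : IsFiberwiseCubic o lam) :
    ∃ B, Represents o B lam := by
  have key (x : M) : ∃ B : TangentSpace (𝓡 2) x →L[ℝ] TangentSpace (𝓡 2) x →L[ℝ]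
      TangentSpace (𝓡 2) x, (∀ u v, B u v = B v u) ∧
      (∀ u v w, (inner ℝ (B u v) (rot o x w) : ℝ) = inner ℝ (B u w) (rot o x v)) ∧
      ∀ (v : TangentSpace (𝓡 2) x) (hv : (inner ℝ v v : ℝ) = 1),
        lam ⟨⟨x, v⟩, hv⟩ = -inner ℝ (B v v) (rot o x v) := by
    obtain ⟨e, he⟩ := exists_inner_self_eq_one x
    obtain ⟨a, b, c, d, hp⟩ := h ⟨⟨x, e⟩, he⟩
    obtain ⟨B, h1, h2, h3⟩ := exists_bilinear_of_cubic (o.orient x) he a b c d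
    refine ⟨B, h1, h2, fun v hv ↦ ?_⟩
    obtain ⟨t, ht⟩ : ∃ t : ℝ, v = Real.cos t • e + Real.sin t • rot o x e := by
      have h4 : v = (inner ℝ e v : ℝ) • e + (inner ℝ (rot o x e) v : ℝ) • rot o x e :=
        eq_frame (o.orient x) he v
      have h5 : (inner ℝ e v : ℝ) ^ 2 + (inner ℝ (rot o x e) v : ℝ) ^ 2 = 1 := by
        have := congrArg (fun w ↦ (inner ℝ w v : ℝ)) h4
        simp only [inner_add_left, inner_smul_left, conj_trivial, hv] at this
        linear_combination -this
      obtain ⟨t, ht, ht'⟩ : ∃ t : ℝ, (inner ℝ e v : ℝ) = Real.cos t ∧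
          (inner ℝ (rot o x e) v : ℝ) = Real.sin t := by
        have h6 : ‖(⟨inner ℝ e v, inner ℝ (rot o x e) v⟩ : ℂ)‖ = 1 := by
          rw [Complex.norm_def, Complex.normSq_mk, ← sq, ← sq, h5, Real.sqrt_one]
        obtain ⟨t, ht⟩ := (Complex.norm_eq_one_iff _).1 h6
        refine ⟨t, ?_, ?_⟩
        · simpa [Complex.exp_ofReal_mul_I_re] using (congrArg Complex.re ht).symm
        · simpa [Complex.exp_ofReal_mul_I_im] using (congrArg Complex.im ht).symm
      exact ⟨t, by rw [← ht, ← ht']; exact h4⟩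
    have h4 : (rotate o t ⟨⟨x, e⟩, he⟩) = ⟨⟨x, v⟩, hv⟩ := by
      refine Subtype.ext ?_
      have h5 : (rotate o t ⟨⟨x, e⟩, he⟩).1.2 = v := (rotate_snd o t _).trans ht.symm
      exact congrArg (TotalSpace.mk x) h5
    rw [← h4, hp, ← h3, ht]
    rfl
  choose B h1 h2 h3 using key
  exact ⟨B, h1, h2, fun p ↦ h3 p.1.1 p.1.2 p.2⟩

variable [IsContMDiffRiemannianBundle (𝓡 2) ∞ Plane (fun x : M ↦ TangentSpace (𝓡 2) x)]
  {B : Π x : M, TangentSpace (𝓡 2) x →L[ℝ] TangentSpace (𝓡 2) x →L[ℝ] TangentSpace (𝓡 2) x}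
  {x₀ : M}

/-- Along a unit field `σ` this function is `-λ ∘ σ`. -/
theorem Represents.contMDiffAt_diagonal (h : Represents o B lam)
    (hlam : IsSmoothOnUnitTangentBundle lam) {σ : Π x : M, TangentSpace (𝓡 2) x}
    (hσ : SmoothFieldAt σ x₀) (hu : ∀ᶠ x in 𝓝 x₀, (inner ℝ (σ x) (σ x) : ℝ) = 1) :
    ContMDiffAt (𝓡 2) 𝓘(ℝ, ℝ) ∞
      (fun x ↦ (inner ℝ (B x (σ x) (σ x)) (rot o x (σ x)) : ℝ)) x₀ := by
  obtain ⟨f, hf, hf'⟩ := hlam ⟨⟨x₀, σ x₀⟩, hu.self_of_nhds⟩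
  have h1 : ContMDiffAt (𝓡 2) 𝓘(ℝ, ℝ) ∞ (fun x ↦ f ⟨x, σ x⟩) x₀ := ContMDiffAt.comp x₀ hf hσ
  refine h1.neg.congr_of_eventuallyEq ?_
  rw [nhds_subtype_eq_comap, Filter.eventually_comap] at hf'
  filter_upwards [hu, hσ.continuousAt.eventually hf'] with x hx hx'
  have h2 := hx' ⟨⟨x, σ x⟩, hx⟩ rfl
  have h3 := h.eq_neg_inner ⟨⟨x, σ x⟩, hx⟩
  change _ = -f ⟨x, σ x⟩
  rw [h2, h3, neg_neg]

/-- By total symmetry the trilinear form `⟨B(u, v), Jw⟩` has four independent components in a frame,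
the coefficients of a binary cubic up to binomial factors; they are linear combinations of its
values on four unit fields, which are smooth. -/
theorem Represents.smoothFieldAt (h : Represents o B lam)
    (hlam : IsSmoothOnUnitTangentBundle lam) {Y U : Π x : M, TangentSpace (𝓡 2) x}
    (hY : SmoothFieldAt Y x₀) (hU : SmoothFieldAt U x₀) :
    SmoothFieldAt (fun x ↦ B x (Y x) (U x)) x₀ := by
  obtain ⟨e₁, e₂, he⟩ := exists_isOrthonormalFrameAt o x₀
  have hT (x : M) (u v w : TangentSpace (𝓡 2) x) : (inner ℝ (B x u v) (rot o x w) : ℝ) =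
      inner ℝ (B x w u) (rot o x v) := by rw [h.symm_rot, h.symm]
  have h1 := he.eventually_adapted
  have hdiag (a b : ℝ) (hab : a ^ 2 + b ^ 2 = 1) := h.contMDiffAt_diagonal hlam
    (contMDiffAt_smul_add_smul contMDiffAt_id (contMDiffAt_const (c := a))
      (contMDiffAt_const (c := b)) he.smooth₁ he.smooth₂) (by
      filter_upwards [h1] with x hx
      simp only [inner_add_left, inner_add_right, inner_smul_left, inner_smul_right, hx.unit₁,
        hx.unit₂, hx.ortho, (real_inner_comm _ _).trans hx.ortho, conj_trivial]
      linear_combination hab)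
  have hcube (x : M) (a b : ℝ) : (inner ℝ (B x (a • e₁ x + b • e₂ x) (a • e₁ x + b • e₂ x))
      (rot o x (a • e₁ x + b • e₂ x)) : ℝ) =
      a ^ 3 * inner ℝ (B x (e₁ x) (e₁ x)) (rot o x (e₁ x)) +
      3 * a ^ 2 * b * inner ℝ (B x (e₁ x) (e₁ x)) (rot o x (e₂ x)) +
      3 * a * b ^ 2 * inner ℝ (B x (e₂ x) (e₂ x)) (rot o x (e₁ x)) +
      b ^ 3 * inner ℝ (B x (e₂ x) (e₂ x)) (rot o x (e₂ x)) := by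
    simp only [map_add, map_smul, add_apply, smul_apply,
      inner_add_left, inner_add_right, inner_smul_left, inner_smul_right, conj_trivial]
    rw [h.symm x (e₂ x) (e₁ x), hT x (e₁ x) (e₂ x) (e₁ x), hT x (e₁ x) (e₂ x) (e₂ x),
      h.symm_rot x (e₂ x) (e₁ x) (e₂ x)]
    ring
  -- Four unit vectors with rational coordinates at which the values determine a binary cubic. The
  -- first two give the pure coefficients; the sum and the difference of the last two separate the
  -- mixed ones, whence the constants below.
  have k₁ := hdiag 1 0 (by norm_num)
  have k₂ := hdiag 0 1 (by norm_num)
  have k₃ := hdiag (3 / 5) (4 / 5) (by norm_num)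
  have k₄ := hdiag (3 / 5) (-(4 / 5)) (by norm_num)
  simp only [hcube] at k₁ k₂ k₃ k₄
  have m₁ : ContMDiffAt (𝓡 2) 𝓘(ℝ, ℝ) ∞
      (fun x ↦ (inner ℝ (B x (e₁ x) (e₁ x)) (rot o x (e₁ x)) : ℝ)) x₀ := by
    refine k₁.congr_of_eventuallyEq (Filter.Eventually.of_forall fun x ↦ ?_)
    ring
  have m₂ : ContMDiffAt (𝓡 2) 𝓘(ℝ, ℝ) ∞
      (fun x ↦ (inner ℝ (B x (e₂ x) (e₂ x)) (rot o x (e₂ x)) : ℝ)) x₀ := by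
    refine k₂.congr_of_eventuallyEq (Filter.Eventually.of_forall fun x ↦ ?_)
    ring
  have m₃ : ContMDiffAt (𝓡 2) 𝓘(ℝ, ℝ) ∞
      (fun x ↦ (inner ℝ (B x (e₁ x) (e₁ x)) (rot o x (e₂ x)) : ℝ)) x₀ := by
    refine ((contMDiffAt_const (c := (125 / 216 : ℝ)).mul (k₃.sub k₄)).sub
      (contMDiffAt_const (c := (128 / 216 : ℝ)).mul m₂)).congr_of_eventuallyEq
      (Filter.Eventually.of_forall fun x ↦ ?_)
    simp only [Pi.mul_apply]
    ring
  have m₄ : ContMDiffAt (𝓡 2) 𝓘(ℝ, ℝ) ∞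
      (fun x ↦ (inner ℝ (B x (e₂ x) (e₂ x)) (rot o x (e₁ x)) : ℝ)) x₀ := by
    refine ((contMDiffAt_const (c := (125 / 288 : ℝ)).mul (k₃.add k₄)).sub
      (contMDiffAt_const (c := (54 / 288 : ℝ)).mul m₁)).congr_of_eventuallyEq
      (Filter.Eventually.of_forall fun x ↦ ?_)
    simp only [Pi.mul_apply, Pi.add_apply]
    ring
  have y₁ := contMDiffAt_inner he.smooth₁ hY
  have y₂ := contMDiffAt_inner he.smooth₂ hY
  have u₁ := contMDiffAt_inner he.smooth₁ hU
  have u₂ := contMDiffAt_inner he.smooth₂ hU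
  have hbil (x : M) (w : TangentSpace (𝓡 2) x) (a b c d : ℝ) :
      (inner ℝ (B x (a • e₁ x + b • e₂ x) (c • e₁ x + d • e₂ x)) (rot o x w) : ℝ) =
      a * c * inner ℝ (B x (e₁ x) (e₁ x)) (rot o x w) +
      (a * d + b * c) * inner ℝ (B x (e₁ x) w) (rot o x (e₂ x)) +
      b * d * inner ℝ (B x (e₂ x) (e₂ x)) (rot o x w) := by
    simp only [map_add, map_smul, add_apply, smul_apply,
      inner_add_left, inner_smul_left, conj_trivial]
    rw [h.symm x (e₂ x) (e₁ x), h.symm_rot x (e₁ x) (e₂ x) w]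
    ring
  -- The frame components of `B(Y, U)` are `-⟨B(Y, U), Je₂⟩` and `⟨B(Y, U), Je₁⟩`, which expand into
  -- the four smooth coefficients.
  refine he.smoothFieldAt ?_ ?_
  · refine (((((y₁.mul u₁).mul m₃).add (((y₁.mul u₂).add (y₂.mul u₁)).mul m₄)).add
      ((y₂.mul u₂).mul m₂)).neg).congr_of_eventuallyEq ?_
    filter_upwards [h1] with x hx
    have h2 := hx.rot 0 1
    rw [zero_smul, one_smul, zero_add, zero_smul, add_zero] at h2
    have h3 := hbil x (e₂ x) (inner ℝ (e₁ x) (Y x)) (inner ℝ (e₂ x) (Y x))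
      (inner ℝ (e₁ x) (U x)) (inner ℝ (e₂ x) (U x))
    rw [← hx.eq (Y x), ← hx.eq (U x), h.symm x (e₁ x) (e₂ x),
      h.symm_rot x (e₂ x) (e₁ x) (e₂ x)] at h3
    conv_lhs at h3 => rw [h2, neg_smul, one_smul, inner_neg_right, real_inner_comm]
    simp only [Pi.mul_apply, Pi.add_apply]
    linear_combination -h3
  · refine ((((y₁.mul u₁).mul m₁).add (((y₁.mul u₂).add (y₂.mul u₁)).mul m₃)).add
      ((y₂.mul u₂).mul m₄)).congr_of_eventuallyEq ?_
    filter_upwards [h1] with x hx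
    have h2 := hx.rot 1 0
    rw [zero_smul, one_smul, add_zero, one_smul, neg_zero, zero_smul, zero_add] at h2
    have h3 := hbil x (e₁ x) (inner ℝ (e₁ x) (Y x)) (inner ℝ (e₂ x) (Y x))
      (inner ℝ (e₁ x) (U x)) (inner ℝ (e₂ x) (U x))
    rw [← hx.eq (Y x), ← hx.eq (U x)] at h3
    conv_lhs at h3 => rw [h2, real_inner_comm]
    simp only [Pi.mul_apply, Pi.add_apply]
    exact h3

/-- The function `v ↦ ⟨B(v, v), v⟩` is smooth. -/
theorem Represents.contMDiffAt_inner (h : Represents o B lam)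
    (hlam : IsSmoothOnUnitTangentBundle lam) (q : TangentBundle (𝓡 2) M) :
    ContMDiffAt (𝓡 2).tangent 𝓘(ℝ, ℝ) ∞
      (fun r : TangentBundle (𝓡 2) M ↦ (inner ℝ (B r.1 r.2 r.2) r.2 : ℝ)) q := by
  obtain ⟨e₁, e₂, he⟩ := exists_isOrthonormalFrameAt o q.1
  have a₁ := contMDiffAt_inner_frame he.smooth₁
  have a₂ := contMDiffAt_inner_frame he.smooth₂
  have hB {Y U : Π x : M, TangentSpace (𝓡 2) x} (hY : SmoothFieldAt Y q.1)
      (hU : SmoothFieldAt U q.1) : ContMDiffAt (𝓡 2).tangent 𝓘(ℝ, ℝ) ∞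
        (fun r : TangentBundle (𝓡 2) M ↦ (inner ℝ (B r.1 (Y r.1) (U r.1)) r.2 : ℝ)) q :=
    contMDiffAt_inner_frame (h.smoothFieldAt hlam hY hU)
  refine ((((a₁.mul a₁).mul (hB he.smooth₁ he.smooth₁)).add
    ((contMDiffAt_const (c := (2 : ℝ)).mul (a₁.mul a₂)).mul (hB he.smooth₁ he.smooth₂))).add
    ((a₂.mul a₂).mul (hB he.smooth₂ he.smooth₂))).congr_of_eventuallyEq ?_
  filter_upwards [continuous_proj_tangentBundle.continuousAt.eventually he.eventually_eq] with r hr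
  have key (a b : ℝ) (w : TangentSpace (𝓡 2) r.1) :
      (inner ℝ (B r.1 (a • e₁ r.1 + b • e₂ r.1) (a • e₁ r.1 + b • e₂ r.1)) w : ℝ) =
      a * a * inner ℝ (B r.1 (e₁ r.1) (e₁ r.1)) w +
        2 * (a * b) * inner ℝ (B r.1 (e₁ r.1) (e₂ r.1)) w +
        b * b * inner ℝ (B r.1 (e₂ r.1) (e₂ r.1)) w := by
    simp only [map_add, map_smul, add_apply, smul_apply,
      inner_add_left, inner_smul_left, conj_trivial]
    rw [h.symm r.1 (e₂ r.1) (e₁ r.1)]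
    ring
  have h3 := key (inner ℝ (e₁ r.1) r.2) (inner ℝ (e₂ r.1) r.2) r.2
  rw [← hr] at h3
  exact h3

/-- The thermostat with intensity `-⟨B(v, v), Jv⟩` is projective. -/
theorem Represents.isProjectiveThermostat (h : Represents o B lam)
    (hlam : IsSmoothOnUnitTangentBundle lam) : IsProjectiveThermostat o lam := by
  refine ⟨(leviCivita (𝓡 2) M).addOneForm B,
    contMDiffCovariantDerivative_leviCivita_addOneForm o (h.smoothFieldAt hlam),
    torsion_addOneForm_eq_zero torsion_leviCivita h.symm, fun γ s hs hs' hγ ↦ ?_⟩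
  -- This is the tangential acceleration of the orbit for the new connection, the part that the
  -- change of parameter has to absorb.
  let f : ℝ → ℝ := fun t ↦ inner ℝ (B _ (γ t).1.2 (γ t).1.2) (γ t).1.2
  have hf : ContDiffOn ℝ ∞ f s := fun t ht ↦
    (ContMDiffAt.comp t (g := fun r : TangentBundle (𝓡 2) M ↦ (inner ℝ (B r.1 r.2 r.2) r.2 : ℝ))
      (f := fun r ↦ (γ r).1) (h.contMDiffAt_inner hlam (γ t).1) (hγ.contMDiffAt hlam hs ht)).contDiffAt.contDiffWithinAt
  obtain ⟨φ, s', hs₁, hs₂, hφ, hφ'⟩ := exists_isReparametrization hs hs' hf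
  refine ⟨φ, s', hs₁, hs₂, hφ, fun t ht ↦ ContMDiffAt.contMDiffWithinAt ?_, fun t ht ↦ ?_⟩
  · have h1 := hγ.contMDiffAt hlam hs (hφ.bijOn.mapsTo ht)
    have h2 : ContMDiffAt 𝓘(ℝ, ℝ) (𝓡 2) ∞ (fun r ↦ (γ r).1.1) (φ t) :=
      ContMDiffAt.comp (φ t) (Bundle.contMDiffAt_proj (fun x : M ↦ TangentSpace (𝓡 2) x)) h1
    exact ContMDiffAt.comp t (g := fun r ↦ (γ r).1.1) h2 (hφ.contDiffOn.contDiffAt (hs₁.mem_nhds ht)).contMDiffAt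
  · have ht' := hφ.bijOn.mapsTo ht
    have hd : ∀ᶠ r in 𝓝 t, DifferentiableAt ℝ φ r := by
      filter_upwards [hs₁.mem_nhds ht] with r hr
      exact (hφ.contDiffOn.contDiffAt (hs₁.mem_nhds hr)).differentiableAt (by simp)
    have hv : ∀ᶠ r in 𝓝 (φ t), HasVelocityAt (J := 𝓡 2) (fun r ↦ (γ r).1.1) r (γ r).1.2 := by
      filter_upwards [hs.mem_nhds ht'] with r hr
      exact (isOrbitOn_iff.1 hγ r hr).1
    have h1 := (isOrbitOn_iff.1 hγ _ ht').2.change ((leviCivita (𝓡 2) M).addOneForm B)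
      (Z := fun r ↦ (γ r).1) hv.self_of_nhds
    have h2 := hasCovDerivAlong_velocity_comp (Z := fun r ↦ (γ r).1) h1 hv hd (hφ' t ht)
    refine (congrArg (HasCovDerivAlong ((leviCivita (𝓡 2) M).addOneForm B)
      (velocity (𝓡 2) (fun s ↦ (γ (φ s)).1.1)) t) ?_).mp h2
    -- In the frame `v, Jv` one has `B(v, v) = f v - λ Jv`: the normal part cancels `λ Jv`, and the
    -- tangential part `a² f v` cancels `φ'' v`.
    have key (p : UnitTangentBundle M) (a : ℝ) :
        (-(inner ℝ (B _ p.1.2 p.1.2) p.1.2) * a ^ 2 : ℝ) • p.1.2 +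
          a • a • (lam p • rot o _ p.1.2 +
            ((leviCivita (𝓡 2) M).addOneForm B (FiberBundle.extend Plane p.1.2) p.1.1 p.1.2 -
              leviCivita (𝓡 2) M (FiberBundle.extend Plane p.1.2) p.1.1 p.1.2)) = 0 := by
      have h3 : (leviCivita (𝓡 2) M).addOneForm B (FiberBundle.extend Plane p.1.2) p.1.1 p.1.2 =
          leviCivita (𝓡 2) M (FiberBundle.extend Plane p.1.2) p.1.1 p.1.2 +
            B p.1.1 p.1.2 p.1.2 := by
        change leviCivita (𝓡 2) M (FiberBundle.extend Plane p.1.2) p.1.1 p.1.2 +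
            B p.1.1 (FiberBundle.extend Plane p.1.2 p.1.1) p.1.2 = _
        rw [FiberBundle.extend_apply_self]
      have h4 : B p.1.1 p.1.2 p.1.2 = (inner ℝ p.1.2 (B p.1.1 p.1.2 p.1.2) : ℝ) • p.1.2 +
          (inner ℝ (rot o p.1.1 p.1.2) (B p.1.1 p.1.2 p.1.2) : ℝ) • rot o p.1.1 p.1.2 :=
        eq_frame (o.orient p.1.1) p.2 _
      rw [h3, add_sub_cancel_left, h.eq_neg_inner p,
        real_inner_comm p.1.2 (B p.1.1 p.1.2 p.1.2),
        real_inner_comm (rot o p.1.1 p.1.2) (B p.1.1 p.1.2 p.1.2)]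
      exact smul_add_smul_eq_zero h4 a
    exact key (γ (φ t)) (deriv φ t)

end RiemannianGeometry

theorem proposition3 {M : Type*} [TopologicalSpace M] [T2Space M] [SecondCountableTopology M]
    [ConnectedSpace M] [ChartedSpace (EuclideanSpace ℝ (Fin 2)) M] [IsManifold (𝓡 2) ∞ M]
    [RiemannianBundle (fun x : M ↦ TangentSpace (𝓡 2) x)]
    [IsContMDiffRiemannianBundle (𝓡 2) ∞ (EuclideanSpace ℝ (Fin 2))
      (fun x : M ↦ TangentSpace (𝓡 2) x)]
    (o : RiemannianGeometry.SurfaceOrientation M)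
    (lam : RiemannianGeometry.UnitTangentBundle M → ℝ)
    (hlam : RiemannianGeometry.IsSmoothOnUnitTangentBundle lam) :
    RiemannianGeometry.IsProjectiveThermostat o lam ↔
      (fun p ↦ (lam p : ℂ)) ∈
        RiemannianGeometry.fourierMode o (-1) ⊔ RiemannianGeometry.fourierMode o 1 ⊔
          RiemannianGeometry.fourierMode o (-3) ⊔ RiemannianGeometry.fourierMode o 3 :=
  ⟨fun h ↦ (h.isFiberwiseCubic hlam).mem hlam, fun h ↦ by
    obtain ⟨B, hB⟩ := (RiemannianGeometry.isFiberwiseCubic_of_mem h).exists_represents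
    exact hB.isProjectiveThermostat hlam⟩
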